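/- All measures are probability measures on $\mathbb R$ with finite moments $s_m(\mu)=\int x^m\,d\mu$. The Jacobi parameters $J(\mu)=\begin{pmatrix}\beta_0,&\beta_1,&\dots\\ \gamma_0,&\gamma_1,&\dots\end{pmatrix}$, $\gamma_m\ge 0$, are the coefficients of a recursion $P_0=1$, $xP_m=P_{m+1}+\beta_mP_m+\gamma_{m-1}P_{m-1}$ ($P_{-1}=0$) whose solutions are orthogonal with respect to $\mu$. The terms after the first $\gamma_m=0$ (if there is one) are not determined by $\mu$; they may be filled in by arbitrary $\beta_m\in\mathbb R$, $\gamma_m\ge0$, and statements about the individual parameters disregard them. The free cumulants $r_n(\mu)$ and the two-state free cumulants $R_n(\widetilde\mu,\mu)$ are defined by $$s_m(\mu)=\sum_{\pi\in NC(m)}\prod_{V\in\pi}r_{|V|}(\mu),\qquad s_m(\widetilde\mu)=\sum_{\pi\in NC(m)}\ \prod_{V\ \mathrm{outer}}R_{|V|}(\widetilde\mu,\mu)\prod_{U\ \mathrm{inner}}r_{|U|}(\mu)\qquad(m\ge1),$$ where $NC(m)$ is the set of noncrossing partitions of $\{1,\dots,m\}$, and a block $U$ of $\pi$ is inner if $\min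 V\le\min U$ and $\max U\le\max V$ for some other block $V$ of $\pi$, and outer otherwise. For real $t\ge0$, $(\widetilde\mu_t,\mu_t)=(\widetilde\mu,\mu)^{\boxplus_c t}$ means $r_n(\mu_t)=t\,r_n(\mu)$ and $R_n(\widetilde\mu_t,\mu_t)=t\,R_n(\widetilde\mu,\mu)$ for all $n\ge1$. The pair $(\widetilde\mu,\mu)$ is $\boxplus_c$-infinitely divisible if for every $n\ge1$ it equals $(\widetilde\nu,\nu)^{\boxplus_c n}$ for some pair $(\widetilde\nu,\nu)$. A free Meixner distribution is a measure with $J=\begin{pmatrix}\beta_0,&b+\beta_0,&b+\beta_0,&\dots\\ \gamma_0,&c+\gamma_0,&c+\gamma_0,&\dots\end{pmatrix}$, $\gamma_0\ge0$, $c+\gamma_0\ge0$. **Theorem.** Let $(\widetilde\mu,\mu)$ be a pair of measures with Jacobi parameters $\widetilde\beta_m,\widetilde\gamma_m$ and $\beta_m,\gamma_m$ respectively. (1) Assume that neither $\widetilde\mu$ nor $\mu$ is a point mass and that, for the powers $(\widetilde\mu_t,\mu_t)=(\widetilde\mu,\mu)^{\boxplus_c t}$, $t=1,2,3,\dots$,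 all Jacobi parameters of $\widetilde\mu_t$ are polynomials in $t$. Then $$\beta_1=\widetilde\beta_2=\beta_2=\widetilde\beta_3=\beta_3=\cdots,\qquad \gamma_1=\widetilde\gamma_2=\gamma_2=\widetilde\gamma_3=\gamma_3=\cdots,\tag{$*$}$$ so that $$J(\widetilde\mu)=\begin{pmatrix}\widetilde\beta_0,&\widetilde\beta_1,&\beta_1,&\beta_1,&\dots\\ \widetilde\gamma_0,&\widetilde\gamma_1,&\gamma_1,&\gamma_1,&\dots\end{pmatrix},\qquad J(\mu)=\begin{pmatrix}\beta_0,&\beta_1,&\beta_1,&\dots\\ \gamma_0,&\gamma_1,&\gamma_1,&\dots\end{pmatrix},$$ and $\mu$ is a free Meixner distribution. (2) Conversely, suppose that $(*)$ holds (point masses are allowed) and put $\widetilde b=\widetilde\beta_1-\beta_0$, $b=\beta_1-\beta_0$, $\widetilde c=\widetilde\gamma_1-\gamma_0$, $c=\gamma_1-\gamma_0$. (a) For every real $t\ge0$ with $c+\gamma_0t\ge0$ and $\widetilde c+\gamma_0t\ge0$ the power $(\widetilde\mu_t,\mu_t)=(\widetilde\mu,\mu)^{\boxplus_c t}$ exists,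 and $$J(\widetilde\mu_t)=\begin{pmatrix}\widetilde\beta_0t,&\widetilde b+\beta_0t,&b+\beta_0t,&b+\beta_0t,&\dots\\ \widetilde\gamma_0t,&\widetilde c+\gamma_0t,&c+\gamma_0t,&c+\gamma_0t,&\dots\end{pmatrix},\qquad J(\mu_t)=\begin{pmatrix}\beta_0t,&b+\beta_0t,&b+\beta_0t,&\dots\\ \gamma_0t,&c+\gamma_0t,&c+\gamma_0t,&\dots\end{pmatrix}.$$ (b) If $\widetilde\mu$ is not a point mass, then $(\widetilde\mu,\mu)$ is $\boxplus_c$-infinitely divisible if and only if $c\ge0$ and $\widetilde c\ge0$. If $\widetilde\mu$ is a point mass (so that $\widetilde c$ is not determined by the pair), it is $\boxplus_c$-infinitely divisible if and only if $c\ge0$. (c) If $c\ge0$ and $\widetilde c\ge0$, then for all complex $z$ in some neighbourhood of $0$ $$R^{\widetilde\mu,\mu}(z):=\sum_{k\ge1}R_k(\widetilde\mu,\mu)z^k=\widetilde\beta_0z+\widetilde\gamma_0z^2\int_{\mathbb R}\frac{d\widetilde\rho(x)}{1-xz},$$ where $\widetilde\rho$ is a free Meixner probability measure with $J(\widetilde\rho)=\begin{pmatrix}\widetilde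 b,&b,&b,&\dots\\ \widetilde c,&c,&c,&\dots\end{pmatrix}$. -/

import Mathlib

namespace TwoState

open MeasureTheory Polynomial

noncomputable section

/-! ### Noncrossing partitions -/

/-- A partition of a finite set of integers is noncrossing if `x₁ < x₂ < x₃ < x₄`, `x₁, x₃ ∈ V₁`
and `x₂, x₄ ∈ V₂` force `V₁ = V₂`. -/
def IsNoncrossing {s : Finset ℕ} (π : Finpartition s) : Prop :=
  ∀ V₁ ∈ π.parts, ∀ V₂ ∈ π.parts, ∀ x₁ x₂ x₃ x₄ : ℕ, x₁ < x₂ → x₂ < x₃ → x₃ < x₄ →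
    x₁ ∈ V₁ → x₃ ∈ V₁ → x₂ ∈ V₂ → x₄ ∈ V₂ → V₁ = V₂

/-- `U ⪯ V`: some `r, s ∈ V` satisfy `r ≤ k ≤ s` for every `k ∈ U`. -/
def IsCovered (U V : Finset ℕ) : Prop :=
  ∃ r ∈ V, ∃ s ∈ V, ∀ k ∈ U, r ≤ k ∧ k ≤ s

/-- A block `U` of `π` is inner if `U ⪯ V` for some other block `V`; otherwise it is outer. -/
def IsInner {s : Finset ℕ} (π : Finpartition s) (U : Finset ℕ) : Prop :=
  ∃ V ∈ π.parts, V ≠ U ∧ IsCovered U V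

open scoped Classical in
/-- The noncrossing partitions of an `m`-element chain. -/
def NC (m : ℕ) : Finset (Finpartition (Finset.range m)) :=
  Finset.univ.filter fun π => IsNoncrossing π

open scoped Classical in
/-- The inner blocks of a partition. -/
def innerBlocks {s : Finset ℕ} (π : Finpartition s) : Finset (Finset ℕ) :=
  π.parts.filter fun U => IsInner π U

open scoped Classical in
/-- The outer blocks of a partition. -/
def outerBlocks {s : Finset ℕ} (π : Finpartition s) : Finset (Finset ℕ) :=
  π.parts.filter fun U => ¬ IsInner π U

open scoped Classical in
/-- The noncrossing partitions of an `m`-element chain other than the one-block partition. -/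
def properNC (m : ℕ) : Finset (Finpartition (Finset.range m)) :=
  (NC m).filter fun π => π.parts ≠ {Finset.range m}

/-! ### Moments and cumulants -/

/-- All moments of `μ` are finite. -/
def HasAllMoments (μ : Measure ℝ) : Prop :=
  ∀ n : ℕ, Integrable (fun x : ℝ => x ^ n) μ

/-- The moment `s_m(μ)`. -/
def rawMoment (μ : Measure ℝ) (m : ℕ) : ℝ := ∫ x, x ^ m ∂μ

/-- The free cumulants `r_m(μ)`: the moment-cumulant formula
`s_m(μ) = ∑_{π ∈ NC(m)} ∏_{V ∈ π} r_{|V|}(μ)` (see `rawMoment_eq_sum_freeCumulant`), solved for the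
term of the one-block partition. The guard `V.card < m` always holds for the partitions in the
sum; it is there for the termination of the recursion. -/
def freeCumulant (μ : Measure ℝ) (m : ℕ) : ℝ :=
  rawMoment μ m - ∑ π ∈ properNC m,
    ∏ V ∈ π.parts, if _h : V.card < m then freeCumulant μ V.card else 0
termination_by m

/-- The two-state free cumulants `R_m(μ', μ)`: the moment-cumulant formula
`s_m(μ') = ∑_{π ∈ NC(m)} ∏_{V outer} R_{|V|}(μ', μ) ∏_{U inner} r_{|U|}(μ)`
(see `rawMoment_eq_sum_cfreeCumulant`), solved for the term of the one-block partition. -/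
def cfreeCumulant (μ' μ : Measure ℝ) (m : ℕ) : ℝ :=
  rawMoment μ' m - ∑ π ∈ properNC m,
    (∏ V ∈ outerBlocks π, if _h : V.card < m then cfreeCumulant μ' μ V.card else 0) *
      ∏ U ∈ innerBlocks π, freeCumulant μ U.card
termination_by m

theorem card_lt_of_mem_properNC {m : ℕ} {π : Finpartition (Finset.range m)}
    (hπ : π ∈ properNC m) {V : Finset ℕ} (hV : V ∈ π.parts) : V.card < m := by
  classical
  have hne : π.parts ≠ {Finset.range m} := (Finset.mem_filter.1 hπ).2
  have hsub : V ⊆ Finset.range m := π.le hV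
  rcases lt_or_ge V.card m with h | h
  · exact h
  · exfalso
    have hVeq : V = Finset.range m :=
      Finset.eq_of_subset_of_card_le hsub (by simpa using h)
    apply hne
    ext U
    rw [Finset.mem_singleton]
    constructor
    · intro hU
      by_contra hUV
      have hd : Disjoint U V := π.disjoint hU hV (by rw [hVeq]; exact hUV)
      have hUs : U ⊆ V := by rw [hVeq]; exact π.le hU
      exact π.ne_bot hU (hd.eq_bot_of_le hUs)
    · intro hU
      have hUV : U = V := hU.trans hVeq.symm
      rw [hUV]
      exact hV

/-- The one-block partition. -/
def oneBlock {m : ℕ} (hm : 1 ≤ m) : Finpartition (Finset.range m) :=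
  Finpartition.indiscrete (a := Finset.range m)
    (by rw [Finset.bot_eq_empty, Ne, Finset.range_eq_empty_iff]; omega)

theorem oneBlock_parts {m : ℕ} (hm : 1 ≤ m) : (oneBlock hm).parts = {Finset.range m} := rfl

theorem sum_NC_eq {m : ℕ} (hm : 1 ≤ m) (f : Finpartition (Finset.range m) → ℝ) :
    ∑ π ∈ NC m, f π = f (oneBlock hm) + ∑ π ∈ properNC m, f π := by
  classical
  have hmem : oneBlock hm ∈ NC m := by
    refine Finset.mem_filter.2 ⟨Finset.mem_univ _, ?_⟩
    intro V₁ h₁ V₂ h₂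
    rw [oneBlock_parts, Finset.mem_singleton] at h₁ h₂
    intros
    rw [h₁, h₂]
  have hE : properNC m = (NC m).erase (oneBlock hm) := by
    ext π
    simp only [properNC, Finset.mem_filter, Finset.mem_erase]
    rw [and_comm]
    refine and_congr_left fun _ => not_congr ?_
    constructor
    · intro h
      exact Finpartition.ext (by rw [h, oneBlock_parts])
    · rintro rfl
      rfl
  rw [hE, Finset.add_sum_erase _ _ hmem]

theorem rawMoment_eq_sum_freeCumulant (μ : Measure ℝ) {m : ℕ} (hm : 1 ≤ m) :
    rawMoment μ m = ∑ π ∈ NC m, ∏ V ∈ π.parts, freeCumulant μ V.card := by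
  rw [sum_NC_eq hm, oneBlock_parts, Finset.prod_singleton, Finset.card_range, freeCumulant]
  have : ∑ π ∈ properNC m, ∏ V ∈ π.parts,
        (if _h : V.card < m then freeCumulant μ V.card else 0)
      = ∑ π ∈ properNC m, ∏ V ∈ π.parts, freeCumulant μ V.card :=
    Finset.sum_congr rfl fun π hπ => Finset.prod_congr rfl fun V hV =>
      dif_pos (card_lt_of_mem_properNC hπ hV)
  rw [this]
  ring

theorem rawMoment_eq_sum_cfreeCumulant (μ' μ : Measure ℝ) {m : ℕ} (hm : 1 ≤ m) :
    rawMoment μ' m = ∑ π ∈ NC m, (∏ V ∈ outerBlocks π, cfreeCumulant μ' μ V.card) *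
      ∏ U ∈ innerBlocks π, freeCumulant μ U.card := by
  classical
  have hno : ∀ U ∈ (oneBlock hm).parts, ¬ IsInner (oneBlock hm) U := by
    rintro U hU ⟨V, hV, hVU, -⟩
    rw [oneBlock_parts, Finset.mem_singleton] at hU hV
    exact hVU (hV.trans hU.symm)
  have hout : outerBlocks (oneBlock hm) = {Finset.range m} := by
    rw [outerBlocks, Finset.filter_true_of_mem hno, oneBlock_parts]
  have hinn : innerBlocks (oneBlock hm) = ∅ := by
    rw [innerBlocks, Finset.filter_false_of_mem hno]
  rw [sum_NC_eq hm, hout, hinn, Finset.prod_singleton, Finset.prod_empty, mul_one,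
    Finset.card_range, cfreeCumulant]
  have : ∑ π ∈ properNC m,
        (∏ V ∈ outerBlocks π, if _h : V.card < m then cfreeCumulant μ' μ V.card else 0) *
          ∏ U ∈ innerBlocks π, freeCumulant μ U.card
      = ∑ π ∈ properNC m, (∏ V ∈ outerBlocks π, cfreeCumulant μ' μ V.card) *
          ∏ U ∈ innerBlocks π, freeCumulant μ U.card :=
    Finset.sum_congr rfl fun π hπ => congrArg₂ _ (Finset.prod_congr rfl fun V hV =>
      dif_pos (card_lt_of_mem_properNC hπ (Finset.mem_filter.1 hV).1)) rfl
  rw [this]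
  ring

/-! ### Two-state free powers -/

/-- `(ν', ν)` is the two-state free (conditionally free) power `(μ', μ)^{⊞_c t}`:
`r_n(ν) = t r_n(μ)` and `R_n(ν', ν) = t R_n(μ', μ)` for all `n ≥ 1`. -/
structure IsCFreePower (t : ℝ) (μ' μ ν' ν : Measure ℝ) : Prop where
  isProbabilityMeasure' : IsProbabilityMeasure ν'
  isProbabilityMeasure : IsProbabilityMeasure ν
  hasAllMoments' : HasAllMoments ν'
  hasAllMoments : HasAllMoments ν
  freeCumulant_eq : ∀ n : ℕ, 1 ≤ n → freeCumulant ν n = t * freeCumulant μ n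
  cfreeCumulant_eq : ∀ n : ℕ, 1 ≤ n → cfreeCumulant ν' ν n = t * cfreeCumulant μ' μ n

/-- `(μ', μ)` is `⊞_c`-infinitely divisible: for every `n ≥ 1` it is the `n`-th two-state free
power of some pair of probability measures (with finite moments). -/
def IsCFreeInfinitelyDivisible (μ' μ : Measure ℝ) : Prop :=
  ∀ n : ℕ, 1 ≤ n → ∃ ν' ν : Measure ℝ, IsProbabilityMeasure ν' ∧ IsProbabilityMeasure ν ∧
    HasAllMoments ν' ∧ HasAllMoments ν ∧ IsCFreePower n ν' ν μ' μ

/-! ### Jacobi parameters -/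

/-- The monic polynomials with `P₀ = 1`, `x P_m = P_{m+1} + β_m P_m + γ_{m-1} P_{m-1}`,
`P_{-1} = 0`. -/
def jacobiPoly (β γ : ℕ → ℝ) : ℕ → ℝ[X]
  | 0 => 1
  | 1 => X - C (β 0)
  | n + 2 => (X - C (β (n + 1))) * jacobiPoly β γ (n + 1) - C (γ n) * jacobiPoly β γ n

/-- `J(μ) = (β; γ)`. If `μ` is supported on exactly `N < ∞` points then `γ_{N-1}` is the first zero
of `γ`, and nothing but `γ_m ≥ 0` is required of the terms with index `m ≥ N` (the polynomials
`P_m`, `m ≥ N`, vanish `μ`-almost everywhere whatever these terms are). -/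
structure HasJacobiParameters (μ : Measure ℝ) (β γ : ℕ → ℝ) : Prop where
  nonneg : ∀ n, 0 ≤ γ n
  orthogonal : ∀ m n : ℕ, m ≠ n →
    ∫ x, (jacobiPoly β γ m).eval x * (jacobiPoly β γ n).eval x ∂μ = 0

/-- The Jacobi parameters `β_n, γ_n` are genuine, that is, no earlier `γ_k` vanishes;
the terms after the first `γ_k = 0` are to be disregarded. -/
def IsGenuine (γ : ℕ → ℝ) (n : ℕ) : Prop := ∀ k < n, γ k ≠ 0

/-- All the (genuine) Jacobi parameters of `ν t` are polynomials in `t = 1, 2, 3, …`. -/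
def HasPolynomialJacobiParameters (ν : ℕ → Measure ℝ) : Prop :=
  ∃ B G : ℕ → ℕ → ℝ, (∀ t : ℕ, 1 ≤ t → HasJacobiParameters (ν t) (B t) (G t)) ∧
    ∀ n : ℕ, ∃ p q : ℝ[X], ∀ t : ℕ, 1 ≤ t → IsGenuine (G t) n →
      B t n = p.eval (t : ℝ) ∧ G t n = q.eval (t : ℝ)

/-- `μ` is a point mass. -/
def IsPointMass (μ : Measure ℝ) : Prop := ∃ a : ℝ, μ = Measure.dirac a

/-- The sequence `a₀, a₁, a₁, a₁, …`. -/
def tail₁ (a₀ a₁ : ℝ) : ℕ → ℝ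
  | 0 => a₀
  | _ + 1 => a₁

/-- The sequence `a₀, a₁, a₂, a₂, a₂, …`. -/
def tail₂ (a₀ a₁ a₂ : ℝ) : ℕ → ℝ
  | 0 => a₀
  | 1 => a₁
  | _ + 2 => a₂

/-- Free Meixner distributions. -/
def IsFreeMeixner (μ : Measure ℝ) : Prop :=
  ∃ β₀ γ₀ b c : ℝ, 0 ≤ γ₀ ∧ 0 ≤ c + γ₀ ∧
    HasJacobiParameters μ (tail₁ β₀ (b + β₀)) (tail₁ γ₀ (c + γ₀))

/-- The relations `β₁ = β'₂ = β₂ = β'₃ = β₃ = …` and `γ₁ = γ'₂ = γ₂ = γ'₃ = γ₃ = …`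
between the genuine Jacobi parameters of two measures. -/
def JacobiRelations (β' γ' β γ : ℕ → ℝ) : Prop :=
  ∀ n : ℕ, 1 ≤ n →
    (IsGenuine γ n → β n = β 1 ∧ γ n = γ 1) ∧
    (IsGenuine γ' (n + 1) → β' (n + 1) = β 1 ∧ γ' (n + 1) = γ 1)

end

end TwoState

open MeasureTheory TwoState

/-! Let M, M' be the moment series of μ, μ', and let A, H be the series with coefficients r_{k+1},
R_{k+1}. Splitting a noncrossing partition at the last point of its first block turns the
moment-cumulant formulas into M = 1 + X A(XM) M and M' = 1 + X H(XM) M' (`isCFreeMoment_ncSeries`).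
Jacobi parameters are the coefficients of the continued fraction J = 1 + β₀ X J + γ₀ X² J J₁ of the
moment series, J₁ having the shifted parameters (`HasJacobiParameters.momentSeries`,
`hasJacobiParameters_of_momentSeries`). The theorem thus becomes a matter of formal power series.

The converse rests on `compX_const_mul` and `compX_constTail_mul`. If M has parameters β₀, b+β₀, …;
γ₀, c+γ₀, …, then f ↦ f(XM) M sends the continued fraction b', b, b, …; c', c, c, … to the one with
every β raised by β₀ and every γ by γ₀. Hence (∗) gives A = β₀ + γ₀ X J(b; c) and H = β₀' + γ₀' X
J(b', b, …; c', c, …), and a power t only multiplies β₀, γ₀, β₀', γ₀' by t. Measures for the new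
parameters come from Favard's theorem (`exists_measure_of_bounded`). Infinite divisibility forces
the signs because the square norm γ₀γ₁ of P₂ is nonnegative for every n-th root. The integral
formula says that the tail of H is γ₀' times the moment series of a measure.

For part (1) write A = β₀ + Xκ with κ(0) = γ₀ =: σ, and H = β₀' + γ₀' Xρ. With M_t the moment series
of μ_t, the parameters of μ'_t from index 1 on are those of N_t = ρ(XM_t) M_t. After centering by
tβ₀ and dilating by ε = 1/√t, all N_t are values of a single power series N over ℝ[ε]
(`homog_series_eval`), and N is the semicircle series of variance σ at ε = 0. So ε(B_t - tβ₀) → 0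
and ε²G_t → σ, where B_t, G_t are the parameters of N_t; polynomials in t with this growth are B_t =
tβ₀ + b_n and G_t = σt + c_n (`exists_affine_params`), and N is the continued fraction with
parameters εb_n, σ + ε²c_n.

Modulo ε³ the series N depends only on the first three coefficients of κ and ρ, yet still determines
all b_n and c_n (`homog_params_unique`). A free Meixner pair with the same first three coefficients
therefore has the same N, and N determines κ and ρ (`homog_pair_unique`). So κ and ρ are of free
Meixner type (`meixner_of_polynomial_params`). -/

namespace TwoState

noncomputable section

/-! ### Recursions for sums over noncrossing partitions -/

section Noncrossing

open Finset
open scoped Classical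

/-- `P` is the set of blocks of a noncrossing partition of `s`. -/
structure IsNCBlocks (s : Finset ℕ) (P : Finset (Finset ℕ)) : Prop where
  nonempty : ∀ V ∈ P, V.Nonempty
  subset : ∀ V ∈ P, V ⊆ s
  cover : ∀ x ∈ s, ∃ V ∈ P, x ∈ V
  eq_of_mem : ∀ V ∈ P, ∀ W ∈ P, ∀ x, x ∈ V → x ∈ W → V = W
  noncrossing : ∀ V ∈ P, ∀ W ∈ P, ∀ x₁ x₂ x₃ x₄ : ℕ, x₁ < x₂ → x₂ < x₃ → x₃ < x₄ →
    x₁ ∈ V → x₃ ∈ V → x₂ ∈ W → x₄ ∈ W → V = W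

/-- The block sets of the noncrossing partitions of `s`. -/
def ncBlocks (s : Finset ℕ) : Finset (Finset (Finset ℕ)) :=
  s.powerset.powerset.filter fun P => IsNCBlocks s P

lemma mem_ncBlocks {s : Finset ℕ} {P : Finset (Finset ℕ)} : P ∈ ncBlocks s ↔ IsNCBlocks s P := by
  simp only [ncBlocks, mem_filter, mem_powerset, and_iff_right_iff_imp]
  intro h V hV
  exact mem_powerset.2 (h.subset V hV)

/-- Being inner, as a property of block sets. -/
def InnerIn (P : Finset (Finset ℕ)) (U : Finset ℕ) : Prop :=
  ∃ V ∈ P, V ≠ U ∧ IsCovered U V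

/-- The block of `P` that contains `a`. -/
def blockOf (a : ℕ) (P : Finset (Finset ℕ)) : Finset ℕ := (P.filter (a ∈ ·)).sup id

/-- The blocks of `P` that do not contain `a`. -/
def otherBlocks (a : ℕ) (P : Finset (Finset ℕ)) : Finset (Finset ℕ) := P.filter (a ∉ ·)

/-- Add the point `ℓ` to the block of `a`, and adjoin the blocks of `τ`. -/
def joinBlocks (a ℓ : ℕ) (σ τ : Finset (Finset ℕ)) : Finset (Finset ℕ) :=
  insert (insert ℓ (blockOf a σ)) (otherBlocks a σ ∪ τ)

lemma mem_otherBlocks {a : ℕ} {P : Finset (Finset ℕ)} {V : Finset ℕ} :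
    V ∈ otherBlocks a P ↔ V ∈ P ∧ a ∉ V := by
  simp [otherBlocks]

lemma mem_blockOf {a x : ℕ} {P : Finset (Finset ℕ)} :
    x ∈ blockOf a P ↔ ∃ V ∈ P, a ∈ V ∧ x ∈ V := by
  simp [blockOf, Finset.mem_sup, and_assoc]

lemma IsNCBlocks.blockOf_eq {s : Finset ℕ} {P : Finset (Finset ℕ)} (h : IsNCBlocks s P)
    {a : ℕ} {V : Finset ℕ} (hV : V ∈ P) (ha : a ∈ V) : blockOf a P = V := by
  ext x
  rw [mem_blockOf]
  constructor
  · rintro ⟨W, hW, haW, hx⟩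
    rwa [h.eq_of_mem V hV W hW a ha haW]
  · intro hx
    exact ⟨V, hV, ha, hx⟩

lemma IsNCBlocks.blockOf_mem {s : Finset ℕ} {P : Finset (Finset ℕ)} (h : IsNCBlocks s P)
    {a : ℕ} (ha : a ∈ s) : blockOf a P ∈ P ∧ a ∈ blockOf a P := by
  obtain ⟨V, hV, haV⟩ := h.cover a ha
  rw [h.blockOf_eq hV haV]
  exact ⟨hV, haV⟩

lemma IsNCBlocks.blockOf_subset {s : Finset ℕ} {P : Finset (Finset ℕ)} (h : IsNCBlocks s P)
    (a : ℕ) : blockOf a P ⊆ s := by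
  intro x hx
  obtain ⟨V, hV, -, hxV⟩ := mem_blockOf.1 hx
  exact h.subset V hV hxV

lemma mem_joinBlocks {a ℓ : ℕ} {σ τ : Finset (Finset ℕ)} {V : Finset ℕ} :
    V ∈ joinBlocks a ℓ σ τ ↔ V = insert ℓ (blockOf a σ) ∨ (V ∈ σ ∧ a ∉ V) ∨ V ∈ τ := by
  simp [joinBlocks, mem_otherBlocks]

section Join

variable {a b ℓ : ℕ} {σ τ : Finset (Finset ℕ)}

lemma mem_insert_blockOf (h₁ : a ≤ ℓ) (hσ : IsNCBlocks (Ico a ℓ) σ) :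
    a ∈ insert ℓ (blockOf a σ) := by
  rcases h₁.eq_or_lt with rfl | h
  · simp
  · exact mem_insert_of_mem (hσ.blockOf_mem (by simp [h])).2

lemma IsNCBlocks.le_of_mem_insert (h₁ : a ≤ ℓ) (hσ : IsNCBlocks (Ico a ℓ) σ) {x : ℕ}
    (hx : x ∈ insert ℓ (blockOf a σ)) : a ≤ x ∧ x ≤ ℓ := by
  rcases mem_insert.1 hx with rfl | hx
  · exact ⟨h₁, le_rfl⟩
  · have := mem_Ico.1 (hσ.blockOf_subset a hx)
    omega

/-- The blocks of `τ` lie to the right of all the others, and `ℓ` lies to the right of `σ`. So the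
only crossings to exclude are those of the enlarged block of `a` with other blocks of `σ`, and these
would already be crossings in `σ`. -/
lemma isNCBlocks_joinBlocks (h₁ : a ≤ ℓ) (h₂ : ℓ < b) (hσ : IsNCBlocks (Ico a ℓ) σ)
    (hτ : IsNCBlocks (Ico (ℓ + 1) b) τ) : IsNCBlocks (Ico a b) (joinBlocks a ℓ σ τ) := by
  have hB := fun x => hσ.le_of_mem_insert h₁ (x := x)
  have hS : ∀ V ∈ σ, ∀ x ∈ V, a ≤ x ∧ x < ℓ := fun V hV x hx => mem_Ico.1 (hσ.subset V hV hx)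
  have hT : ∀ V ∈ τ, ∀ x ∈ V, ℓ < x ∧ x < b := fun V hV x hx => by
    have := mem_Ico.1 (hτ.subset V hV hx); omega
  have hBσ : ∀ x ∈ insert ℓ (blockOf a σ), x < ℓ → ∃ V ∈ σ, a ∈ V ∧ x ∈ V ∧ blockOf a σ = V := by
    intro x hx hxl
    rcases mem_insert.1 hx with rfl | hx
    · omega
    · obtain ⟨V, hV, haV, hxV⟩ := mem_blockOf.1 hx
      exact ⟨V, hV, haV, hxV, hσ.blockOf_eq hV haV⟩
  have haB := mem_insert_blockOf h₁ hσ
  refine ⟨?_, ?_, ?_, ?_, ?_⟩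
  · intro V hV
    rcases mem_joinBlocks.1 hV with rfl | ⟨hV, -⟩ | hV
    · simp
    · exact hσ.nonempty V hV
    · exact hτ.nonempty V hV
  · intro V hV x hx
    rw [mem_Ico]
    rcases mem_joinBlocks.1 hV with rfl | ⟨hV, -⟩ | hV
    · have := hB x hx; omega
    · have := hS V hV x hx; omega
    · have := hT V hV x hx; omega
  · intro x hx
    rw [mem_Ico] at hx
    rcases lt_trichotomy x ℓ with h | h | h
    · obtain ⟨V, hV, hxV⟩ := hσ.cover x (by simp; omega)
      by_cases haV : a ∈ V
      · exact ⟨_, mem_joinBlocks.2 (Or.inl rfl),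
          mem_insert_of_mem (mem_blockOf.2 ⟨V, hV, haV, hxV⟩)⟩
      · exact ⟨V, mem_joinBlocks.2 (Or.inr (Or.inl ⟨hV, haV⟩)), hxV⟩
    · exact ⟨_, mem_joinBlocks.2 (Or.inl rfl), by simp [h]⟩
    · obtain ⟨V, hV, hxV⟩ := hτ.cover x (by simp; omega)
      exact ⟨V, mem_joinBlocks.2 (Or.inr (Or.inr hV)), hxV⟩
  · intro V hV W hW x hxV hxW
    rcases mem_joinBlocks.1 hV with rfl | ⟨hV, haV⟩ | hV <;>
    rcases mem_joinBlocks.1 hW with rfl | ⟨hW, haW⟩ | hW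
    · rfl
    · obtain ⟨V', hV', haV', hxV', -⟩ := hBσ x hxV (hS W hW x hxW).2
      exact absurd (hσ.eq_of_mem W hW V' hV' x hxW hxV' ▸ haV') haW
    · have := hB x hxV; have := hT W hW x hxW; omega
    · obtain ⟨V', hV', haV', hxV', -⟩ := hBσ x hxW (hS V hV x hxV).2
      exact absurd (hσ.eq_of_mem V hV V' hV' x hxV hxV' ▸ haV') haV
    · exact hσ.eq_of_mem V hV W hW x hxV hxW
    · have := hS V hV x hxV; have := hT W hW x hxW; omega
    · have := hB x hxW; have := hT V hV x hxV; omega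
    · have := hS W hW x hxW; have := hT V hV x hxV; omega
    · exact hτ.eq_of_mem V hV W hW x hxV hxW
  · intro V hV W hW x₁ x₂ x₃ x₄ h12 h23 h34 h1 h3 h2 h4
    rcases mem_joinBlocks.1 hV with rfl | ⟨hV, haV⟩ | hV <;>
    rcases mem_joinBlocks.1 hW with rfl | ⟨hW, haW⟩ | hW
    · rfl
    · have := hS W hW x₄ h4
      obtain ⟨V', hV', haV', hx1, e⟩ := hBσ x₁ h1 (by omega)
      obtain ⟨V'', -, -, hx3, e'⟩ := hBσ x₃ h3 (by omega)
      rw [← e', e] at hx3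
      exact absurd (hσ.noncrossing V' hV' W hW _ _ _ _ h12 h23 h34 hx1 hx3 h2 h4 ▸ haV') haW
    · have := hB x₃ h3; have := hT W hW x₂ h2; omega
    · -- `x₁, x₃` lie in a block of `σ` without `a`, and `a, x₂` in the new block
      have := hS V hV x₃ h3
      have := hS V hV x₁ h1
      obtain ⟨V', hV', haV', hx2, e⟩ := hBσ x₂ h2 (by omega)
      have hne : a ≠ x₁ := fun h => haV (h ▸ h1)
      exact absurd (hσ.noncrossing V' hV' V hV a x₁ x₂ x₃ (by omega) h12 h23 haV' hx2 h1 h3 ▸ haV')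
        haV
    · exact hσ.noncrossing V hV W hW _ _ _ _ h12 h23 h34 h1 h3 h2 h4
    · have := hS V hV x₃ h3; have := hT W hW x₂ h2; omega
    · have := hB x₂ h2; have := hT V hV x₁ h1; omega
    · have := hS W hW x₂ h2; have := hT V hV x₁ h1; omega
    · exact hτ.noncrossing V hV W hW _ _ _ _ h12 h23 h34 h1 h3 h2 h4

lemma blockOf_joinBlocks (h₁ : a ≤ ℓ) (h₂ : ℓ < b) (hσ : IsNCBlocks (Ico a ℓ) σ)
    (hτ : IsNCBlocks (Ico (ℓ + 1) b) τ) :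
    blockOf a (joinBlocks a ℓ σ τ) = insert ℓ (blockOf a σ) :=
  (isNCBlocks_joinBlocks h₁ h₂ hσ hτ).blockOf_eq (mem_joinBlocks.2 (Or.inl rfl))
    (mem_insert_blockOf h₁ hσ)

lemma notMem_of_mem_right (h₁ : a ≤ ℓ) (hτ : IsNCBlocks (Ico (ℓ + 1) b) τ) {V : Finset ℕ}
    (hV : V ∈ τ) : a ∉ V := fun h => by
  have := mem_Ico.1 (hτ.subset V hV h); omega

lemma otherBlocks_joinBlocks (h₁ : a ≤ ℓ) (hσ : IsNCBlocks (Ico a ℓ) σ)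
    (hτ : IsNCBlocks (Ico (ℓ + 1) b) τ) :
    otherBlocks a (joinBlocks a ℓ σ τ) = otherBlocks a σ ∪ τ := by
  ext V
  have hB := mem_insert_blockOf h₁ hσ
  have hT : V ∈ τ → a ∉ V := notMem_of_mem_right h₁ hτ
  simp only [mem_otherBlocks, mem_joinBlocks, mem_union]
  constructor
  · rintro ⟨rfl | h | h, ha⟩
    · exact absurd hB ha
    · exact Or.inl h
    · exact Or.inr h
  · rintro (h | h)
    · exact ⟨Or.inr (Or.inl h), h.2⟩
    · exact ⟨Or.inr (Or.inr h), hT h⟩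

lemma disjoint_left_right (hσ : IsNCBlocks (Ico a ℓ) σ) (hτ : IsNCBlocks (Ico (ℓ + 1) b) τ) :
    Disjoint (otherBlocks a σ) τ := by
  rw [Finset.disjoint_left]
  intro V hV hV'
  have hV := (mem_otherBlocks.1 hV).1
  obtain ⟨x, hx⟩ := hσ.nonempty V hV
  have := mem_Ico.1 (hσ.subset V hV hx)
  have := mem_Ico.1 (hτ.subset V hV' hx)
  omega

/-- Both `a` and `ℓ` belong to the enlarged block, which therefore covers everything in between. -/
lemma innerIn_joinBlocks_of_mem_left (h₁ : a ≤ ℓ) (hσ : IsNCBlocks (Ico a ℓ) σ)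
    {V : Finset ℕ} (hV : V ∈ otherBlocks a σ) : InnerIn (joinBlocks a ℓ σ τ) V := by
  have hV := mem_otherBlocks.1 hV
  have hB := mem_insert_blockOf h₁ hσ
  refine ⟨_, mem_joinBlocks.2 (Or.inl rfl), fun h => hV.2 (h ▸ hB), a, hB, ℓ, by simp, ?_⟩
  intro k hk
  have := mem_Ico.1 (hσ.subset V hV.1 hk)
  omega

/-- A covering block would have to reach down to the smallest point `a`, hence be the block of `a`
itself. -/
lemma not_innerIn_insert (h₁ : a ≤ ℓ) (h₂ : ℓ < b) (hσ : IsNCBlocks (Ico a ℓ) σ)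
    (hτ : IsNCBlocks (Ico (ℓ + 1) b) τ) :
    ¬ InnerIn (joinBlocks a ℓ σ τ) (insert ℓ (blockOf a σ)) := by
  rintro ⟨V, hV, hne, r, hr, s, -, h⟩
  have hJ := isNCBlocks_joinBlocks h₁ h₂ hσ hτ
  have hB := mem_insert_blockOf h₁ hσ
  have h1 := (h a hB).1
  have h2 := mem_Ico.1 (hJ.subset V hV hr)
  obtain rfl : r = a := by omega
  exact hne (hJ.eq_of_mem V hV _ (mem_joinBlocks.2 (Or.inl rfl)) _ hr hB)

lemma innerIn_joinBlocks_iff (h₁ : a ≤ ℓ) (hσ : IsNCBlocks (Ico a ℓ) σ)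
    (hτ : IsNCBlocks (Ico (ℓ + 1) b) τ) {U : Finset ℕ} (hU : U ∈ τ) :
    InnerIn (joinBlocks a ℓ σ τ) U ↔ InnerIn τ U := by
  constructor
  · rintro ⟨V, hV, hne, r, hr, s, hs, h⟩
    obtain ⟨x, hx⟩ := hτ.nonempty U hU
    have h1 := (h x hx).2
    have h2 := mem_Ico.1 (hτ.subset U hU hx)
    rcases mem_joinBlocks.1 hV with rfl | ⟨hV, -⟩ | hV
    · have := hσ.le_of_mem_insert h₁ hs; omega
    · have := mem_Ico.1 (hσ.subset V hV hs); omega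
    · exact ⟨V, hV, hne, r, hr, s, hs, h⟩
  · rintro ⟨V, hV, h⟩
    exact ⟨V, mem_joinBlocks.2 (Or.inr (Or.inr hV)), h⟩

end Join

/-- The part of a noncrossing partition enclosed by the block of `a`, with the last point of this
block removed. -/
def leftBlocks (a ℓ : ℕ) (P : Finset (Finset ℕ)) : Finset (Finset ℕ) :=
  (insert ((blockOf a P).erase ℓ) ((otherBlocks a P).filter fun V => ∀ x ∈ V, x < ℓ)).erase ∅

/-- The part of a noncrossing partition beyond `ℓ`. -/
def rightBlocks (ℓ : ℕ) (P : Finset (Finset ℕ)) : Finset (Finset ℕ) :=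
  P.filter fun V => ∀ x ∈ V, ℓ < x

lemma mem_leftBlocks {a ℓ : ℕ} {P : Finset (Finset ℕ)} {V : Finset ℕ} :
    V ∈ leftBlocks a ℓ P ↔ V ≠ ∅ ∧ (V = (blockOf a P).erase ℓ ∨
      ((V ∈ P ∧ a ∉ V) ∧ ∀ x ∈ V, x < ℓ)) := by
  simp only [leftBlocks, mem_erase, mem_insert, mem_filter, mem_otherBlocks]

lemma mem_rightBlocks {ℓ : ℕ} {P : Finset (Finset ℕ)} {V : Finset ℕ} :
    V ∈ rightBlocks ℓ P ↔ V ∈ P ∧ ∀ x ∈ V, ℓ < x := by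
  simp [rightBlocks]

section Split

variable {a b ℓ : ℕ} {P : Finset (Finset ℕ)}

/-- A block with points on both sides of `ℓ` would cross the pair `a`, `ℓ`. -/
lemma IsNCBlocks.lt_or_lt (hP : IsNCBlocks (Ico a b) P) (hℓ : ℓ ∈ blockOf a P)
    {V : Finset ℕ} (hV : V ∈ P) (haV : a ∉ V) :
    (∀ x ∈ V, x < ℓ) ∨ ∀ x ∈ V, ℓ < x := by
  have hab := mem_Ico.1 (hP.blockOf_subset a hℓ)
  have haB := hP.blockOf_mem (a := a) (by simp; omega)
  have hlV : ℓ ∉ V := fun h => haV (hP.eq_of_mem _ haB.1 V hV ℓ hℓ h ▸ haB.2)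
  by_contra! hcon
  obtain ⟨⟨x, hx, hxl⟩, ⟨y, hy, hyl⟩⟩ := hcon
  have hxl' : x ≠ ℓ := fun h => hlV (h ▸ hx)
  have hyl' : y ≠ ℓ := fun h => hlV (h ▸ hy)
  have hya : y ≠ a := fun h => haV (h ▸ hy)
  have := mem_Ico.1 (hP.subset V hV hy)
  exact haV (hP.noncrossing _ haB.1 V hV a y ℓ x (by omega) (by omega) (by omega) haB.2 hℓ hy hx
    ▸ haB.2)

lemma isNCBlocks_leftBlocks (hP : IsNCBlocks (Ico a b) P) (hℓ : ℓ ∈ blockOf a P)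
    (hmax : ∀ x ∈ blockOf a P, x ≤ ℓ) : IsNCBlocks (Ico a ℓ) (leftBlocks a ℓ P) := by
  have hab := mem_Ico.1 (hP.blockOf_subset a hℓ)
  have haB := hP.blockOf_mem (a := a) (by simp; omega)
  -- Every left block is a block of `P` with `ℓ` erased, so disjointness and noncrossing are
  -- inherited.
  have key : ∀ V ∈ leftBlocks a ℓ P, ∃ W ∈ P, V ⊆ W ∧ (V = W.erase ℓ) := by
    intro V hV
    rcases (mem_leftBlocks.1 hV).2 with rfl | ⟨⟨hV, -⟩, hl⟩
    · exact ⟨_, haB.1, erase_subset _ _, rfl⟩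
    · exact ⟨V, hV, Subset.rfl, (erase_eq_of_notMem fun h => lt_irrefl _ (hl _ h)).symm⟩
  refine ⟨?_, ?_, ?_, ?_, ?_⟩
  · intro V hV
    exact nonempty_iff_ne_empty.2 (mem_leftBlocks.1 hV).1
  · intro V hV x hx
    rcases (mem_leftBlocks.1 hV).2 with rfl | ⟨⟨hV, -⟩, hl⟩
    · have h1 := hmax x (mem_of_mem_erase hx)
      have h2 := ne_of_mem_erase hx
      have h3 := mem_Ico.1 (hP.blockOf_subset a (mem_of_mem_erase hx))
      rw [mem_Ico]; omega
    · have := mem_Ico.1 (hP.subset V hV hx)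
      have := hl x hx
      rw [mem_Ico]; omega
  · intro x hx
    rw [mem_Ico] at hx
    obtain ⟨V, hV, hxV⟩ := hP.cover x (by simp; omega)
    by_cases haV : a ∈ V
    · have e := hP.blockOf_eq hV haV
      have hxm : x ∈ (blockOf a P).erase ℓ := by rw [e, mem_erase]; exact ⟨by omega, hxV⟩
      exact ⟨_, mem_leftBlocks.2 ⟨ne_empty_of_mem hxm, Or.inl rfl⟩, hxm⟩
    · rcases hP.lt_or_lt hℓ hV haV with h | h
      · exact ⟨V, mem_leftBlocks.2 ⟨ne_empty_of_mem hxV, Or.inr ⟨⟨hV, haV⟩, h⟩⟩, hxV⟩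
      · have := h x hxV; omega
  · intro V hV W hW x hxV hxW
    obtain ⟨V', hV', hs, rfl⟩ := key V hV
    obtain ⟨W', hW', hs', rfl⟩ := key W hW
    rw [hP.eq_of_mem V' hV' W' hW' x (hs hxV) (hs' hxW)]
  · intro V hV W hW x₁ x₂ x₃ x₄ h12 h23 h34 h1 h3 h2 h4
    obtain ⟨V', hV', hs, rfl⟩ := key V hV
    obtain ⟨W', hW', hs', rfl⟩ := key W hW
    rw [hP.noncrossing V' hV' W' hW' _ _ _ _ h12 h23 h34 (hs h1) (hs h3) (hs' h2) (hs' h4)]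

lemma isNCBlocks_rightBlocks (hP : IsNCBlocks (Ico a b) P) (hℓ : ℓ ∈ blockOf a P)
    (hmax : ∀ x ∈ blockOf a P, x ≤ ℓ) : IsNCBlocks (Ico (ℓ + 1) b) (rightBlocks ℓ P) := by
  have hab := mem_Ico.1 (hP.blockOf_subset a hℓ)
  refine ⟨fun V hV => hP.nonempty V (mem_rightBlocks.1 hV).1, ?_, ?_,
    fun V hV W hW => hP.eq_of_mem V (mem_rightBlocks.1 hV).1 W (mem_rightBlocks.1 hW).1,
    fun V hV W hW => hP.noncrossing V (mem_rightBlocks.1 hV).1 W (mem_rightBlocks.1 hW).1⟩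
  · intro V hV x hx
    have := (mem_rightBlocks.1 hV).2 x hx
    have := mem_Ico.1 (hP.subset V (mem_rightBlocks.1 hV).1 hx)
    rw [mem_Ico]; omega
  · intro x hx
    rw [mem_Ico] at hx
    obtain ⟨V, hV, hxV⟩ := hP.cover x (by simp; omega)
    have haV : a ∉ V := fun haV => by
      have := hmax x (by rw [hP.blockOf_eq hV haV]; exact hxV)
      omega
    rcases hP.lt_or_lt hℓ hV haV with h | h
    · have := h x hxV; omega
    · exact ⟨V, mem_rightBlocks.2 ⟨hV, h⟩, hxV⟩

lemma blockOf_leftBlocks (hP : IsNCBlocks (Ico a b) P) (hℓ : ℓ ∈ blockOf a P)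
    (hmax : ∀ x ∈ blockOf a P, x ≤ ℓ) : blockOf a (leftBlocks a ℓ P) = (blockOf a P).erase ℓ := by
  have hab := mem_Ico.1 (hP.blockOf_subset a hℓ)
  have haB := hP.blockOf_mem (a := a) (by simp; omega)
  ext x
  rw [mem_blockOf]
  constructor
  · rintro ⟨V, hV, haV, hxV⟩
    rcases (mem_leftBlocks.1 hV).2 with rfl | ⟨⟨-, h⟩, -⟩
    · exact hxV
    · exact absurd haV h
  · intro hx
    have hal : a ≠ ℓ := by
      rintro rfl
      have := hmax x (mem_of_mem_erase hx)
      have := ne_of_mem_erase hx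
      have := mem_Ico.1 (hP.blockOf_subset a (mem_of_mem_erase hx))
      omega
    exact ⟨_, mem_leftBlocks.2 ⟨ne_empty_of_mem hx, Or.inl rfl⟩, mem_erase.2 ⟨hal, haB.2⟩, hx⟩

lemma joinBlocks_leftBlocks_rightBlocks (hP : IsNCBlocks (Ico a b) P) (hℓ : ℓ ∈ blockOf a P)
    (hmax : ∀ x ∈ blockOf a P, x ≤ ℓ) :
    joinBlocks a ℓ (leftBlocks a ℓ P) (rightBlocks ℓ P) = P := by
  have hab := mem_Ico.1 (hP.blockOf_subset a hℓ)
  have haB := hP.blockOf_mem (a := a) (by simp; omega)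
  ext V
  rw [mem_joinBlocks, blockOf_leftBlocks hP hℓ hmax, insert_erase hℓ, mem_rightBlocks]
  constructor
  · rintro (rfl | ⟨h, haV⟩ | h)
    · exact haB.1
    · obtain ⟨hne, rfl | h⟩ := mem_leftBlocks.1 h
      · exfalso
        obtain ⟨x, hx⟩ := nonempty_iff_ne_empty.2 hne
        have h1 := hmax x (mem_of_mem_erase hx)
        have h2 := ne_of_mem_erase hx
        have h3 := mem_Ico.1 (hP.blockOf_subset a (mem_of_mem_erase hx))
        exact haV (mem_erase.2 ⟨by omega, haB.2⟩)
      · exact h.1.1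
    · exact h.1
  · intro hV
    by_cases haV : a ∈ V
    · exact Or.inl (hP.blockOf_eq hV haV).symm
    · rcases hP.lt_or_lt hℓ hV haV with h | h
      · exact Or.inr (Or.inl ⟨mem_leftBlocks.2
          ⟨(hP.nonempty V hV).ne_empty, Or.inr ⟨⟨hV, haV⟩, h⟩⟩, haV⟩)
      · exact Or.inr (Or.inr ⟨hV, h⟩)

lemma leftBlocks_joinBlocks {σ τ : Finset (Finset ℕ)} (h₁ : a ≤ ℓ) (h₂ : ℓ < b)
    (hσ : IsNCBlocks (Ico a ℓ) σ) (hτ : IsNCBlocks (Ico (ℓ + 1) b) τ) :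
    leftBlocks a ℓ (joinBlocks a ℓ σ τ) = σ := by
  have hl : ℓ ∉ blockOf a σ := fun h => by
    have := mem_Ico.1 (hσ.blockOf_subset a h); omega
  ext V
  rw [mem_leftBlocks, blockOf_joinBlocks h₁ h₂ hσ hτ, erase_insert hl, mem_joinBlocks]
  constructor
  · rintro ⟨hne, rfl | ⟨⟨rfl | h | h, haV⟩, hl⟩⟩
    · obtain ⟨x, hx⟩ := nonempty_iff_ne_empty.2 hne
      obtain ⟨V, hV, haV, -⟩ := mem_blockOf.1 hx
      rwa [hσ.blockOf_eq hV haV]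
    · exact absurd (mem_insert_blockOf h₁ hσ) haV
    · exact h.1
    · obtain ⟨x, hx⟩ := hτ.nonempty V h
      have := hl x hx
      have := mem_Ico.1 (hτ.subset V h hx)
      omega
  · intro hV
    refine ⟨(hσ.nonempty V hV).ne_empty, ?_⟩
    by_cases haV : a ∈ V
    · exact Or.inl (hσ.blockOf_eq hV haV).symm
    · exact Or.inr ⟨⟨Or.inr (Or.inl ⟨hV, haV⟩), haV⟩, fun x hx => (mem_Ico.1 (hσ.subset V hV hx)).2⟩

lemma rightBlocks_joinBlocks {σ τ : Finset (Finset ℕ)}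
    (hσ : IsNCBlocks (Ico a ℓ) σ) (hτ : IsNCBlocks (Ico (ℓ + 1) b) τ) :
    rightBlocks ℓ (joinBlocks a ℓ σ τ) = τ := by
  ext V
  rw [mem_rightBlocks, mem_joinBlocks]
  constructor
  · rintro ⟨rfl | h | h, hl⟩
    · exact absurd (hl ℓ (by simp)) (lt_irrefl _)
    · obtain ⟨x, hx⟩ := hσ.nonempty V h.1
      have := hl x hx
      have := mem_Ico.1 (hσ.subset V h.1 hx)
      omega
    · exact h
  · intro hV
    exact ⟨Or.inr (Or.inr hV), fun x hx => by have := mem_Ico.1 (hτ.subset V hV hx); omega⟩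

end Split

/-- Noncrossing partitions of an interval, decomposed along the last point `ℓ` of the first
block. -/
lemma sum_ncBlocks_Ico {A : Type*} [AddCommMonoid A] {a b : ℕ} (hab : a < b)
    (F : Finset (Finset ℕ) → A) :
    ∑ P ∈ ncBlocks (Ico a b), F P = ∑ ℓ ∈ Ico a b, ∑ σ ∈ ncBlocks (Ico a ℓ),
      ∑ τ ∈ ncBlocks (Ico (ℓ + 1) b), F (joinBlocks a ℓ σ τ) := by
  have hmem : ∀ P ∈ ncBlocks (Ico a b), a ∈ blockOf a P := fun P hP =>
    ((mem_ncBlocks.1 hP).blockOf_mem (by simp [hab])).2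
  simp only [← Finset.sum_product']
  rw [Finset.sum_sigma']
  symm
  refine Finset.sum_bij' (fun q _ => joinBlocks a q.1 q.2.1 q.2.2)
    (fun P hP => ⟨(blockOf a P).sup id, leftBlocks a ((blockOf a P).sup id) P,
      rightBlocks ((blockOf a P).sup id) P⟩) ?_ ?_ ?_ ?_ ?_
  · rintro ⟨ℓ, σ, τ⟩ hq
    simp only [mem_sigma, mem_product, mem_ncBlocks, mem_Ico] at hq
    exact mem_ncBlocks.2 (isNCBlocks_joinBlocks hq.1.1 hq.1.2 hq.2.1 hq.2.2)
  · intro P hP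
    have hP' := mem_ncBlocks.1 hP
    have hl : (blockOf a P).sup id ∈ blockOf a P := by
      obtain ⟨i, hi, e⟩ := Finset.exists_mem_eq_sup (blockOf a P) ⟨a, hmem P hP⟩ id
      rw [e]; exact hi
    have hmax : ∀ x ∈ blockOf a P, x ≤ (blockOf a P).sup id := fun x hx =>
      Finset.le_sup (f := id) hx
    simp only [mem_sigma, mem_product, mem_ncBlocks]
    exact ⟨hP'.blockOf_subset a hl, isNCBlocks_leftBlocks hP' hl hmax,
      isNCBlocks_rightBlocks hP' hl hmax⟩
  · rintro ⟨ℓ, σ, τ⟩ hq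
    simp only [mem_sigma, mem_product, mem_ncBlocks, mem_Ico] at hq
    have hs : (blockOf a (joinBlocks a ℓ σ τ)).sup id = ℓ := by
      rw [blockOf_joinBlocks hq.1.1 hq.1.2 hq.2.1 hq.2.2]
      apply le_antisymm
      · exact Finset.sup_le fun x hx => (hq.2.1.le_of_mem_insert hq.1.1 hx).2
      · exact Finset.le_sup (f := id) (mem_insert_self _ _)
    simp only [hs, leftBlocks_joinBlocks hq.1.1 hq.1.2 hq.2.1 hq.2.2,
      rightBlocks_joinBlocks hq.2.1 hq.2.2]
  · intro P hP
    have hP' := mem_ncBlocks.1 hP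
    have hl : (blockOf a P).sup id ∈ blockOf a P := by
      obtain ⟨i, hi, e⟩ := Finset.exists_mem_eq_sup (blockOf a P) ⟨a, hmem P hP⟩ id
      rw [e]; exact hi
    have hmax : ∀ x ∈ blockOf a P, x ≤ (blockOf a P).sup id := fun x hx =>
      Finset.le_sup (f := id) hx
    exact joinBlocks_leftBlocks_rightBlocks hP' hl hmax
  · intro q hq
    rfl

section Sums

variable {A : Type*} [CommRing A]

/-- The weight of a noncrossing partition: `R` for outer and `r` for inner blocks. -/
def ncWeight (R r : ℕ → A) (P : Finset (Finset ℕ)) : A :=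
  (∏ V ∈ P.filter (¬ InnerIn P ·), R V.card) * ∏ V ∈ P.filter (InnerIn P ·), r V.card

/-- The sum of the two-state weights over the noncrossing partitions of `Ico a b`. -/
def ncSum (R r : ℕ → A) (a b : ℕ) : A := ∑ P ∈ ncBlocks (Ico a b), ncWeight R r P

/-- The sum over the noncrossing partitions of `Ico a b` in which the block of `a` has weight `f`
and all others have weight `r`. -/
def rootedSum (f r : ℕ → A) (a b : ℕ) : A :=
  ∑ P ∈ ncBlocks (Ico a b), f (blockOf a P).card * ∏ V ∈ otherBlocks a P, r V.card

lemma ncWeight_self (r : ℕ → A) (P : Finset (Finset ℕ)) :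
    ncWeight r r P = ∏ V ∈ P, r V.card := by
  rw [ncWeight, mul_comm]
  exact Finset.prod_filter_mul_prod_filter_not P _ _

lemma ncBlocks_empty : ncBlocks ∅ = {∅} := by
  ext P
  rw [mem_ncBlocks, mem_singleton]
  constructor
  · intro h
    by_contra hne
    obtain ⟨V, hV⟩ := nonempty_iff_ne_empty.2 hne
    exact (h.nonempty V hV).ne_empty (subset_empty.1 (h.subset V hV))
  · rintro rfl
    exact ⟨by simp, by simp, by simp, by simp, by simp⟩

lemma ncSum_self (R r : ℕ → A) (a : ℕ) : ncSum R r a a = 1 := by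
  simp [ncSum, ncBlocks_empty, ncWeight]

/-- The partition of the empty interval has an empty root block, of weight `f 0`. This base value
lets a first block consisting of `ℓ = a` alone be treated like any other. -/
lemma rootedSum_self (f r : ℕ → A) (a : ℕ) : rootedSum f r a a = f 0 := by
  simp [rootedSum, ncBlocks_empty, blockOf, otherBlocks]

lemma card_insert_blockOf {a ℓ : ℕ} {σ : Finset (Finset ℕ)} (hσ : IsNCBlocks (Ico a ℓ) σ) :
    (insert ℓ (blockOf a σ)).card = (blockOf a σ).card + 1 := by
  refine card_insert_of_notMem fun h => ?_
  have := mem_Ico.1 (hσ.blockOf_subset a h)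
  omega

/-- Removing `ℓ` lowers the size of the root block by one, hence the shift of `f`. The part beyond
`ℓ` has no root, so all its blocks weigh `r`. -/
lemma rootedSum_eq (f r : ℕ → A) {a b : ℕ} (hab : a < b) :
    rootedSum f r a b =
      ∑ ℓ ∈ Ico a b, rootedSum (fun k => f (k + 1)) r a ℓ * ncSum r r (ℓ + 1) b := by
  rw [rootedSum, sum_ncBlocks_Ico hab]
  refine sum_congr rfl fun ℓ hℓ => ?_
  rw [rootedSum, ncSum, sum_mul_sum]
  refine sum_congr rfl fun σ hσ => sum_congr rfl fun τ hτ => ?_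
  rw [mem_Ico] at hℓ
  rw [mem_ncBlocks] at hσ hτ
  rw [blockOf_joinBlocks hℓ.1 hℓ.2 hσ hτ, otherBlocks_joinBlocks hℓ.1 hσ hτ,
    card_insert_blockOf hσ, prod_union (disjoint_left_right hσ hτ), ncWeight_self, mul_assoc]

/-- The first block is outer, the blocks it encloses are inner, and the blocks beyond `ℓ` keep the
status they have in `τ`. -/
lemma ncWeight_joinBlocks (R r : ℕ → A) {a b ℓ : ℕ} {σ τ : Finset (Finset ℕ)} (h₁ : a ≤ ℓ)
    (h₂ : ℓ < b) (hσ : IsNCBlocks (Ico a ℓ) σ) (hτ : IsNCBlocks (Ico (ℓ + 1) b) τ) :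
    ncWeight R r (joinBlocks a ℓ σ τ) =
      (R ((blockOf a σ).card + 1) * ∏ V ∈ otherBlocks a σ, r V.card) * ncWeight R r τ := by
  have hB := mem_insert_blockOf h₁ hσ
  have hout : (joinBlocks a ℓ σ τ).filter (¬ InnerIn (joinBlocks a ℓ σ τ) ·) =
      insert (insert ℓ (blockOf a σ)) (τ.filter (¬ InnerIn τ ·)) := by
    ext V
    simp only [mem_filter, mem_insert]
    constructor
    · rintro ⟨hV, hi⟩
      rcases mem_joinBlocks.1 hV with h | h | h
      · exact Or.inl h
      · exact absurd (innerIn_joinBlocks_of_mem_left h₁ hσ (mem_otherBlocks.2 h)) hi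
      · exact Or.inr ⟨h, fun h' => hi ((innerIn_joinBlocks_iff h₁ hσ hτ h).2 h')⟩
    · rintro (rfl | ⟨h, hi⟩)
      · exact ⟨mem_joinBlocks.2 (Or.inl rfl), not_innerIn_insert h₁ h₂ hσ hτ⟩
      · exact ⟨mem_joinBlocks.2 (Or.inr (Or.inr h)),
          fun h' => hi ((innerIn_joinBlocks_iff h₁ hσ hτ h).1 h')⟩
  have hin : (joinBlocks a ℓ σ τ).filter (InnerIn (joinBlocks a ℓ σ τ) ·) =
      otherBlocks a σ ∪ τ.filter (InnerIn τ ·) := by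
    ext V
    simp only [mem_filter, mem_union]
    constructor
    · rintro ⟨hV, hi⟩
      rcases mem_joinBlocks.1 hV with rfl | h | h
      · exact absurd hi (not_innerIn_insert h₁ h₂ hσ hτ)
      · exact Or.inl (mem_otherBlocks.2 h)
      · exact Or.inr ⟨h, (innerIn_joinBlocks_iff h₁ hσ hτ h).1 hi⟩
    · rintro (h | ⟨h, hi⟩)
      · exact ⟨mem_joinBlocks.2 (Or.inr (Or.inl (mem_otherBlocks.1 h))),
          innerIn_joinBlocks_of_mem_left h₁ hσ h⟩
      · exact ⟨mem_joinBlocks.2 (Or.inr (Or.inr h)), (innerIn_joinBlocks_iff h₁ hσ hτ h).2 hi⟩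
  have hnot : insert ℓ (blockOf a σ) ∉ τ.filter (¬ InnerIn τ ·) := fun h =>
    notMem_of_mem_right h₁ hτ (mem_filter.1 h).1 hB
  have hdisj : Disjoint (otherBlocks a σ) (τ.filter (InnerIn τ ·)) :=
    (disjoint_left_right hσ hτ).mono_right (filter_subset _ _)
  rw [ncWeight, hout, hin, prod_insert hnot, prod_union hdisj, card_insert_blockOf hσ, ncWeight]
  ring

lemma ncSum_eq (R r : ℕ → A) {a b : ℕ} (hab : a < b) :
    ncSum R r a b =
      ∑ ℓ ∈ Ico a b, rootedSum (fun k => R (k + 1)) r a ℓ * ncSum R r (ℓ + 1) b := by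
  rw [ncSum, sum_ncBlocks_Ico hab]
  refine sum_congr rfl fun ℓ hℓ => ?_
  rw [rootedSum, ncSum, sum_mul_sum]
  refine sum_congr rfl fun σ hσ => sum_congr rfl fun τ hτ => ?_
  rw [mem_Ico] at hℓ
  rw [mem_ncBlocks] at hσ hτ
  exact ncWeight_joinBlocks R r hℓ.1 hℓ.2 hσ hτ

/-- The two recursions refer to each other and see only lengths of intervals, so both claims go
through a joint induction on the length. -/
lemma sums_translate (r : ℕ → A) (n : ℕ) : ∀ a : ℕ,
    (∀ f : ℕ → A, rootedSum f r a (a + n) = rootedSum f r 0 n) ∧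
    ∀ R : ℕ → A, ncSum R r a (a + n) = ncSum R r 0 n := by
  induction n using Nat.strong_induction_on with
  | _ n ih =>
    intro a
    rcases Nat.eq_zero_or_pos n with rfl | hn
    · simp [rootedSum_self, ncSum_self]
    have key : ∀ f R' : ℕ → A,
        ∑ ℓ ∈ Ico a (a + n), rootedSum f r a ℓ * ncSum R' r (ℓ + 1) (a + n) =
        ∑ ℓ ∈ Ico 0 n, rootedSum f r 0 ℓ * ncSum R' r (ℓ + 1) n := by
      intro f R'
      rw [Finset.sum_Ico_eq_sum_range, Nat.Ico_zero_eq_range, Nat.add_sub_cancel_left]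
      refine sum_congr rfl fun ℓ hℓ => ?_
      rw [mem_range] at hℓ
      rw [(ih ℓ hℓ a).1 f]
      congr 1
      have e1 : a + n = (a + ℓ + 1) + (n - (ℓ + 1)) := by omega
      have e2 : ncSum R' r (ℓ + 1) n = ncSum R' r (ℓ + 1) (ℓ + 1 + (n - (ℓ + 1))) := by
        congr 1; omega
      rw [e1, e2, (ih (n - (ℓ + 1)) (by omega) _).2 R', (ih (n - (ℓ + 1)) (by omega) _).2 R']
    refine ⟨fun f => ?_, fun R' => ?_⟩
    · rw [rootedSum_eq f r (by omega : a < a + n), rootedSum_eq f r hn, key]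
    · rw [ncSum_eq R' r (by omega : a < a + n), ncSum_eq R' r hn, key]

lemma ncSum_succ_right (R r : ℕ → A) {ℓ n : ℕ} (h : ℓ ≤ n) :
    ncSum R r (ℓ + 1) (n + 1) = ncSum R r 0 (n - ℓ) := by
  rw [← (sums_translate r (n - ℓ) (ℓ + 1)).2 R]
  congr 1; omega

lemma rootedSum_succ (f r : ℕ → A) (n : ℕ) :
    rootedSum f r 0 (n + 1) = ∑ ℓ ∈ range (n + 1),
      rootedSum (fun k => f (k + 1)) r 0 ℓ * ncSum r r 0 (n - ℓ) := by
  rw [rootedSum_eq f r n.succ_pos, Nat.Ico_zero_eq_range]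
  refine sum_congr rfl fun ℓ hℓ => ?_
  rw [ncSum_succ_right _ _ (by simpa [Nat.lt_succ_iff] using hℓ)]

lemma ncSum_succ (R r : ℕ → A) (n : ℕ) :
    ncSum R r 0 (n + 1) = ∑ ℓ ∈ range (n + 1),
      rootedSum (fun k => R (k + 1)) r 0 ℓ * ncSum R r 0 (n - ℓ) := by
  rw [ncSum_eq R r n.succ_pos, Nat.Ico_zero_eq_range]
  refine sum_congr rfl fun ℓ hℓ => ?_
  rw [ncSum_succ_right _ _ (by simpa [Nat.lt_succ_iff] using hℓ)]

end Sums

lemma isNCBlocks_parts {s : Finset ℕ} {π : Finpartition s} (h : IsNoncrossing π) :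
    IsNCBlocks s π.parts where
  nonempty _ hV := π.nonempty_of_mem_parts hV
  subset _ hV := π.le hV
  cover _ hx := π.exists_mem hx
  eq_of_mem _ hV _ hW _ hxV hxW := π.eq_of_mem_parts hV hW hxV hxW
  noncrossing := h

lemma sum_NC_eq_sum_ncBlocks {A : Type*} [AddCommMonoid A] (m : ℕ)
    (F : Finset (Finset ℕ) → A) :
    ∑ π ∈ NC m, F π.parts = ∑ P ∈ ncBlocks (Ico 0 m), F P := by
  rw [Nat.Ico_zero_eq_range]
  refine sum_bij (fun π _ => π.parts) ?_ ?_ ?_ ?_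
  · intro π hπ
    exact mem_ncBlocks.2 (isNCBlocks_parts (mem_filter.1 hπ).2)
  · intro π _ π' _ h
    exact Finpartition.ext h
  · intro P hP
    have h := mem_ncBlocks.1 hP
    refine ⟨⟨P, ?_, ?_, ?_⟩, ?_, rfl⟩
    · rw [Finset.supIndep_iff_pairwiseDisjoint]
      intro V hV W hW hne
      refine Finset.disjoint_left.2 fun x hx hx' => hne (h.eq_of_mem V hV W hW x hx hx')
    · ext x
      simp only [Finset.mem_sup, id]
      exact ⟨fun ⟨V, hV, hx⟩ => h.subset V hV hx, fun hx => h.cover x hx⟩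
    · exact fun h' => by simpa using h.nonempty _ h'
    · exact mem_filter.2 ⟨mem_univ _, h.noncrossing⟩
  · intro π _
    rfl

lemma rawMoment_eq_ncSum (μ : Measure ℝ) {m : ℕ} (hm : 1 ≤ m) :
    rawMoment μ m = ncSum (freeCumulant μ) (freeCumulant μ) 0 m := by
  rw [rawMoment_eq_sum_freeCumulant μ hm, ncSum,
    sum_NC_eq_sum_ncBlocks m (fun P => ∏ V ∈ P, freeCumulant μ V.card)]
  exact sum_congr rfl fun P _ => (ncWeight_self _ P).symm

lemma rawMoment_eq_ncSum_cfree (μ' μ : Measure ℝ) {m : ℕ} (hm : 1 ≤ m) :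
    rawMoment μ' m = ncSum (cfreeCumulant μ' μ) (freeCumulant μ) 0 m := by
  rw [rawMoment_eq_sum_cfreeCumulant μ' μ hm, ncSum, ← sum_NC_eq_sum_ncBlocks]
  rfl

end Noncrossing

/-! ### The moment-cumulant formulas as functional equations -/

section Series

open PowerSeries Finset

variable {A : Type*} [CommRing A]

lemma hasSubst_X_mul (M : A⟦X⟧) : HasSubst (X * M) :=
  HasSubst.of_constantCoeff_zero' (by simp)

/-- Substitution of `X * M` into a power series. -/
def compX (M : A⟦X⟧) : A⟦X⟧ →ₐ[A] A⟦X⟧ := substAlgHom (hasSubst_X_mul M)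

lemma compX_apply (M f : A⟦X⟧) : compX M f = f.subst (X * M) := by
  rw [compX, coe_substAlgHom]

@[simp] lemma compX_X (M : A⟦X⟧) : compX M X = X * M := by
  rw [compX, substAlgHom_X]

@[simp] lemma compX_C (M : A⟦X⟧) (a : A) : compX M (C a) = C a :=
  (compX M).commutes a

lemma coeff_compX (M f : A⟦X⟧) (n : ℕ) :
    coeff n (compX M f) = ∑ k ∈ range (n + 1), coeff k f * coeff (n - k) (M ^ k) := by
  rw [compX_apply, coeff_subst' (hasSubst_X_mul M)]
  have hc : ∀ k, coeff n ((X * M) ^ k) = if k ≤ n then coeff (n - k) (M ^ k) else 0 := by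
    intro k
    rw [mul_pow, coeff_X_pow_mul']
  rw [finsum_eq_sum_of_support_subset (s := range (n + 1))]
  · refine sum_congr rfl fun k hk => ?_
    rw [hc, if_pos (by simpa [Nat.lt_succ_iff] using hk), smul_eq_mul]
  · intro k hk
    rw [Function.mem_support, hc] at hk
    by_contra hkn
    apply hk
    rw [if_neg, smul_zero]
    simpa [Nat.lt_succ_iff] using hkn

lemma map_compX {B : Type*} [CommRing B] (φ : A →+* B) (M f : A⟦X⟧) :
    (compX M f).map φ = compX (M.map φ) (f.map φ) := by
  ext n
  simp only [coeff_map, coeff_compX, map_sum, map_mul, ← map_pow]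

lemma coeff_eq_of_X_pow_dvd_sub {f g : A⟦X⟧} {n m : ℕ} (h : X ^ n ∣ f - g) (hm : m < n) :
    coeff m f = coeff m g := by
  rw [← sub_eq_zero, ← map_sub]
  exact X_pow_dvd_iff.1 h m hm

lemma eq_of_forall_X_pow_dvd_sub {f g : A⟦X⟧} (h : ∀ n, X ^ n ∣ f - g) : f = g := by
  ext n
  exact coeff_eq_of_X_pow_dvd_sub (h (n + 1)) n.lt_succ_self

/-- The top coefficient of `f` is multiplied by the constant term 1 of a power of `M`. The other
terms involve coefficients of `f` of index below `m`, and coefficients of `M` of index below `m` as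
well, because the power with exponent 0 does not contain `M`. -/
lemma coeff_compX_sub {M M' f f' : A⟦X⟧} {n m : ℕ} (hM : X ^ n ∣ M - M') (hf : X ^ n ∣ f - f')
    (h1 : constantCoeff M = 1) (h1' : constantCoeff M' = 1) (hm : m ≤ n) :
    coeff m (compX M f) - coeff m (compX M' f') = coeff m f - coeff m f' := by
  rw [coeff_compX, coeff_compX, sum_range_succ, sum_range_succ]
  have : ∑ k ∈ range m, coeff k f * coeff (m - k) (M ^ k) =
      ∑ k ∈ range m, coeff k f' * coeff (m - k) (M' ^ k) := by
    refine sum_congr rfl fun k hk => ?_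
    rw [mem_range] at hk
    rw [coeff_eq_of_X_pow_dvd_sub hf (by omega)]
    rcases Nat.eq_zero_or_pos k with rfl | hk0
    · simp
    · rw [coeff_eq_of_X_pow_dvd_sub (hM.trans (sub_dvd_pow_sub_pow M M' k)) (by omega)]
  rw [this]
  simp [h1, h1']

lemma X_pow_dvd_compX_sub {M M' f f' : A⟦X⟧} {n : ℕ} (hM : X ^ n ∣ M - M')
    (hf : X ^ n ∣ f - f') (h1 : constantCoeff M = 1) (h1' : constantCoeff M' = 1) :
    X ^ n ∣ compX M f - compX M' f' := by
  rw [X_pow_dvd_iff]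
  intro m hm
  rw [map_sub, coeff_compX_sub hM hf h1 h1' hm.le, ← map_sub]
  exact X_pow_dvd_iff.1 hf m hm

lemma compX_injective {M : A⟦X⟧} (h1 : constantCoeff M = 1) : Function.Injective (compX M) := by
  intro f f' h
  refine eq_of_forall_X_pow_dvd_sub fun n => ?_
  induction n with
  | zero => simp
  | succ n ih =>
    rw [X_pow_dvd_iff] at ih ⊢
    intro m hm
    rcases Nat.lt_succ_iff_lt_or_eq.1 hm with hm | rfl
    · exact ih m hm
    · have := coeff_compX_sub (M := M) (M' := M) (by simp) (X_pow_dvd_iff.2 ih) h1 h1 le_rfl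
      rw [h, sub_self] at this
      rw [map_sub, ← this]

/-- `M` is the moment series of the free cumulant series `X * κ`. -/
def IsFreeMoment (κ M : A⟦X⟧) : Prop := M = 1 + X * compX M κ * M

/-- `M'` is the moment series of the two-state free cumulant series `X * η`, relative to `M`. -/
def IsCFreeMoment (η M M' : A⟦X⟧) : Prop := M' = 1 + X * compX M η * M'

lemma constantCoeff_of_eq_one_add {M f : A⟦X⟧} (h : M = 1 + X * f) : constantCoeff M = 1 := by
  rw [h]; simp

lemma IsCFreeMoment.constantCoeff {η M M' : A⟦X⟧} (h : IsCFreeMoment η M M') :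
    constantCoeff M' = 1 :=
  constantCoeff_of_eq_one_add (by rw [IsCFreeMoment, mul_assoc] at h; exact h)

lemma IsFreeMoment.constantCoeff {κ M : A⟦X⟧} (h : IsFreeMoment κ M) :
    PowerSeries.constantCoeff M = 1 :=
  IsCFreeMoment.constantCoeff (M := M) h

lemma isUnit_of_constantCoeff_eq_one {M : A⟦X⟧} (h : constantCoeff M = 1) : IsUnit M := by
  rw [isUnit_iff_constantCoeff, h]; exact isUnit_one

lemma X_mul_cancel {f g : A⟦X⟧} (h : X * f = X * g) : f = g := X_mul_inj.1 h

lemma IsCFreeMoment.cumulant_unique {η η' M M' : A⟦X⟧} (h1 : PowerSeries.constantCoeff M = 1)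
    (h : IsCFreeMoment η M M') (h' : IsCFreeMoment η' M M') : η = η' := by
  have hu := isUnit_of_constantCoeff_eq_one h.constantCoeff
  have e : X * compX M η * M' = X * compX M η' * M' :=
    add_left_cancel (a := 1) (Eq.trans (Eq.symm h) h')
  exact compX_injective h1 (X_mul_cancel (hu.mul_right_cancel e))

lemma IsFreeMoment.cumulant_unique {κ κ' M : A⟦X⟧} (h : IsFreeMoment κ M)
    (h' : IsFreeMoment κ' M) : κ = κ' :=
  IsCFreeMoment.cumulant_unique h.constantCoeff h h'

/-- The factor `X` in the functional equation gains one order of agreement at each pass, until the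
order of agreement of the cumulants is exhausted. -/
lemma IsFreeMoment.X_pow_dvd_sub {κ κ' M M' : A⟦X⟧} {n : ℕ} (h : IsFreeMoment κ M)
    (h' : IsFreeMoment κ' M') (hκ : X ^ n ∣ κ - κ') : X ^ (n + 1) ∣ M - M' := by
  have key : ∀ j ≤ n, X ^ j ∣ M - M' → X ^ (j + 1) ∣ M - M' := by
    intro j hj hM
    have hc := X_pow_dvd_compX_sub hM ((pow_dvd_pow X hj).trans hκ) h.constantCoeff
      h'.constantCoeff
    have e : M - M' = X * ((compX M κ - compX M' κ') * M + compX M' κ' * (M - M')) := by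
      nth_rewrite 1 [h, h']; ring
    rw [e, pow_succ']
    exact mul_dvd_mul_left _ ((hc.mul_right _).add (hM.mul_left _))
  have : ∀ j ≤ n + 1, X ^ j ∣ M - M' := by
    intro j
    induction j with
    | zero => simp
    | succ j ih => exact fun hj => key j (by omega) (ih (by omega))
  exact this _ le_rfl

/-- In the moment of order n + 1 the highest cumulant occurs linearly with coefficient 1 (the
one-block partition); everything else depends on lower cumulants. -/
lemma IsFreeMoment.coeff_sub {κ κ' M M' : A⟦X⟧} {n : ℕ} (h : IsFreeMoment κ M)
    (h' : IsFreeMoment κ' M') (hκ : X ^ n ∣ κ - κ') :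
    coeff (n + 1) M - coeff (n + 1) M' = coeff n κ - coeff n κ' := by
  have hM := h.X_pow_dvd_sub h' hκ
  have hM' : X ^ n ∣ M - M' := (pow_dvd_pow X n.le_succ).trans hM
  obtain ⟨g, hg⟩ := X_pow_dvd_compX_sub hM' hκ h.constantCoeff h'.constantCoeff
  obtain ⟨g', hg'⟩ := hM
  have e : M - M' = X * ((compX M κ - compX M' κ') * M + compX M' κ' * (M - M')) := by
    nth_rewrite 1 [h, h']; ring
  have e2 : coeff n (compX M κ - compX M' κ') = coeff n κ - coeff n κ' := by
    rw [map_sub, coeff_compX_sub hM' hκ h.constantCoeff h'.constantCoeff le_rfl]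
  rw [← map_sub, e, coeff_succ_X_mul, ← e2, map_add, hg, hg', mul_assoc, pow_succ, mul_assoc,
    mul_left_comm _ (X ^ n), coeff_X_pow_mul', coeff_X_pow_mul', coeff_X_pow_mul']
  simp [h.constantCoeff]

lemma IsFreeMoment.moment_unique {κ M M' : A⟦X⟧} (h : IsFreeMoment κ M)
    (h' : IsFreeMoment κ M') : M = M' := by
  refine eq_of_forall_X_pow_dvd_sub fun n => ?_
  exact (pow_dvd_pow X n.le_succ).trans (h.X_pow_dvd_sub h' (n := n) (by simp))

/-- With `F` fixed the equation is linear with the unit `1 - X * F`; for the second measure of a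
pair, `F` is the cumulant series substituted with the other measure's moments. -/
lemma eq_of_eq_one_add_X_mul {F M M' : A⟦X⟧} (h : M = 1 + X * F * M) (h' : M' = 1 + X * F * M') :
    M = M' := by
  have hu : IsUnit (1 - X * F) := isUnit_of_constantCoeff_eq_one (by simp)
  apply hu.mul_left_cancel
  have e : (1 - X * F) * M = 1 := by linear_combination h
  have e' : (1 - X * F) * M' = 1 := by linear_combination h'
  rw [e, e']

lemma IsFreeMoment.map {B : Type*} [CommRing B] (φ : A →+* B) {κ M : A⟦X⟧}
    (h : IsFreeMoment κ M) : IsFreeMoment (κ.map φ) (M.map φ) := by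
  have := congrArg (PowerSeries.map φ) h
  rwa [map_add, map_mul, map_mul, map_compX, map_one, PowerSeries.map_X] at this

/-- The series of two-state noncrossing sums. -/
def ncSeries (R r : ℕ → A) : A⟦X⟧ := PowerSeries.mk fun n => ncSum R r 0 n

lemma compX_mk (M : A⟦X⟧) (f : ℕ → A) :
    compX M (mk f) = C (f 0) + X * (compX M (mk fun k => f (k + 1)) * M) := by
  have : (mk f : A⟦X⟧) = C (f 0) + X * PowerSeries.mk fun k => f (k + 1) := by
    ext n
    cases n <;> simp [coeff_succ_X_mul]
  rw [this, map_add, map_mul, compX_C, compX_X]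
  ring

/-- Both sides satisfy the same recursion, in which `f` is replaced by its shift: `rootedSum_succ`
on the left, `compX_mk` on the right. -/
lemma mk_rootedSum (f r : ℕ → A) :
    mk (fun n => rootedSum f r 0 n) = compX (ncSeries r r) (mk f) := by
  ext n
  induction n using Nat.strong_induction_on generalizing f with
  | _ n ih =>
    rw [compX_mk, coeff_mk]
    cases n with
    | zero => simp [rootedSum_self]
    | succ n =>
      rw [rootedSum_succ, map_add, coeff_succ_X_mul, coeff_mul,
        Finset.Nat.sum_antidiagonal_eq_sum_range_succ_mk, coeff_C, if_neg n.succ_ne_zero, zero_add]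
      refine sum_congr rfl fun ℓ hℓ => ?_
      rw [← ih ℓ (by simpa using hℓ)]
      simp [ncSeries]

lemma isCFreeMoment_ncSeries (R r : ℕ → A) :
    IsCFreeMoment (mk fun k => R (k + 1)) (ncSeries r r) (ncSeries R r) := by
  rw [IsCFreeMoment, ← mk_rootedSum]
  ext n
  cases n with
  | zero => simp [ncSeries, ncSum_self]
  | succ n =>
    rw [mul_assoc, map_add, coeff_succ_X_mul, coeff_mul,
        Finset.Nat.sum_antidiagonal_eq_sum_range_succ_mk, ncSeries, coeff_mk, ncSum_succ]
    simp [coeff_one]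

lemma isFreeMoment_ncSeries (r : ℕ → A) :
    IsFreeMoment (mk fun k => r (k + 1)) (ncSeries r r) :=
  isCFreeMoment_ncSeries r r

/-- Every power series is a free cumulant series. -/
lemma exists_isFreeMoment (κ : A⟦X⟧) : ∃ M, IsFreeMoment κ M := by
  refine ⟨ncSeries (fun k => coeff (k - 1) κ) (fun k => coeff (k - 1) κ), ?_⟩
  convert isFreeMoment_ncSeries (fun k => coeff (k - 1) κ) using 1
  ext n; simp

/-- The moment series of a measure. -/
def momentSeries (μ : Measure ℝ) : ℝ⟦X⟧ := mk (rawMoment μ)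

/-- The free cumulants `r_{k+1}` as a power series. -/
def freeCumulantSeries (μ : Measure ℝ) : ℝ⟦X⟧ := mk fun k => freeCumulant μ (k + 1)

/-- The two-state free cumulants `R_{k+1}` as a power series. -/
def cfreeCumulantSeries (μ' μ : Measure ℝ) : ℝ⟦X⟧ := mk fun k => cfreeCumulant μ' μ (k + 1)

lemma rawMoment_zero (μ : Measure ℝ) [IsProbabilityMeasure μ] : rawMoment μ 0 = 1 := by
  simp [rawMoment]

lemma momentSeries_eq_ncSeries (μ : Measure ℝ) [IsProbabilityMeasure μ] :
    momentSeries μ = ncSeries (freeCumulant μ) (freeCumulant μ) := by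
  ext n
  rw [momentSeries, ncSeries, coeff_mk, coeff_mk]
  rcases Nat.eq_zero_or_pos n with rfl | hn
  · rw [rawMoment_zero, ncSum_self]
  · exact rawMoment_eq_ncSum μ hn

lemma isFreeMoment_momentSeries (μ : Measure ℝ) [IsProbabilityMeasure μ] :
    IsFreeMoment (freeCumulantSeries μ) (momentSeries μ) := by
  rw [momentSeries_eq_ncSeries]
  exact isFreeMoment_ncSeries _

lemma isCFreeMoment_momentSeries (μ' μ : Measure ℝ) [IsProbabilityMeasure μ']
    [IsProbabilityMeasure μ] :
    IsCFreeMoment (cfreeCumulantSeries μ' μ) (momentSeries μ) (momentSeries μ') := by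
  have : momentSeries μ' = ncSeries (cfreeCumulant μ' μ) (freeCumulant μ) := by
    ext n
    rw [momentSeries, ncSeries, coeff_mk, coeff_mk]
    rcases Nat.eq_zero_or_pos n with rfl | hn
    · rw [rawMoment_zero, ncSum_self]
    · exact rawMoment_eq_ncSum_cfree μ' μ hn
  rw [this, momentSeries_eq_ncSeries]
  exact isCFreeMoment_ncSeries _ _

end Series

/-! ### Continued fractions and their coefficients -/

section Jacobi

open PowerSeries Finset

variable {A : Type*} [CommRing A]

/-- The coefficients of `x ^ n` in the basis of the polynomials with recursion coefficients
`β, γ`; equivalently, weighted sums over Motzkin paths. -/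
def jacPath (β γ : ℕ → A) : ℕ → ℕ → A
  | 0, 0 => 1
  | 0, _ + 1 => 0
  | n + 1, 0 => β 0 * jacPath β γ n 0 + γ 0 * jacPath β γ n 1
  | n + 1, h + 1 => jacPath β γ n h + β (h + 1) * jacPath β γ n (h + 1)
      + γ (h + 1) * jacPath β γ n (h + 2)

/-- The moment series with Jacobi parameters `β, γ`. -/
def jac (β γ : ℕ → A) : A⟦X⟧ := PowerSeries.mk fun n => jacPath β γ n 0

/-- The family `M` consists of the successive tails of the continued fraction with coefficients
`β, γ`. -/
def IsJacChain (β γ : ℕ → A) (M : ℕ → A⟦X⟧) : Prop :=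
  ∀ n, M n = 1 + C (β n) * X * M n + C (γ n) * X ^ 2 * M n * M (n + 1)

lemma jacPath_mk_zero (β γ : ℕ → A) :
    (PowerSeries.mk fun n => jacPath β γ n 0) =
      1 + X * (C (β 0) * (PowerSeries.mk fun n => jacPath β γ n 0) +
        C (γ 0) * PowerSeries.mk fun n => jacPath β γ n 1) := by
  ext n
  cases n with
  | zero => simp [jacPath]
  | succ n => rw [map_add, coeff_succ_X_mul]; simp [jacPath, coeff_one]

lemma jacPath_mk_succ (β γ : ℕ → A) (h : ℕ) :
    (PowerSeries.mk fun n => jacPath β γ n (h + 1)) =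
      X * ((PowerSeries.mk fun n => jacPath β γ n h) +
        C (β (h + 1)) * (PowerSeries.mk fun n => jacPath β γ n (h + 1)) +
        C (γ (h + 1)) * PowerSeries.mk fun n => jacPath β γ n (h + 2)) := by
  ext n
  cases n with
  | zero => simp [jacPath]
  | succ n => rw [coeff_succ_X_mul]; simp [jacPath]

/-- A Motzkin path from level 0 to level `h + 1` splits at its last step from level 0 to level 1.
Before this step it is a closed path at level 0; after it, a path with shifted weights that never
comes back. -/
lemma jacPath_mk_shift (β γ : ℕ → A) (h : ℕ) :
    (PowerSeries.mk fun n => jacPath β γ n (h + 1)) =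
      X * (jac β γ * PowerSeries.mk fun n =>
        jacPath (fun k => β (k + 1)) (fun k => γ (k + 1)) n h) := by
  ext n
  induction n generalizing h with
  | zero => simp [jacPath]
  | succ n ih =>
    rw [jacPath_mk_succ, coeff_succ_X_mul, coeff_succ_X_mul]
    simp only [map_add, coeff_C_mul, ih]
    cases h with
    | zero =>
      conv_rhs => rw [jacPath_mk_zero (fun k => β (k + 1))]
      have : ∀ a b c d e : A⟦X⟧, a * (1 + X * (b * c + d * e)) =
          a + b * (X * (a * c)) + d * (X * (a * e)) := fun a b c d e => by ring
      rw [this, map_add, map_add, coeff_C_mul, coeff_C_mul, zero_add]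
      rfl
    | succ h =>
      conv_rhs => rw [jacPath_mk_succ (fun k => β (k + 1))]
      have : ∀ a b c d e f : A⟦X⟧, a * (X * (f + b * c + d * e)) =
          X * (a * f) + b * (X * (a * c)) + d * (X * (a * e)) := fun a b c d e f => by ring
      rw [this, map_add, map_add, coeff_C_mul, coeff_C_mul, ih]

lemma jac_eq (β γ : ℕ → A) :
    jac β γ = 1 + C (β 0) * X * jac β γ +
      C (γ 0) * X ^ 2 * jac β γ * jac (fun k => β (k + 1)) (fun k => γ (k + 1)) := by
  have h := jacPath_mk_zero β γ
  rw [jacPath_mk_shift β γ 0] at h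
  change jac β γ = _ at h
  conv_lhs => rw [h]
  simp only [jac]
  ring

lemma isJacChain_jac (β γ : ℕ → A) :
    IsJacChain β γ fun n => jac (fun k => β (k + n)) (fun k => γ (k + n)) := by
  intro n
  have h := jac_eq (fun k => β (k + n)) (fun k => γ (k + n))
  simp only [zero_add] at h
  convert h using 5
  · exact congrArg β (by omega)
  · exact congrArg γ (by omega)

lemma IsJacChain.constantCoeff {β γ : ℕ → A} {M : ℕ → A⟦X⟧} (h : IsJacChain β γ M) (n : ℕ) :
    PowerSeries.constantCoeff (M n) = 1 := by
  rw [h n]; simp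

lemma IsJacChain.shift {β γ : ℕ → A} {M : ℕ → A⟦X⟧} (h : IsJacChain β γ M) :
    IsJacChain (fun k => β (k + 1)) (fun k => γ (k + 1)) fun k => M (k + 1) := fun n => h (n + 1)

lemma constantCoeff_jac (β γ : ℕ → A) : constantCoeff (jac β γ) = 1 := by
  simp [jac, jacPath]

lemma IsJacChain.coeff_succ {β γ : ℕ → A} {M : ℕ → A⟦X⟧} (h : IsJacChain β γ M) (n : ℕ) :
    coeff (n + 1) (M 0) = β 0 * coeff n (M 0) + γ 0 * coeff n (X * (M 0 * M 1)) := by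
  conv_lhs => rw [h 0]
  have : 1 + C (β 0) * X * M 0 + C (γ 0) * X ^ 2 * M 0 * M (0 + 1) =
      1 + X * (C (β 0) * M 0 + C (γ 0) * (X * (M 0 * M 1))) := by ring
  rw [this, map_add, coeff_succ_X_mul, map_add, coeff_C_mul, coeff_C_mul]
  simp [coeff_one]

/-- By `coeff_succ` the tail enters only through coefficients of lower order and multiplied by `γ
0`. So only parameters of index below `m` matter, and none beyond a vanishing γ: this is why
non-genuine parameters can be disregarded. -/
lemma IsJacChain.coeff_congr (m : ℕ) : ∀ {β γ β' γ' : ℕ → A} {M M' : ℕ → A⟦X⟧},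
    IsJacChain β γ M → IsJacChain β' γ' M' →
    (∀ n < m, (∀ k < n, γ k ≠ 0) → β n = β' n ∧ γ n = γ' n) →
    coeff m (M 0) = coeff m (M' 0) := by
  induction m using Nat.strong_induction_on with
  | _ m ih =>
    intro β γ β' γ' M M' h h' hag
    cases m with
    | zero =>
      rw [coeff_zero_eq_constantCoeff_apply, coeff_zero_eq_constantCoeff_apply, h.constantCoeff,
        h'.constantCoeff]
    | succ m =>
      have h0 := hag 0 (by omega) (by simp)
      have hM : ∀ i ≤ m, coeff i (M 0) = coeff i (M' 0) := fun i hi =>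
        ih i (by omega) h h' fun n hn => hag n (by omega)
      rw [h.coeff_succ, h'.coeff_succ, hM m le_rfl, h0.1, ← h0.2]
      by_cases hγ : γ 0 = 0
      · rw [hγ, zero_mul, zero_mul]
      · congr 2
        cases m with
        | zero => simp
        | succ m =>
          rw [coeff_succ_X_mul, coeff_succ_X_mul, coeff_mul, coeff_mul]
          refine sum_congr rfl fun p hp => ?_
          rw [HasAntidiagonal.mem_antidiagonal] at hp
          rw [hM p.1 (by omega), ih p.2 (by omega) h.shift h'.shift]
          intro n hn hg
          refine hag (n + 1) (by omega) fun k hk => ?_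
          cases k with
          | zero => exact hγ
          | succ k => exact hg k (by omega)

lemma coeff_jac_congr {β γ β' γ' : ℕ → A} {m : ℕ}
    (h : ∀ n < m, (∀ k < n, γ k ≠ 0) → β n = β' n ∧ γ n = γ' n) :
    coeff m (jac β γ) = coeff m (jac β' γ') :=
  IsJacChain.coeff_congr m (isJacChain_jac β γ) (isJacChain_jac β' γ') h

lemma jac_congr {β γ β' γ' : ℕ → A}
    (h : ∀ n, (∀ k < n, γ k ≠ 0) → β n = β' n ∧ γ n = γ' n) : jac β γ = jac β' γ' := by
  ext m
  exact coeff_jac_congr fun n _ => h n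

lemma IsJacChain.eq_jac {β γ : ℕ → A} {M : ℕ → A⟦X⟧} (h : IsJacChain β γ M) : M 0 = jac β γ := by
  ext m
  exact IsJacChain.coeff_congr m h (isJacChain_jac β γ) fun _ _ _ => ⟨rfl, rfl⟩

lemma map_jac {B : Type*} [CommRing B] (φ : A →+* B) (β γ : ℕ → A) :
    (jac β γ).map φ = jac (fun n => φ (β n)) (fun n => φ (γ n)) := by
  have h : IsJacChain (fun n => φ (β n)) (fun n => φ (γ n)) fun n =>
      (jac (fun k => β (k + n)) (fun k => γ (k + n))).map φ := by
    intro n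
    have := congrArg (PowerSeries.map φ) (isJacChain_jac β γ n)
    simpa only [map_add, map_mul, map_one, map_pow, PowerSeries.map_X, PowerSeries.map_C] using this
  exact h.eq_jac

/-- The first step of a continued fraction expansion is unique. -/
lemma cfrac_step_unique {M N N' : A⟦X⟧} {b b' c c' : A} (hM : constantCoeff M = 1)
    (hN : constantCoeff N = 1) (hN' : constantCoeff N' = 1)
    (h : M = 1 + C b * X * M + C c * X ^ 2 * M * N)
    (h' : M = 1 + C b' * X * M + C c' * X ^ 2 * M * N') :
    b = b' ∧ c = c' ∧ C c * N = C c * N' := by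
  have hu := isUnit_of_constantCoeff_eq_one hM
  have e : C b + X * (C c * N) = C b' + X * (C c' * N') := by
    apply X_mul_cancel
    apply hu.mul_left_cancel
    linear_combination h' - h
  have e0 : b = b' := by
    have := congrArg PowerSeries.constantCoeff e
    simpa using this
  subst e0
  have e1 := X_mul_cancel (add_left_cancel e)
  have e2 : c = c' := by
    have := congrArg PowerSeries.constantCoeff e1
    simpa [hN, hN'] using this
  subst e2
  exact ⟨rfl, rfl, e1⟩

lemma jac_params_unique_step {β γ β' γ' : ℕ → A} (h : jac β γ = jac β' γ') :
    β 0 = β' 0 ∧ γ 0 = γ' 0 ∧ (IsUnit (γ 0) →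
      jac (fun k => β (k + 1)) (fun k => γ (k + 1)) =
        jac (fun k => β' (k + 1)) (fun k => γ' (k + 1))) := by
  obtain ⟨h0, h1, h2⟩ := cfrac_step_unique (constantCoeff_jac β γ) (constantCoeff_jac _ _)
    (constantCoeff_jac _ _) (jac_eq β γ) (h ▸ jac_eq β' γ')
  exact ⟨h0, h1, fun hu => (hu.map (C (R := A))).mul_left_cancel h2⟩

lemma jac_params_unique (n : ℕ) : ∀ {β γ β' γ' : ℕ → A}, jac β γ = jac β' γ' →
    (∀ k < n, IsUnit (γ k)) → β n = β' n ∧ γ n = γ' n := by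
  induction n with
  | zero =>
    intro β γ β' γ' h _
    exact ⟨(jac_params_unique_step h).1, (jac_params_unique_step h).2.1⟩
  | succ n ih =>
    intro β γ β' γ' h hu
    exact ih ((jac_params_unique_step h).2.2 (hu 0 n.succ_pos))
      fun k hk => hu (k + 1) (by omega)

open Filter Topology

/-- The parameters of index 0 are polynomials in the first two moments. The moments of the tail are
then found one at a time upon division by `γ 0`, which is continuous because the limit is nonzero.
-/
lemma tendsto_jac_shift {ι : Type*} {l : Filter ι} {B G : ι → ℕ → ℝ} {β γ : ℕ → ℝ}
    (h : ∀ k, Tendsto (fun i => coeff k (jac (B i) (G i))) l (𝓝 (coeff k (jac β γ))))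
    (hγ : γ 0 ≠ 0) :
    Tendsto (fun i => B i 0) l (𝓝 (β 0)) ∧ Tendsto (fun i => G i 0) l (𝓝 (γ 0)) ∧
    ∀ k, Tendsto (fun i => coeff k (jac (fun n => B i (n + 1)) (fun n => G i (n + 1)))) l
      (𝓝 (coeff k (jac (fun n => β (n + 1)) (fun n => γ (n + 1))))) := by
  have c1 : ∀ β γ : ℕ → ℝ, coeff 1 (jac β γ) = β 0 := by intro β γ; simp [jac, jacPath]
  have c2 : ∀ β γ : ℕ → ℝ, coeff 2 (jac β γ) = β 0 * β 0 + γ 0 := by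
    intro β γ; simp [jac, jacPath]
  have hB : Tendsto (fun i => B i 0) l (𝓝 (β 0)) := by simpa only [c1] using h 1
  have hG : Tendsto (fun i => G i 0) l (𝓝 (γ 0)) := by
    have := (h 2).sub (hB.mul hB)
    simpa only [c2, add_sub_cancel_left] using this
  refine ⟨hB, hG, fun k => ?_⟩
  -- The continued fraction equation in degree `k + 2`, solved for the coefficient of order `k` of
  -- the tail.
  have hrec : ∀ (β γ : ℕ → ℝ) (k : ℕ),
      γ 0 * coeff k (jac (fun n => β (n + 1)) (fun n => γ (n + 1))) =
        coeff (k + 2) (jac β γ) - β 0 * coeff (k + 1) (jac β γ) - γ 0 *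
          (∑ j ∈ range k, coeff (k - j) (jac β γ) *
            coeff j (jac (fun n => β (n + 1)) (fun n => γ (n + 1)))) := by
    intro β γ k
    have := (isJacChain_jac β γ).coeff_succ (k + 1)
    simp only [add_zero] at this
    rw [this, coeff_succ_X_mul, mul_comm (jac β γ), coeff_mul,
      Finset.Nat.sum_antidiagonal_eq_sum_range_succ_mk, sum_range_succ]
    simp only [Nat.sub_self, coeff_zero_eq_constantCoeff_apply, constantCoeff_jac]
    simp only [mul_comm (coeff _ (jac (fun n => β (n + 1)) _)) (coeff _ (jac β γ))]
    ring
  induction k using Nat.strong_induction_on with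
  | _ k ih =>
    have h1 : Tendsto (fun i => G i 0 *
        coeff k (jac (fun n => B i (n + 1)) (fun n => G i (n + 1)))) l
        (𝓝 (γ 0 * coeff k (jac (fun n => β (n + 1)) (fun n => γ (n + 1))))) := by
      simp only [hrec]
      refine ((h _).sub (hB.mul (h _))).sub (hG.mul (tendsto_finsetSum _ fun j hj => ?_))
      exact (h _).mul (ih j (by simpa using hj))
    have h2 := h1.div hG hγ
    rw [mul_div_cancel_left₀ _ hγ] at h2
    refine h2.congr' ?_
    filter_upwards [hG.eventually_ne hγ] with i hi
    rw [Pi.div_apply, mul_div_cancel_left₀ _ hi]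

lemma tendsto_jac_params {ι : Type*} {l : Filter ι} (n : ℕ) : ∀ {B G : ι → ℕ → ℝ} {β γ : ℕ → ℝ},
    (∀ k, Tendsto (fun i => coeff k (jac (B i) (G i))) l (𝓝 (coeff k (jac β γ)))) →
    (∀ n, γ n ≠ 0) →
    Tendsto (fun i => B i n) l (𝓝 (β n)) ∧ Tendsto (fun i => G i n) l (𝓝 (γ n)) := by
  induction n with
  | zero =>
    intro B G β γ h hγ
    exact ⟨(tendsto_jac_shift h (hγ 0)).1, (tendsto_jac_shift h (hγ 0)).2.1⟩
  | succ n ih =>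
    intro B G β γ h hγ
    exact ih (tendsto_jac_shift h (hγ 0)).2.2 fun k => hγ (k + 1)

end Jacobi

/-! ### Orthogonality and the continued fraction of the moment series -/

section Orthogonality

open Polynomial

/-- The linear functional on polynomials with moments `s`. -/
def momentFunctional (s : ℕ → ℝ) : ℝ[X] →ₗ[ℝ] ℝ :=
  Polynomial.lsum fun n => LinearMap.mulRight ℝ (s n)

@[simp] lemma momentFunctional_monomial (s : ℕ → ℝ) (n : ℕ) (a : ℝ) :
    momentFunctional s (monomial n a) = a * s n := by
  simp [momentFunctional, Polynomial.lsum]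

lemma momentFunctional_one (s : ℕ → ℝ) : momentFunctional s 1 = s 0 := by
  rw [← monomial_zero_one, momentFunctional_monomial, one_mul]

lemma momentFunctional_C_mul (s : ℕ → ℝ) (a : ℝ) (p : ℝ[X]) :
    momentFunctional s (C a * p) = a * momentFunctional s p := by
  rw [← smul_eq_C_mul, map_smul, smul_eq_mul]

lemma HasAllMoments.integrable_eval {μ : Measure ℝ} (h : HasAllMoments μ) (p : ℝ[X]) :
    Integrable (fun x => p.eval x) μ := by
  induction p using Polynomial.induction_on' with
  | add p q hp hq =>
    simp only [eval_add]
    exact hp.add hq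
  | monomial n a => simpa using (h n).const_mul a

lemma integral_eval {μ : Measure ℝ} (h : HasAllMoments μ) (p : ℝ[X]) :
    ∫ x, p.eval x ∂μ = momentFunctional (rawMoment μ) p := by
  induction p using Polynomial.induction_on' with
  | add p q hp hq =>
    rw [map_add, ← hp, ← hq, ← integral_add (h.integrable_eval p) (h.integrable_eval q)]
    simp
  | monomial n a => simp [integral_const_mul, rawMoment]

lemma X_mul_jacobiPoly_zero (β γ : ℕ → ℝ) :
    X * jacobiPoly β γ 0 = jacobiPoly β γ 1 + C (β 0) * jacobiPoly β γ 0 := by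
  simp [jacobiPoly]

lemma X_mul_jacobiPoly_succ (β γ : ℕ → ℝ) (n : ℕ) :
    X * jacobiPoly β γ (n + 1) = jacobiPoly β γ (n + 2) +
      C (β (n + 1)) * jacobiPoly β γ (n + 1) + C (γ n) * jacobiPoly β γ n := by
  rw [jacobiPoly.eq_3]
  ring

lemma momentFunctional_jacPath_X_mul_zero (β γ : ℕ → ℝ) (p : ℝ[X]) :
    momentFunctional (jacPath β γ · 0) (X * p) = β 0 * momentFunctional (jacPath β γ · 0) p +
      γ 0 * momentFunctional (jacPath β γ · 1) p := by
  induction p using Polynomial.induction_on' with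
  | add p q hp hq => rw [mul_add, map_add, map_add, map_add, hp, hq]; ring
  | monomial n a => simp only [X_mul_monomial, momentFunctional_monomial, jacPath]; ring

lemma momentFunctional_jacPath_X_mul_succ (β γ : ℕ → ℝ) (h : ℕ) (p : ℝ[X]) :
    momentFunctional (jacPath β γ · (h + 1)) (X * p) = momentFunctional (jacPath β γ · h) p +
      β (h + 1) * momentFunctional (jacPath β γ · (h + 1)) p +
      γ (h + 1) * momentFunctional (jacPath β γ · (h + 2)) p := by
  induction p using Polynomial.induction_on' with
  | add p q hp hq => rw [mul_add, map_add, map_add, map_add, map_add, hp, hq]; ring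
  | monomial n a => simp only [X_mul_monomial, momentFunctional_monomial, jacPath]; ring

/-- Since `jacPath β γ n h` is the coefficient of P_h in the expansion of x^n, these functionals
form the basis dual to the P_m. -/
lemma momentFunctional_jacPath_jacobiPoly (β γ : ℕ → ℝ) (m : ℕ) : ∀ h : ℕ,
    momentFunctional (jacPath β γ · h) (jacobiPoly β γ m) = if m = h then 1 else 0 := by
  have hs : ∀ m, jacobiPoly β γ (m + 2) = X * jacobiPoly β γ (m + 1) -
      C (β (m + 1)) * jacobiPoly β γ (m + 1) - C (γ m) * jacobiPoly β γ m := fun m => by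
    rw [X_mul_jacobiPoly_succ]; ring
  have h0 : ∀ h : ℕ,
      momentFunctional (jacPath β γ · h) (jacobiPoly β γ 0) = if 0 = h then 1 else 0 := by
    rintro (_ | h)
    · rw [jacobiPoly, momentFunctional_one]; simp [jacPath]
    · rw [jacobiPoly, momentFunctional_one]; simp [jacPath]
  induction m using Nat.strong_induction_on with
  | _ m ih =>
    match m with
    | 0 => exact h0
    | 1 =>
      have e : jacobiPoly β γ 1 = X * jacobiPoly β γ 0 - C (β 0) * jacobiPoly β γ 0 := by
        rw [X_mul_jacobiPoly_zero]; ring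
      rintro (_ | h)
      · rw [e, map_sub, momentFunctional_C_mul, momentFunctional_jacPath_X_mul_zero, h0, h0]
        simp
      · rw [e, map_sub, momentFunctional_C_mul, momentFunctional_jacPath_X_mul_succ, h0, h0, h0]
        rcases h with _ | h <;> simp
    | m + 2 =>
      have h1 := ih (m + 1) (by omega)
      have h2 := ih m (by omega)
      rintro (_ | h)
      · rw [hs, map_sub, map_sub, momentFunctional_C_mul, momentFunctional_C_mul,
          momentFunctional_jacPath_X_mul_zero, h1, h1, h2]
        rcases m with _ | m <;> simp
      · rw [hs, map_sub, map_sub, momentFunctional_C_mul, momentFunctional_C_mul,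
          momentFunctional_jacPath_X_mul_succ, h1, h1, h1, h2]
        by_cases e1 : m = h
        · subst e1
          simp
        have e1' : ¬ m + 1 = h + 1 := by omega
        have e2' : ¬ m + 1 = h + 2 ↔ ¬ m = h + 1 := by omega
        have e3 : m + 2 = h + 1 ↔ m + 1 = h := by omega
        by_cases e2 : m = h + 1
        · rw [if_neg e1', if_pos (by omega : m + 1 = h + 2), if_pos e2,
            if_neg (by omega : ¬ m + 1 = h), if_neg (by omega : ¬ m + 2 = h + 1), e2]
          ring
        · rw [if_neg e1', if_neg (e2'.2 e2), if_neg e2, ← if_congr e3 rfl rfl]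
          ring

lemma momentFunctional_jacPath_X_pow_mul (β γ : ℕ → ℝ) (n k : ℕ) : ∀ h : ℕ, h + k < n →
    momentFunctional (jacPath β γ · h) (X ^ k * jacobiPoly β γ n) = 0 := by
  induction k with
  | zero =>
    intro h hh
    rw [pow_zero, one_mul, momentFunctional_jacPath_jacobiPoly, if_neg (by omega)]
  | succ k ih =>
    rintro (_ | h) hh
    · rw [pow_succ', mul_assoc, momentFunctional_jacPath_X_mul_zero, ih _ (by omega),
        ih _ (by omega), mul_zero, mul_zero, add_zero]
    · rw [pow_succ', mul_assoc, momentFunctional_jacPath_X_mul_succ, ih _ (by omega),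
        ih _ (by omega), ih _ (by omega), mul_zero, mul_zero, add_zero, add_zero]

lemma natDegree_jacobiPoly_le (β γ : ℕ → ℝ) (n : ℕ) : (jacobiPoly β γ n).natDegree ≤ n := by
  induction n using Nat.strong_induction_on with
  | _ n ih =>
    match n with
    | 0 => simp [jacobiPoly]
    | 1 => simp [jacobiPoly]
    | n + 2 =>
      rw [jacobiPoly.eq_3]
      have h1 := ih (n + 1) (by omega)
      have h2 := ih n (by omega)
      refine (natDegree_sub_le _ _).trans (max_le ?_ ?_)
      · refine natDegree_mul_le.trans ?_
        rw [natDegree_X_sub_C]; omega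
      · exact (natDegree_C_mul_le _ _).trans (by omega)

lemma momentFunctional_jacPath_mul (β γ : ℕ → ℝ) {n : ℕ} {p : ℝ[X]} (hp : p.natDegree < n) :
    momentFunctional (jacPath β γ · 0) (p * jacobiPoly β γ n) = 0 := by
  rw [p.as_sum_range_C_mul_X_pow, Finset.sum_mul, map_sum]
  refine Finset.sum_eq_zero fun k hk => ?_
  rw [Finset.mem_range] at hk
  rw [mul_assoc, momentFunctional_C_mul,
    momentFunctional_jacPath_X_pow_mul β γ n k 0 (by omega), mul_zero]

lemma momentFunctional_jacPath_orthogonal (β γ : ℕ → ℝ) {m n : ℕ} (h : m ≠ n) :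
    momentFunctional (jacPath β γ · 0) (jacobiPoly β γ m * jacobiPoly β γ n) = 0 := by
  rcases lt_or_gt_of_ne h with h | h
  · exact momentFunctional_jacPath_mul β γ ((natDegree_jacobiPoly_le β γ m).trans_lt h)
  · rw [mul_comm]
    exact momentFunctional_jacPath_mul β γ ((natDegree_jacobiPoly_le β γ n).trans_lt h)

lemma momentFunctional_jacPath_sq_zero (β γ : ℕ → ℝ) :
    momentFunctional (jacPath β γ · 0) (jacobiPoly β γ 0 * jacobiPoly β γ 0) = 1 := by
  rw [jacobiPoly, mul_one, momentFunctional_one]; simp [jacPath]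

/-- One factor P_{n+1} may be replaced by x P_n, from which it differs by a polynomial of lower
degree; the recursion for x P_{n+1} then leaves only γ_n P_n². -/
lemma momentFunctional_jacPath_sq_succ (β γ : ℕ → ℝ) (n : ℕ) :
    momentFunctional (jacPath β γ · 0) (jacobiPoly β γ (n + 1) * jacobiPoly β γ (n + 1)) =
      γ n * momentFunctional (jacPath β γ · 0) (jacobiPoly β γ n * jacobiPoly β γ n) := by
  set P := jacobiPoly β γ with hP
  have e1 : P (n + 1) * P (n + 1) = (X * P n) * P (n + 1) + (P (n + 1) - X * P n) * P (n + 1) := by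
    ring
  have e2 : (P (n + 1) - X * P n).natDegree < n + 1 := by
    rcases n with _ | n
    · rw [hP, X_mul_jacobiPoly_zero, sub_add_cancel_left, natDegree_neg]
      refine (natDegree_C_mul_le _ _).trans_lt ?_
      exact (natDegree_jacobiPoly_le β γ 0).trans_lt (by omega)
    · have : P (n + 1 + 1) - X * P (n + 1) = -(C (β (n + 1)) * P (n + 1) + C (γ n) * P n) := by
        rw [hP, X_mul_jacobiPoly_succ]; ring
      rw [this, natDegree_neg]
      refine (natDegree_add_le _ _).trans_lt (max_lt ?_ ?_)
      · exact ((natDegree_C_mul_le _ _).trans (natDegree_jacobiPoly_le β γ _)).trans_lt (by omega)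
      · exact ((natDegree_C_mul_le _ _).trans (natDegree_jacobiPoly_le β γ _)).trans_lt (by omega)
  have e3 : (X * P n) * P (n + 1) = P n * P (n + 2) + C (β (n + 1)) * (P n * P (n + 1)) +
      C (γ n) * (P n * P n) := by
    rw [mul_right_comm, hP, X_mul_jacobiPoly_succ]; ring
  rw [e1, map_add, momentFunctional_jacPath_mul β γ e2, e3, map_add, map_add,
    momentFunctional_C_mul, momentFunctional_C_mul,
    momentFunctional_jacPath_orthogonal β γ (by omega : n ≠ n + 2),
    momentFunctional_jacPath_orthogonal β γ (by omega : n ≠ n + 1)]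
  ring

lemma rawMoment_eq_jacPath {μ : Measure ℝ} {β γ : ℕ → ℝ} (h : momentSeries μ = jac β γ) :
    rawMoment μ = (jacPath β γ · 0) := by
  funext n
  simpa [momentSeries, jac] using congrArg (PowerSeries.coeff n) h

/-- A measure with moment series `jac β γ` has Jacobi parameters `β, γ`. -/
lemma hasJacobiParameters_of_momentSeries {μ : Measure ℝ} (hμ : HasAllMoments μ) {β γ : ℕ → ℝ}
    (hγ : ∀ n, 0 ≤ γ n) (h : momentSeries μ = jac β γ) : HasJacobiParameters μ β γ := by
  refine ⟨hγ, fun m n hmn => ?_⟩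
  simp only [← eval_mul]
  rw [integral_eval hμ, rawMoment_eq_jacPath h, momentFunctional_jacPath_orthogonal β γ hmn]

/-- The functional of the measure and the formal one both take the value 1 at P₀ and 0 at the other
P_k. Writing x P_k through the recursion propagates their agreement to x^n P_k, and k = 0 gives the
moments. -/
lemma HasJacobiParameters.momentSeries {μ : Measure ℝ} [IsProbabilityMeasure μ]
    (hμ : HasAllMoments μ) {β γ : ℕ → ℝ} (h : HasJacobiParameters μ β γ) :
    momentSeries μ = jac β γ := by
  have key : ∀ n k : ℕ, momentFunctional (rawMoment μ) (X ^ n * jacobiPoly β γ k) =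
      momentFunctional (jacPath β γ · 0) (X ^ n * jacobiPoly β γ k) := by
    intro n
    induction n with
    | zero =>
      intro k
      rw [pow_zero, one_mul]
      rcases k with _ | k
      · rw [jacobiPoly, momentFunctional_one, momentFunctional_one, rawMoment_zero]
        simp [jacPath]
      · rw [momentFunctional_jacPath_jacobiPoly, if_neg k.succ_ne_zero, ← integral_eval hμ]
        simpa [jacobiPoly] using h.orthogonal (k + 1) 0 k.succ_ne_zero
    | succ n ih =>
      rintro (_ | k)
      · rw [pow_succ, mul_assoc, X_mul_jacobiPoly_zero, mul_add, mul_left_comm, map_add, map_add,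
          momentFunctional_C_mul, momentFunctional_C_mul, ih, ih]
      · rw [pow_succ, mul_assoc, X_mul_jacobiPoly_succ, mul_add, mul_add, mul_left_comm,
          mul_left_comm _ (C (γ k)), map_add, map_add, map_add, map_add,
          momentFunctional_C_mul, momentFunctional_C_mul, momentFunctional_C_mul,
          momentFunctional_C_mul, ih, ih, ih]
  ext n
  have := key n 0
  rw [jacobiPoly, mul_one, X_pow_eq_monomial, momentFunctional_monomial,
    momentFunctional_monomial, one_mul, one_mul] at this
  simpa [TwoState.momentSeries, jac] using this

lemma integral_jacobiPoly_sq {μ : Measure ℝ} (hμ : HasAllMoments μ) {β γ : ℕ → ℝ}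
    (h : momentSeries μ = jac β γ) :
    ∫ x, (jacobiPoly β γ 1).eval x ^ 2 ∂μ = γ 0 ∧
      ∫ x, (jacobiPoly β γ 2).eval x ^ 2 ∂μ = γ 1 * γ 0 := by
  simp only [sq, ← eval_mul]
  rw [integral_eval hμ, integral_eval hμ, rawMoment_eq_jacPath h,
    momentFunctional_jacPath_sq_succ, momentFunctional_jacPath_sq_succ,
    momentFunctional_jacPath_sq_succ, momentFunctional_jacPath_sq_zero]
  simp

/-- Needed for roots of a pair, where the continued fraction is computed formally and no sign of its
coefficients is known in advance. -/
lemma mul_nonneg_of_momentSeries {μ : Measure ℝ} (hμ : HasAllMoments μ) {β γ : ℕ → ℝ}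
    (h : momentSeries μ = jac β γ) : 0 ≤ γ 1 * γ 0 := by
  rw [← (integral_jacobiPoly_sq hμ h).2]
  exact integral_nonneg fun x => sq_nonneg _

/-- The number `γ 0` is the variance of the measure. -/
lemma isPointMass_iff {μ : Measure ℝ} [IsProbabilityMeasure μ] (hμ : HasAllMoments μ)
    {β γ : ℕ → ℝ} (h : momentSeries μ = jac β γ) : IsPointMass μ ↔ γ 0 = 0 := by
  have hs := rawMoment_eq_jacPath h
  constructor
  · rintro ⟨a, rfl⟩
    have h1 := congrFun hs 1
    have h2 := congrFun hs 2
    simp [rawMoment, jacPath] at h1 h2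
    rw [h1] at h2
    linarith [sq (β 0)]
  · intro h0
    have h1 := (integral_jacobiPoly_sq hμ h).1
    rw [h0, integral_eq_zero_iff_of_nonneg (fun x => sq_nonneg _)
      (by simpa only [sq, eval_mul] using hμ.integrable_eval (jacobiPoly β γ 1 * jacobiPoly β γ 1))] at h1
    have h2 : (id : ℝ → ℝ) =ᵐ[μ] fun _ => β 0 := by
      filter_upwards [h1] with x hx
      simp [jacobiPoly] at hx
      simp only [id]; linarith
    refine ⟨β 0, ?_⟩
    have h3 : μ.map id = μ.map fun _ => β 0 := Measure.map_congr h2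
    rwa [Measure.map_id, Measure.map_const, measure_univ, one_smul] at h3

end Orthogonality

/-! ### Favard's theorem via Gauss quadrature and compactness -/

section Favard

open Finset Matrix Filter Topology

/-- The truncated symmetric Jacobi matrix. -/
def jacMatrix (β γ : ℕ → ℝ) (N : ℕ) : Matrix (Fin (N + 1)) (Fin (N + 1)) ℝ :=
  Matrix.of fun i j => (if (j : ℕ) = i then β i else 0) +
    (if (j : ℕ) = i + 1 then √(γ i) else 0) + (if (i : ℕ) = j + 1 then √(γ j) else 0)

lemma jacMatrix_apply (β γ : ℕ → ℝ) (N : ℕ) (i j : Fin (N + 1)) :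
    jacMatrix β γ N i j = (if (j : ℕ) = i then β i else 0) +
    (if (j : ℕ) = i + 1 then √(γ i) else 0) + (if (i : ℕ) = j + 1 then √(γ j) else 0) := rfl

lemma isHermitian_jacMatrix (β γ : ℕ → ℝ) (N : ℕ) : (jacMatrix β γ N).IsHermitian := by
  ext i j
  rw [conjTranspose_apply, star_trivial, jacMatrix_apply, jacMatrix_apply]
  by_cases h : (i : ℕ) = j
  · simp [h]
  · simp only [h, Ne.symm h, if_false]; ring

/-- The condition `w (N + 1) = 0` makes the truncated matrix act as the infinite one would. -/
lemma jacMatrix_mulVec (β γ : ℕ → ℝ) (N : ℕ) (w : ℕ → ℝ) (hw : w (N + 1) = 0)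
    (i : Fin (N + 1)) :
    (jacMatrix β γ N *ᵥ fun j => w j) i = β i * w i + √(γ i) * w (i + 1) +
      if (i : ℕ) = 0 then 0 else √(γ (i - 1)) * w (i - 1) := by
  have hi := i.isLt
  have e : (jacMatrix β γ N *ᵥ fun j => w j) i =
      ∑ j ∈ range (N + 1), ((if j = i then β i else 0) +
        (if j = i + 1 then √(γ i) else 0) + (if (i : ℕ) = j + 1 then √(γ j) else 0)) * w j := by
    rw [mulVec, dotProduct, ← Fin.sum_univ_eq_sum_range (fun j => ((if j = i then β i else 0) +
        (if j = i + 1 then √(γ i) else 0) + (if (i : ℕ) = j + 1 then √(γ j) else 0)) * w j)]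
    rfl
  rw [e]
  simp only [add_mul, ite_mul, zero_mul, sum_add_distrib, sum_ite_eq', mem_range]
  rw [if_pos hi]
  congr 1
  · congr 1
    split_ifs with h
    · rfl
    · have : (i : ℕ) + 1 = N + 1 := by omega
      rw [this, hw, mul_zero]
  · split_ifs with h
    · exact sum_eq_zero fun j _ => if_neg (by omega)
    · rw [sum_eq_single (i - 1 : ℕ)]
      · rw [if_pos (by omega)]
      · intro j _ hj
        exact if_neg (by omega)
      · intro hj
        exact absurd (mem_range.2 (by omega)) hj

lemma jacPath_eq_zero (β γ : ℕ → ℝ) (n : ℕ) : ∀ h, n < h → jacPath β γ n h = 0 := by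
  induction n with
  | zero =>
    rintro (_ | h) hh
    · omega
    · rfl
  | succ n ih =>
    rintro (_ | h) hh
    · omega
    · rw [jacPath, ih _ (by omega), ih _ (by omega), ih _ (by omega)]; ring

/-- The products of square roots are the norms of the P_i, that is, the passage from the monic to
the orthonormal basis. A path of at most `N` steps does not notice the truncation. -/
lemma jacMatrix_pow_mulVec {β γ : ℕ → ℝ} (hγ : ∀ n, 0 ≤ γ n) (N n : ℕ) (hn : n ≤ N) :
    (jacMatrix β γ N ^ n) *ᵥ Pi.single 0 1 =
      fun i : Fin (N + 1) => (∏ k ∈ range i, √(γ k)) * jacPath β γ n i := by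
  induction n with
  | zero =>
    rw [pow_zero, one_mulVec]
    ext i
    refine Fin.cases ?_ (fun i => ?_) i
    · simp [jacPath]
    · simp [jacPath, Fin.succ_ne_zero]
  | succ n ih =>
    rw [pow_succ', ← mulVec_mulVec, ih (by omega)]
    ext i
    rw [jacMatrix_mulVec β γ N (fun i => (∏ k ∈ range i, √(γ k)) * jacPath β γ n i)
      (by rw [jacPath_eq_zero _ _ _ _ (by omega), mul_zero])]
    generalize (i : ℕ) = h
    have hs := Real.mul_self_sqrt (hγ h)
    rcases h with _ | h
    · simp only [jacPath, prod_range_succ, if_true, prod_range_zero, zero_add]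
      linear_combination jacPath β γ n 1 * hs
    · simp only [jacPath, prod_range_succ, Nat.succ_ne_zero, if_false, Nat.add_sub_cancel]
      linear_combination (∏ k ∈ range h, √(γ k)) * √(γ h) * jacPath β γ n (h + 2) * hs

lemma abs_eigenvalues_jacMatrix_le {β γ : ℕ → ℝ} {K : ℝ} (hβ : ∀ n, |β n| ≤ K)
    (hγ : ∀ n, √(γ n) ≤ K) (N : ℕ) (i : Fin (N + 1)) :
    |(isHermitian_jacMatrix β γ N).eigenvalues i| ≤ 3 * K := by
  have hK : 0 ≤ K := (abs_nonneg _).trans (hβ 0)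
  set hA := isHermitian_jacMatrix β γ N
  have hev : Module.End.HasEigenvalue (Matrix.toLin' (jacMatrix β γ N)) (hA.eigenvalues i) := by
    refine Module.End.hasEigenvalue_of_hasEigenvector
      (x := (hA.eigenvectorBasis i : Fin (N + 1) → ℝ)) ⟨?_, ?_⟩
    · rw [Module.End.mem_eigenspace_iff, Matrix.toLin'_apply]
      exact hA.mulVec_eigenvectorBasis i
    · intro h
      apply hA.eigenvectorBasis.orthonormal.ne_zero i
      ext j
      exact congrFun h j
  -- Gershgorin: the diagonal entry and the two off-diagonal neighbours contribute at most `K` each.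
  obtain ⟨k, hk⟩ := eigenvalue_mem_ball hev
  rw [Metric.mem_closedBall, Real.dist_eq] at hk
  have hkk : jacMatrix β γ N k k = β k := by simp [jacMatrix_apply]
  have hsum : ∑ j ∈ univ.erase k, ‖jacMatrix β γ N k j‖ ≤ 2 * K := by
    -- For `k = 0` the truncated `k - 1` equals `k`; after the sum is extended to all `j` this only
    -- adds a superfluous nonnegative term.
    calc ∑ j ∈ univ.erase k, ‖jacMatrix β γ N k j‖
        ≤ ∑ j ∈ univ.erase k, ((if (j : ℕ) = k + 1 then K else 0) +
            (if (j : ℕ) = k - 1 then K else 0)) := by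
          refine sum_le_sum fun j hj => ?_
          have hjk : (j : ℕ) ≠ k := fun h => ne_of_mem_erase hj (Fin.ext h)
          rw [jacMatrix_apply, if_neg hjk, zero_add, Real.norm_eq_abs]
          refine (abs_add_le _ _).trans (add_le_add ?_ ?_)
          · split_ifs
            · rw [abs_of_nonneg (Real.sqrt_nonneg _)]; exact hγ _
            · simp
          · split_ifs with h1 h2
            · rw [abs_of_nonneg (Real.sqrt_nonneg _)]; exact hγ _
            · omega
            · simpa using hK
            · simp
      _ ≤ ∑ j : Fin (N + 1), ((if (j : ℕ) = k + 1 then K else 0) +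
            (if (j : ℕ) = k - 1 then K else 0)) :=
          sum_le_sum_of_subset_of_nonneg (subset_univ _) fun j _ _ => by positivity
      _ ≤ 2 * K := by
          rw [Fin.sum_univ_eq_sum_range (fun j => (if j = (k : ℕ) + 1 then K else 0) +
            (if j = (k : ℕ) - 1 then K else 0)), sum_add_distrib, sum_ite_eq', sum_ite_eq', two_mul]
          refine add_le_add ?_ ?_ <;> split_ifs <;> simp [hK]
  have h1 := hβ k
  rw [hkk] at hk
  have h2 := abs_sub_abs_le_abs_sub (hA.eigenvalues i) (β k)
  linarith

/-- Gauss quadrature: a finitely supported measure with prescribed Jacobi parameters up to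
order `N`. -/
lemma exists_quadrature {β γ : ℕ → ℝ} {K : ℝ} (hγ : ∀ n, 0 ≤ γ n) (hβ : ∀ n, |β n| ≤ K)
    (hγK : ∀ n, √(γ n) ≤ K) (N : ℕ) :
    ∃ μ : ProbabilityMeasure (Set.Icc (-(3 * K)) (3 * K)),
      ∀ n ≤ N, ∫ x, (x : ℝ) ^ n ∂(μ : Measure (Set.Icc (-(3 * K)) (3 * K))) = jacPath β γ n 0 := by
  set A := jacMatrix β γ N with hAdef
  set hA := isHermitian_jacMatrix β γ N with hAh
  set U := (hA.eigenvectorUnitary : Matrix (Fin (N + 1)) (Fin (N + 1)) ℝ) with hU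
  -- The measure sought is the spectral measure of `A` at the first basis vector: atoms at the
  -- eigenvalues, weights the squared first coordinates of the eigenvectors.
  have hpow : ∀ n, (A ^ n) 0 0 = ∑ i, U 0 i ^ 2 * hA.eigenvalues i ^ n := by
    intro n
    have h1 : A ^ n = U * diagonal (hA.eigenvalues ^ n) * star U := by
      conv_lhs => rw [hAdef, hA.spectral_theorem]
      rw [← map_pow, Matrix.diagonal_pow, Unitary.conjStarAlgAut_apply]
      rfl
    rw [h1, Matrix.mul_apply]
    refine sum_congr rfl fun i _ => ?_
    rw [Matrix.mul_diagonal]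
    simp [star_apply, hU]
    ring
  have hmom : ∀ n ≤ N, ∑ i, U 0 i ^ 2 * hA.eigenvalues i ^ n = jacPath β γ n 0 := by
    intro n hn
    rw [← hpow]
    have := congrFun (jacMatrix_pow_mulVec (β := β) hγ N n hn) 0
    simpa using this
  have hb := abs_eigenvalues_jacMatrix_le hβ hγK N
  let pt : Fin (N + 1) → Set.Icc (-(3 * K)) (3 * K) := fun i =>
    ⟨hA.eigenvalues i, abs_le.1 (hb i)⟩
  let μ : Measure (Set.Icc (-(3 * K)) (3 * K)) :=
    ∑ i, ENNReal.ofReal (U 0 i ^ 2) • Measure.dirac (pt i)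
  have hμ : IsProbabilityMeasure μ := by
    constructor
    simp only [μ, Measure.finsetSum_apply, Measure.smul_apply, measure_univ, smul_eq_mul, mul_one]
    rw [← ENNReal.ofReal_sum_of_nonneg (fun i _ => sq_nonneg _)]
    have := hmom 0 (Nat.zero_le _)
    simp only [pow_zero, mul_one, jacPath] at this
    rw [this, ENNReal.ofReal_one]
  refine ⟨⟨μ, hμ⟩, fun n hn => ?_⟩
  rw [← hmom n hn]
  change ∫ x, (x : ℝ) ^ n ∂μ = _
  rw [integral_finsetSum_measure]
  · refine sum_congr rfl fun i _ => ?_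
    rw [integral_smul_measure, integral_dirac, ENNReal.toReal_ofReal (sq_nonneg _), smul_eq_mul]
  · intro i _
    exact (integrable_dirac (by simp)).smul_measure ENNReal.ofReal_ne_top

/-- **Favard's theorem** for bounded Jacobi parameters. -/
theorem exists_measure_of_bounded {β γ : ℕ → ℝ} {K : ℝ} (hγ : ∀ n, 0 ≤ γ n)
    (hβ : ∀ n, |β n| ≤ K) (hγK : ∀ n, √(γ n) ≤ K) :
    ∃ μ : Measure ℝ, IsProbabilityMeasure μ ∧ (∀ᵐ x ∂μ, |x| ≤ 3 * K) ∧
      momentSeries μ = jac β γ := by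
  choose μ hμ using fun N => exists_quadrature hγ hβ hγK N
  -- Probability measures on a compact interval form a compact space, so the quadrature measures
  -- converge along any ultrafilter. Each moment is a continuous function of the measure and
  -- eventually has its final value.
  let F : Ultrafilter (ProbabilityMeasure (Set.Icc (-(3 * K)) (3 * K))) :=
    (hyperfilter ℕ).map μ
  have hF : Tendsto μ (hyperfilter ℕ) (𝓝 F.lim) := F.le_nhds_lim
  rw [ProbabilityMeasure.tendsto_iff_forall_integral_tendsto] at hF
  set ν := F.lim
  have hmom : ∀ n, ∫ x, (x : ℝ) ^ n ∂(ν : Measure (Set.Icc (-(3 * K)) (3 * K))) =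
      jacPath β γ n 0 := by
    intro n
    have h1 := hF (BoundedContinuousFunction.mkOfCompact
      ⟨fun x : Set.Icc (-(3 * K)) (3 * K) => (x : ℝ) ^ n, by fun_prop⟩)
    refine tendsto_nhds_unique h1 (tendsto_const_nhds.congr' ?_)
    have : ∀ᶠ N in (hyperfilter ℕ : Filter ℕ), n ≤ N :=
      (Nat.hyperfilter_le_atTop) (eventually_ge_atTop n)
    filter_upwards [this] with N hN
    exact (hμ N n hN).symm
  have hemb : MeasurableEmbedding ((↑) : Set.Icc (-(3 * K)) (3 * K) → ℝ) :=
    MeasurableEmbedding.subtype_coe measurableSet_Icc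
  refine ⟨(ν : Measure (Set.Icc (-(3 * K)) (3 * K))).map (↑),
    Measure.isProbabilityMeasure_map hemb.measurable.aemeasurable, ?_, ?_⟩
  · rw [hemb.ae_map_iff]
    exact Eventually.of_forall fun x => abs_le.2 x.2
  · ext n
    rw [momentSeries, jac, PowerSeries.coeff_mk, PowerSeries.coeff_mk, rawMoment,
      hemb.integral_map, hmom]

lemma hasAllMoments_of_bounded {μ : Measure ℝ} [IsProbabilityMeasure μ] {K : ℝ}
    (h : ∀ᵐ x ∂μ, |x| ≤ K) : HasAllMoments μ := by
  intro n
  refine Integrable.of_bound (by fun_prop) (K ^ n) ?_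
  filter_upwards [h] with x hx
  rw [norm_pow, Real.norm_eq_abs]
  exact pow_le_pow_left₀ (abs_nonneg x) hx n

end Favard

/-! ### The shift identity for free Meixner continued fractions -/

section Meixner

open PowerSeries

variable {A : Type*} [CommRing A]

/-- The sequence `a, b, b, b, …` in a ring. -/
def constTail (a b : A) : ℕ → A
  | 0 => a
  | _ + 1 => b

lemma jac_const_eq (b c : A) :
    jac (fun _ => b) (fun _ => c) = 1 + C b * X * jac (fun _ => b) (fun _ => c) +
      C c * X ^ 2 * jac (fun _ => b) (fun _ => c) ^ 2 := by
  have := jac_eq (fun _ => b) (fun _ => c)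
  rwa [mul_assoc _ (jac _ _), ← sq] at this

lemma jac_constTail_eq (a b c d : A) :
    jac (constTail a b) (constTail c d) = 1 + C a * X * jac (constTail a b) (constTail c d) +
      C c * X ^ 2 * jac (constTail a b) (constTail c d) * jac (fun _ => b) (fun _ => d) :=
  jac_eq (constTail a b) (constTail c d)

/-- The cumulant series of a free Meixner distribution, substituted. -/
lemma compX_const_mul (β₀ γ₀ b c : A) :
    compX (jac (constTail β₀ (b + β₀)) (constTail γ₀ (c + γ₀))) (jac (fun _ => b) (fun _ => c)) *
      jac (constTail β₀ (b + β₀)) (constTail γ₀ (c + γ₀)) =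
      jac (fun _ => b + β₀) (fun _ => c + γ₀) := by
  set M := jac (constTail β₀ (b + β₀)) (constTail γ₀ (c + γ₀)) with hM
  set M₁ := jac (fun _ => b + β₀) (fun _ => c + γ₀) with hM₁
  have eM : M = 1 + C β₀ * X * M + C γ₀ * X ^ 2 * M * M₁ := jac_constTail_eq _ _ _ _
  have eM₁ : M₁ = 1 + (C b + C β₀) * X * M₁ + (C c + C γ₀) * X ^ 2 * M₁ ^ 2 := by
    have := jac_const_eq (b + β₀) (c + γ₀)
    rwa [map_add, map_add] at this
  have eY := congrArg (compX M) (jac_const_eq b c)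
  simp only [map_add, map_mul, map_one, map_pow, compX_C, compX_X] at eY
  set Y := compX M (jac (fun _ => b) (fun _ => c)) with hY
  -- This is M₁ / M, by the equation for `M`. It satisfies the same quadratic equation as `Y`, and
  -- that equation has only one power series solution.
  set Z := M₁ * (1 - C β₀ * X - C γ₀ * X ^ 2 * M₁) with hZ
  have hMZ : M * Z = M₁ := by rw [hZ]; linear_combination M₁ * eM
  have eZ : Z = 1 + C b * X * M₁ + C c * X ^ 2 * M₁ ^ 2 := by rw [hZ]; linear_combination eM₁
  have hu : IsUnit (1 - X * (C b * M + C c * X * M ^ 2 * (Y + Z))) :=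
    isUnit_of_constantCoeff_eq_one (by simp)
  have hYZ : Y = Z := by
    rw [← sub_eq_zero]
    apply hu.mul_left_cancel
    rw [← hMZ] at eZ
    linear_combination eY - eZ
  rw [hYZ, mul_comm, hMZ]

/-- By `compX_const_mul`, the substituted series times `M` is the tail of `M`, so the functional
equation is the first step of the continued fraction. -/
lemma isFreeMoment_meixner (β₀ γ₀ b c : A) :
    IsFreeMoment (C β₀ + C γ₀ * X * jac (fun _ => b) (fun _ => c))
      (jac (constTail β₀ (b + β₀)) (constTail γ₀ (c + γ₀))) := by
  have h := compX_const_mul β₀ γ₀ b c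
  have e := jac_constTail_eq β₀ (b + β₀) γ₀ (c + γ₀)
  rw [← h] at e
  rw [IsFreeMoment]
  simp only [map_add, map_mul, compX_C, compX_X]
  linear_combination e

/-- The argument of `compX_const_mul` carried one level up: N / M and the substituted series solve
the same equation, which is now linear because the tails are already known to correspond. -/
lemma compX_constTail_mul (β₀ γ₀ b c b' c' : A) :
    compX (jac (constTail β₀ (b + β₀)) (constTail γ₀ (c + γ₀)))
        (jac (constTail b' b) (constTail c' c)) *
      jac (constTail β₀ (b + β₀)) (constTail γ₀ (c + γ₀)) =
      jac (constTail (b' + β₀) (b + β₀)) (constTail (c' + γ₀) (c + γ₀)) := by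
  have hY := compX_const_mul β₀ γ₀ b c
  set M := jac (constTail β₀ (b + β₀)) (constTail γ₀ (c + γ₀)) with hM
  set M₁ := jac (fun _ => b + β₀) (fun _ => c + γ₀) with hM₁
  have eM : M = 1 + C β₀ * X * M + C γ₀ * X ^ 2 * M * M₁ := jac_constTail_eq _ _ _ _
  have eN := jac_constTail_eq (b' + β₀) (b + β₀) (c' + γ₀) (c + γ₀)
  rw [← hM₁, map_add, map_add] at eN
  set N := jac (constTail (b' + β₀) (b + β₀)) (constTail (c' + γ₀) (c + γ₀)) with hN
  have eW := congrArg (compX M) (jac_constTail_eq b' b c' c)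
  simp only [map_add, map_mul, map_one, map_pow, compX_C, compX_X] at eW
  set Y := compX M (jac (fun _ => b) (fun _ => c))
  set W := compX M (jac (constTail b' b) (constTail c' c)) with hW
  set V := N * (1 - C β₀ * X - C γ₀ * X ^ 2 * M₁) with hV
  have hMV : M * V = N := by rw [hV]; linear_combination N * eM
  have eV : V = 1 + C b' * X * N + C c' * X ^ 2 * N * M₁ := by rw [hV]; linear_combination eN
  have hu : IsUnit (1 - X * (C b' * M + C c' * X * M * M₁)) :=
    isUnit_of_constantCoeff_eq_one (by simp)
  have hWV : W = V := by
    rw [← sub_eq_zero]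
    apply hu.mul_left_cancel
    rw [← hMV] at eV
    linear_combination eW - eV + C c' * X ^ 2 * M * W * hY
  rw [hWV, mul_comm, hMV]

end Meixner

/-! ### Free Meixner pairs of measures -/

section MeasureMeixner

open PowerSeries

lemma tail₁_eq_constTail (a b : ℝ) : tail₁ a b = constTail a b := by
  funext n; cases n <;> rfl

lemma tail₁_eq_tail₂ (a b : ℝ) : tail₁ a b = tail₂ a b b := by
  funext n; rcases n with _ | _ | n <;> rfl

lemma jac_tail₂_eq (a₀ a₁ a₂ g₀ g₁ g₂ : ℝ) :
    jac (tail₂ a₀ a₁ a₂) (tail₂ g₀ g₁ g₂) = 1 + C a₀ * X * jac (tail₂ a₀ a₁ a₂) (tail₂ g₀ g₁ g₂) +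
      C g₀ * X ^ 2 * jac (tail₂ a₀ a₁ a₂) (tail₂ g₀ g₁ g₂) *
        jac (constTail a₁ a₂) (constTail g₁ g₂) := by
  have h : ∀ a₀ a₁ a₂ : ℝ, (fun k => tail₂ a₀ a₁ a₂ (k + 1)) = constTail a₁ a₂ := by
    intro a₀ a₁ a₂
    funext n; cases n <;> rfl
  have := jac_eq (tail₂ a₀ a₁ a₂) (tail₂ g₀ g₁ g₂)
  rwa [h, h] at this

lemma isCFreeMoment_meixner (β₀' γ₀' β₀ γ₀ b' c' b c : ℝ) :
    IsCFreeMoment (C β₀' + C γ₀' * X * jac (constTail b' b) (constTail c' c))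
      (jac (constTail β₀ (b + β₀)) (constTail γ₀ (c + γ₀)))
      (jac (tail₂ β₀' (b' + β₀) (b + β₀)) (tail₂ γ₀' (c' + γ₀) (c + γ₀))) := by
  have h := compX_constTail_mul β₀ γ₀ b c b' c'
  have e := jac_tail₂_eq β₀' (b' + β₀) (b + β₀) γ₀' (c' + γ₀) (c + γ₀)
  rw [← h] at e
  rw [IsCFreeMoment]
  simp only [map_add, map_mul, compX_C, compX_X]
  linear_combination e

lemma freeCumulantSeries_eq_iff (ν : Measure ℝ) [IsProbabilityMeasure ν] (β₀ γ₀ b c : ℝ) :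
    freeCumulantSeries ν = C β₀ + C γ₀ * X * jac (fun _ => b) (fun _ => c) ↔
      momentSeries ν = jac (tail₁ β₀ (b + β₀)) (tail₁ γ₀ (c + γ₀)) := by
  rw [tail₁_eq_constTail, tail₁_eq_constTail]
  have h := isFreeMoment_momentSeries ν
  have h' := isFreeMoment_meixner β₀ γ₀ b c
  constructor
  · intro e
    rw [e] at h
    exact h.moment_unique h'
  · intro e
    rw [e] at h
    exact h.cumulant_unique h'

lemma cfreeCumulantSeries_eq_iff (ν' ν : Measure ℝ) [IsProbabilityMeasure ν']
    [IsProbabilityMeasure ν] (β₀' γ₀' β₀ γ₀ b' c' b c : ℝ)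
    (hν : momentSeries ν = jac (tail₁ β₀ (b + β₀)) (tail₁ γ₀ (c + γ₀))) :
    cfreeCumulantSeries ν' ν = C β₀' + C γ₀' * X * jac (tail₁ b' b) (tail₁ c' c) ↔
      momentSeries ν' = jac (tail₂ β₀' (b' + β₀) (b + β₀)) (tail₂ γ₀' (c' + γ₀) (c + γ₀)) := by
  rw [tail₁_eq_constTail, tail₁_eq_constTail] at hν ⊢
  have h := isCFreeMoment_momentSeries ν' ν
  have h' := isCFreeMoment_meixner β₀' γ₀' β₀ γ₀ b' c' b c
  rw [hν] at h
  constructor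
  · intro e
    rw [e] at h
    exact eq_of_eq_one_add_X_mul h h'
  · intro e
    rw [e] at h
    exact h.cumulant_unique (constantCoeff_jac _ _) h'

lemma freeCumulantSeries_smul_iff {ν μ : Measure ℝ} {t : ℝ} :
    (∀ n : ℕ, 1 ≤ n → freeCumulant ν n = t * freeCumulant μ n) ↔
      freeCumulantSeries ν = C t * freeCumulantSeries μ := by
  constructor
  · intro h
    ext n
    simpa [freeCumulantSeries] using h (n + 1) (by omega)
  · intro h n hn
    obtain ⟨n, rfl⟩ : ∃ k, n = k + 1 := ⟨n - 1, by omega⟩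
    simpa [freeCumulantSeries] using congrArg (coeff n) h

lemma cfreeCumulantSeries_smul_iff {ν' ν μ' μ : Measure ℝ} {t : ℝ} :
    (∀ n : ℕ, 1 ≤ n → cfreeCumulant ν' ν n = t * cfreeCumulant μ' μ n) ↔
      cfreeCumulantSeries ν' ν = C t * cfreeCumulantSeries μ' μ := by
  constructor
  · intro h
    ext n
    simpa [cfreeCumulantSeries] using h (n + 1) (by omega)
  · intro h n hn
    obtain ⟨n, rfl⟩ : ∃ k, n = k + 1 := ⟨n - 1, by omega⟩
    simpa [cfreeCumulantSeries] using congrArg (coeff n) h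

lemma exists_measure_tail₂ {a₀ a₁ a₂ g₀ g₁ g₂ : ℝ} (h₀ : 0 ≤ g₀) (h₁ : 0 ≤ g₁) (h₂ : 0 ≤ g₂) :
    ∃ (μ : Measure ℝ) (K : ℝ), IsProbabilityMeasure μ ∧ HasAllMoments μ ∧ 0 ≤ K ∧
      (∀ᵐ x ∂μ, |x| ≤ K) ∧ momentSeries μ = jac (tail₂ a₀ a₁ a₂) (tail₂ g₀ g₁ g₂) := by
  have hn : ∀ n, 0 ≤ tail₂ g₀ g₁ g₂ n := by
    rintro (_ | _ | n) <;> assumption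
  have p := abs_nonneg a₀
  have p₁ := abs_nonneg a₁
  have p₂ := abs_nonneg a₂
  have q := Real.sqrt_nonneg g₀
  have q₁ := Real.sqrt_nonneg g₁
  have q₂ := Real.sqrt_nonneg g₂
  obtain ⟨μ, hp, hb, hm⟩ := exists_measure_of_bounded (β := tail₂ a₀ a₁ a₂)
    (γ := tail₂ g₀ g₁ g₂) (K := |a₀| + |a₁| + |a₂| + √g₀ + √g₁ + √g₂) hn
    (by rintro (_ | _ | n) <;> simp only [tail₂] <;> linarith)
    (by rintro (_ | _ | n) <;> simp only [tail₂] <;> linarith)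
  exact ⟨μ, _, hp, hasAllMoments_of_bounded hb, by positivity, hb, hm⟩

/-- Parameters after a vanishing γ do not enter the continued fraction (`jac_congr`), so relations
between the genuine ones suffice. -/
lemma momentSeries_of_relations {μ' μ : Measure ℝ} [IsProbabilityMeasure μ']
    [IsProbabilityMeasure μ] (hμ' : HasAllMoments μ') (hμ : HasAllMoments μ)
    {β' γ' β γ : ℕ → ℝ} (hJ' : HasJacobiParameters μ' β' γ') (hJ : HasJacobiParameters μ β γ)
    (hrel : JacobiRelations β' γ' β γ) :
    momentSeries μ' = jac (tail₂ (β' 0) (β' 1) (β 1)) (tail₂ (γ' 0) (γ' 1) (γ 1)) ∧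
    momentSeries μ = jac (tail₁ (β 0) (β 1)) (tail₁ (γ 0) (γ 1)) := by
  constructor
  · rw [hJ'.momentSeries hμ']
    refine jac_congr ?_
    rintro (_ | _ | n) hn
    · exact ⟨rfl, rfl⟩
    · exact ⟨rfl, rfl⟩
    · exact (hrel (n + 1) (by omega)).2 hn
  · rw [hJ.momentSeries hμ]
    refine jac_congr ?_
    rintro (_ | n) hn
    · exact ⟨rfl, rfl⟩
    · exact (hrel (n + 1) (by omega)).1 hn

lemma hasJacobiParameters_of_relations {μ' μ : Measure ℝ} [IsProbabilityMeasure μ']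
    [IsProbabilityMeasure μ] (hμ' : HasAllMoments μ') (hμ : HasAllMoments μ)
    {β' γ' β γ : ℕ → ℝ} (hJ' : HasJacobiParameters μ' β' γ') (hJ : HasJacobiParameters μ β γ)
    (hrel : JacobiRelations β' γ' β γ) :
    HasJacobiParameters μ' (tail₂ (β' 0) (β' 1) (β 1)) (tail₂ (γ' 0) (γ' 1) (γ 1)) ∧
    HasJacobiParameters μ (tail₁ (β 0) (β 1)) (tail₁ (γ 0) (γ 1)) ∧ IsFreeMeixner μ := by
  obtain ⟨h', h⟩ := momentSeries_of_relations hμ' hμ hJ' hJ hrel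
  have hm : HasJacobiParameters μ (tail₁ (β 0) (β 1)) (tail₁ (γ 0) (γ 1)) :=
    hasJacobiParameters_of_momentSeries hμ
      (by rintro (_ | n) <;> exact hJ.nonneg _) h
  refine ⟨hasJacobiParameters_of_momentSeries hμ'
    (by rintro (_ | _ | n) <;> first | exact hJ'.nonneg _ | exact hJ.nonneg _) h', hm,
    β 0, γ 0, β 1 - β 0, γ 1 - γ 0, hJ.nonneg 0, ?_, ?_⟩
  · rw [sub_add_cancel]; exact hJ.nonneg 1
  · rwa [sub_add_cancel, sub_add_cancel]

end MeasureMeixner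

/-! ### Powers, infinite divisibility and the integral representation -/

section Powers

open PowerSeries

/-- Data of a pair in the two-state free Meixner class, in terms of cumulants. -/
structure IsMeixnerPair (μ' μ : Measure ℝ) (β₀' γ₀' β₀ γ₀ b' c' b c : ℝ) : Prop where
  free : freeCumulantSeries μ = C β₀ + C γ₀ * X * jac (fun _ => b) (fun _ => c)
  cfree : cfreeCumulantSeries μ' μ = C β₀' + C γ₀' * X * jac (tail₁ b' b) (tail₁ c' c)

variable {μ' μ ν' ν : Measure ℝ} {β₀' γ₀' β₀ γ₀ b' c' b c t : ℝ}

lemma isMeixnerPair_iff [IsProbabilityMeasure μ'] [IsProbabilityMeasure μ] :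
    IsMeixnerPair μ' μ β₀' γ₀' β₀ γ₀ b' c' b c ↔
      momentSeries μ = jac (tail₁ β₀ (b + β₀)) (tail₁ γ₀ (c + γ₀)) ∧
      momentSeries μ' =
        jac (tail₂ β₀' (b' + β₀) (b + β₀)) (tail₂ γ₀' (c' + γ₀) (c + γ₀)) := by
  constructor
  · rintro ⟨h, h'⟩
    rw [freeCumulantSeries_eq_iff] at h
    exact ⟨h, (cfreeCumulantSeries_eq_iff μ' μ β₀' γ₀' β₀ γ₀ b' c' b c h).1 h'⟩
  · rintro ⟨h, h'⟩
    exact ⟨(freeCumulantSeries_eq_iff μ β₀ γ₀ b c).2 h,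
      (cfreeCumulantSeries_eq_iff μ' μ β₀' γ₀' β₀ γ₀ b' c' b c h).2 h'⟩

/-- In the cumulant series the first parameters are linear factors while `b'`, `c'`, `b`, `c` sit
inside the continued fractions; multiplication by `t` affects only the former. -/
lemma IsMeixnerPair.power (h : IsMeixnerPair μ' μ β₀' γ₀' β₀ γ₀ b' c' b c)
    (hp : IsCFreePower t μ' μ ν' ν) :
    IsMeixnerPair ν' ν (β₀' * t) (γ₀' * t) (β₀ * t) (γ₀ * t) b' c' b c := by
  have h1 := freeCumulantSeries_smul_iff.1 hp.freeCumulant_eq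
  have h2 := cfreeCumulantSeries_smul_iff.1 hp.cfreeCumulant_eq
  refine ⟨?_, ?_⟩
  · rw [h1, h.free]; simp only [map_mul]; ring
  · rw [h2, h.cfree]; simp only [map_mul]; ring

lemma IsCFreePower.inv {t : ℝ} (ht : t ≠ 0) [IsProbabilityMeasure μ'] [IsProbabilityMeasure μ]
    (hμ' : HasAllMoments μ') (hμ : HasAllMoments μ) (hp : IsCFreePower t μ' μ ν' ν) :
    IsCFreePower t⁻¹ ν' ν μ' μ where
  isProbabilityMeasure' := inferInstance
  isProbabilityMeasure := inferInstance
  hasAllMoments' := hμ'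
  hasAllMoments := hμ
  freeCumulant_eq n hn := by rw [hp.freeCumulant_eq n hn, inv_mul_cancel_left₀ ht]
  cfreeCumulant_eq n hn := by rw [hp.cfreeCumulant_eq n hn, inv_mul_cancel_left₀ ht]

lemma IsMeixnerPair.exists_power (h : IsMeixnerPair μ' μ β₀' γ₀' β₀ γ₀ b' c' b c)
    (h₀' : 0 ≤ γ₀') (h₀ : 0 ≤ γ₀) (ht : 0 ≤ t) (hc : 0 ≤ c + γ₀ * t) (hc' : 0 ≤ c' + γ₀ * t) :
    ∃ ν' ν : Measure ℝ, IsCFreePower t μ' μ ν' ν := by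
  obtain ⟨ν, -, hν, hmν, -, -, eν⟩ := exists_measure_tail₂ (a₀ := β₀ * t) (a₁ := b + β₀ * t)
    (a₂ := b + β₀ * t) (mul_nonneg h₀ ht) hc hc
  obtain ⟨ν', -, hν', hmν', -, -, eν'⟩ := exists_measure_tail₂ (a₀ := β₀' * t)
    (a₁ := b' + β₀ * t) (a₂ := b + β₀ * t) (mul_nonneg h₀' ht) hc' hc
  rw [← tail₁_eq_tail₂, ← tail₁_eq_tail₂] at eν
  have h' := isMeixnerPair_iff.2 ⟨eν, eν'⟩
  refine ⟨ν', ν, hν', hν, hmν', hmν, freeCumulantSeries_smul_iff.2 ?_,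
    cfreeCumulantSeries_smul_iff.2 ?_⟩
  · rw [h.free, h'.free]; simp only [map_mul]; ring
  · rw [h.cfree, h'.cfree]; simp only [map_mul]; ring

lemma IsMeixnerPair.hasJacobiParameters_power
    (h : IsMeixnerPair μ' μ β₀' γ₀' β₀ γ₀ b' c' b c)
    (h₀' : 0 ≤ γ₀') (h₀ : 0 ≤ γ₀) (ht : 0 ≤ t) (hc : 0 ≤ c + γ₀ * t) (hc' : 0 ≤ c' + γ₀ * t)
    (hp : IsCFreePower t μ' μ ν' ν) :
    HasJacobiParameters ν' (tail₂ (β₀' * t) (b' + β₀ * t) (b + β₀ * t))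
      (tail₂ (γ₀' * t) (c' + γ₀ * t) (c + γ₀ * t)) ∧
    HasJacobiParameters ν (tail₁ (β₀ * t) (b + β₀ * t)) (tail₁ (γ₀ * t) (c + γ₀ * t)) := by
  have := hp.isProbabilityMeasure
  have := hp.isProbabilityMeasure'
  obtain ⟨e, e'⟩ := isMeixnerPair_iff.1 (h.power hp)
  constructor
  · refine hasJacobiParameters_of_momentSeries hp.hasAllMoments' ?_ e'
    rintro (_ | _ | n)
    exacts [mul_nonneg h₀' ht, hc', hc]
  · refine hasJacobiParameters_of_momentSeries hp.hasAllMoments ?_ e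
    rintro (_ | n)
    exacts [mul_nonneg h₀ ht, hc]

lemma IsMeixnerPair.infinitelyDivisible (h : IsMeixnerPair μ' μ β₀' γ₀' β₀ γ₀ b' c' b c)
    [IsProbabilityMeasure μ'] [IsProbabilityMeasure μ]
    (hμ' : HasAllMoments μ') (hμ : HasAllMoments μ)
    (h₀' : 0 ≤ γ₀') (h₀ : 0 ≤ γ₀) (hc : 0 ≤ c) (hc' : 0 ≤ c') :
    IsCFreeInfinitelyDivisible μ' μ := by
  intro n hn
  have hn0 : (n : ℝ) ≠ 0 := by positivity
  obtain ⟨ν', ν, hp⟩ := h.exists_power (t := (n : ℝ)⁻¹) h₀' h₀ (by positivity) (by positivity)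
    (by positivity)
  refine ⟨ν', ν, hp.isProbabilityMeasure', hp.isProbabilityMeasure, hp.hasAllMoments',
    hp.hasAllMoments, ?_⟩
  have := hp.inv (inv_ne_zero hn0) hμ' hμ
  rwa [inv_inv] at this

lemma nonneg_of_forall_nonneg_add_div {c g : ℝ} (h : ∀ n : ℕ, 1 ≤ n → 0 ≤ c + g * (n : ℝ)⁻¹) :
    0 ≤ c := by
  have h1 : Filter.Tendsto (fun n : ℕ => c + g * (n : ℝ)⁻¹) Filter.atTop (nhds (c + g * 0)) :=
    (tendsto_inv_atTop_nhds_zero_nat.const_mul g).const_add c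
  rw [mul_zero, add_zero] at h1
  exact ge_of_tendsto h1 (Filter.eventually_atTop.2 ⟨1, h⟩)

/-- For each n-th root the square norm of P₂ equals γ₁γ₀, which is (c + γ₀/n)(γ₀/n) for the second
measure and (c' + γ₀/n)(γ₀'/n) for the first. A positive second factor can be cancelled before n
tends to infinity. -/
lemma IsMeixnerPair.nonneg_of_infinitelyDivisible
    (h : IsMeixnerPair μ' μ β₀' γ₀' β₀ γ₀ b' c' b c)
    (hid : IsCFreeInfinitelyDivisible μ' μ) :
    (0 < γ₀ → 0 ≤ c) ∧ (0 < γ₀' → 0 ≤ c') := by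
  have key : ∀ n : ℕ, 1 ≤ n → 0 ≤ (c + γ₀ * (n : ℝ)⁻¹) * (γ₀ * (n : ℝ)⁻¹) ∧
      0 ≤ (c' + γ₀ * (n : ℝ)⁻¹) * (γ₀' * (n : ℝ)⁻¹) := by
    intro n hn
    have hn0 : (n : ℝ) ≠ 0 := by positivity
    obtain ⟨ν', ν, i', i, m', m, hp⟩ := hid n hn
    obtain ⟨e, e'⟩ := isMeixnerPair_iff.1 (h.power (hp.inv hn0 m' m))
    exact ⟨mul_nonneg_of_momentSeries m e, mul_nonneg_of_momentSeries m' e'⟩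
  constructor
  · intro h0
    refine nonneg_of_forall_nonneg_add_div (g := γ₀) fun n hn => ?_
    exact nonneg_of_mul_nonneg_left (key n hn).1 (by positivity)
  · intro h0
    refine nonneg_of_forall_nonneg_add_div (g := γ₀) fun n hn => ?_
    exact nonneg_of_mul_nonneg_left (key n hn).2 (by positivity)

/-- For a measure supported in [-K, K] the geometric series may be integrated term by term when K‖z‖
< 1; the bound (K + 1)⁻¹ ensures this also when K = 0. -/
lemma hasSum_integral_geometric {ρ : Measure ℝ} [IsProbabilityMeasure ρ] {K : ℝ} (hK : 0 ≤ K)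
    (hb : ∀ᵐ x ∂ρ, |x| ≤ K) {z : ℂ} (hz : ‖z‖ < (K + 1)⁻¹) :
    Integrable (fun x : ℝ => 1 / (1 - (x : ℂ) * z)) ρ ∧
      HasSum (fun k : ℕ => (rawMoment ρ k : ℂ) * z ^ k) (∫ x : ℝ, 1 / (1 - (x : ℂ) * z) ∂ρ) := by
  set q := K * ‖z‖ with hq
  have hq0 : 0 ≤ q := by positivity
  have hq1 : q < 1 := by
    have h1 : q ≤ K * (K + 1)⁻¹ := mul_le_mul_of_nonneg_left hz.le hK
    have h2 : K * (K + 1)⁻¹ < 1 := by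
      rw [← div_eq_mul_inv, div_lt_one (by positivity)]; linarith
    linarith
  have hxz : ∀ᵐ x : ℝ ∂ρ, ‖(x : ℂ) * z‖ ≤ q := by
    filter_upwards [hb] with x hx
    rw [norm_mul, Complex.norm_real, Real.norm_eq_abs]
    exact mul_le_mul_of_nonneg_right hx (norm_nonneg z)
  constructor
  · refine Integrable.of_bound (Measurable.aestronglyMeasurable (by fun_prop)) (1 - q)⁻¹ ?_
    filter_upwards [hxz] with x hx
    rw [norm_div, norm_one, one_div]
    refine inv_anti₀ (by linarith) ?_
    have := norm_sub_norm_le (1 : ℂ) ((x : ℂ) * z)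
    rw [norm_one] at this
    linarith
  · have h := hasSum_integral_of_dominated_convergence (μ := ρ)
      (F := fun (k : ℕ) (x : ℝ) => ((x : ℂ) * z) ^ k) (f := fun x : ℝ => 1 / (1 - (x : ℂ) * z))
      (fun k _ => q ^ k) (fun k => by fun_prop)
      (fun k => by
        filter_upwards [hxz] with x hx
        rw [norm_pow]
        exact pow_le_pow_left₀ (norm_nonneg _) hx k)
      (Filter.Eventually.of_forall fun x => summable_geometric_of_lt_one hq0 hq1)
      (integrable_const _)
      (by
        filter_upwards [hxz] with x hx
        rw [one_div]
        exact hasSum_geometric_of_norm_lt_one (hx.trans_lt hq1))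
    have e : (fun k : ℕ => (rawMoment ρ k : ℂ) * z ^ k) =
        fun k : ℕ => ∫ x : ℝ, ((x : ℂ) * z) ^ k ∂ρ := by
      funext k
      simp only [mul_pow]
      rw [integral_mul_const, rawMoment, ← integral_complex_ofReal]
      simp
    rw [e]
    exact h

lemma IsMeixnerPair.exists_representing_measure
    (h : IsMeixnerPair μ' μ β₀' γ₀' β₀ γ₀ b' c' b c) (hc : 0 ≤ c) (hc' : 0 ≤ c') :
    ∃ ρ : Measure ℝ, IsProbabilityMeasure ρ ∧ HasAllMoments ρ ∧ IsFreeMeixner ρ ∧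
      HasJacobiParameters ρ (tail₁ b' b) (tail₁ c' c) ∧
      ∃ ε : ℝ, 0 < ε ∧ ∀ z : ℂ, ‖z‖ < ε →
        Integrable (fun x : ℝ => 1 / (1 - (x : ℂ) * z)) ρ ∧
        HasSum (fun k : ℕ => (cfreeCumulant μ' μ (k + 1) : ℂ) * z ^ (k + 1))
          ((β₀' : ℂ) * z + (γ₀' : ℂ) * z ^ 2 * ∫ x : ℝ, 1 / (1 - (x : ℂ) * z) ∂ρ) := by
  obtain ⟨ρ, K, hρ, hm, hK, hb, e⟩ := exists_measure_tail₂ (a₀ := b') (a₁ := b) (a₂ := b) hc' hc hc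
  rw [← tail₁_eq_tail₂, ← tail₁_eq_tail₂] at e
  have hJ : HasJacobiParameters ρ (tail₁ b' b) (tail₁ c' c) :=
    hasJacobiParameters_of_momentSeries hm (by rintro (_ | n); exacts [hc', hc]) e
  refine ⟨ρ, hρ, hm, ⟨b', c', b - b', c - c', hc', by rwa [sub_add_cancel], by
    rwa [sub_add_cancel, sub_add_cancel]⟩, hJ, (K + 1)⁻¹, by positivity, fun z hz => ?_⟩
  obtain ⟨hi, hs⟩ := hasSum_integral_geometric hK hb hz
  refine ⟨hi, ?_⟩
  have hcf := h.cfree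
  rw [← e] at hcf
  have c0 : cfreeCumulant μ' μ 1 = β₀' := by
    simpa [cfreeCumulantSeries] using congrArg PowerSeries.constantCoeff hcf
  have c1 : ∀ k, cfreeCumulant μ' μ (k + 2) = γ₀' * rawMoment ρ k := by
    intro k
    have := congrArg (coeff (k + 1)) hcf
    rw [mul_assoc, map_add, coeff_C_mul, coeff_succ_X_mul] at this
    simpa [cfreeCumulantSeries, momentSeries, coeff_C] using this
  -- The first cumulant is the linear term; from the second on, the cumulants are `γ₀'` times the
  -- moments of `ρ`.
  rw [← hasSum_nat_add_iff' 1]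
  simp only [Finset.range_one, Finset.sum_singleton, zero_add, pow_one, c0, add_sub_cancel_left]
  have e2 : (fun k : ℕ => (cfreeCumulant μ' μ (k + 1 + 1) : ℂ) * z ^ (k + 1 + 1)) =
      fun k : ℕ => (γ₀' : ℂ) * z ^ 2 * ((rawMoment ρ k : ℂ) * z ^ k) := by
    funext k
    rw [c1 k, Complex.ofReal_mul]
    ring
  rw [e2]
  exact hs.mul_left _

end Powers

/-! ### Composition and rescaling of series -/

section Transformations

open PowerSeries Finset

variable {A : Type*} [CommRing A]

lemma compX_compX (D M f : A⟦X⟧) : compX D (compX M f) = compX (D * compX D M) f := by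
  rw [compX_apply M, compX_apply D, compX_apply (D * _),
    subst_comp_subst_apply (hasSubst_X_mul M) (hasSubst_X_mul D), ← compX_apply D, map_mul,
    compX_X, mul_assoc]

lemma compX_C_mul (a : A) (F f : A⟦X⟧) : compX (C a * F) f = compX F (rescale a f) := by
  ext n
  rw [coeff_compX, coeff_compX]
  refine sum_congr rfl fun k _ => ?_
  rw [mul_pow, ← map_pow, coeff_C_mul, coeff_rescale]
  ring

lemma rescale_jac (a : A) (β γ : ℕ → A) :
    rescale a (jac β γ) = jac (fun n => a * β n) (fun n => a ^ 2 * γ n) := by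
  have h : IsJacChain (fun n => a * β n) (fun n => a ^ 2 * γ n) fun n =>
      rescale a (jac (fun k => β (k + n)) (fun k => γ (k + n))) := by
    intro n
    have hC : ∀ r : A, rescale a (C r) = C r := by
      intro r
      ext k
      rw [coeff_rescale, coeff_C]
      split_ifs with hk
      · simp [hk]
      · simp
    have := congrArg (rescale a) (isJacChain_jac β γ n)
    simp only [map_add, map_mul, map_one, map_pow, rescale_X, hC] at this
    simp only [map_mul, map_pow]
    linear_combination this
  exact h.eq_jac

lemma coeff_mul_of_X_pow_dvd {f : A⟦X⟧} {m : ℕ} (h : X ^ m ∣ f) (g : A⟦X⟧) :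
    coeff m (f * g) = coeff m f * constantCoeff g := by
  obtain ⟨k, rfl⟩ := h
  rw [mul_assoc, coeff_X_pow_mul', coeff_X_pow_mul']
  simp

/-- To leading order the map (ρ, M) ↦ ρ(XM) M is additive, both constant terms being 1. -/
lemma coeff_compX_mul_sub {M M' ρ ρ' : A⟦X⟧} {m : ℕ} (hM : X ^ m ∣ M - M') (hρ : X ^ m ∣ ρ - ρ')
    (h1 : constantCoeff M = 1) (h1' : constantCoeff M' = 1) (hρ1 : constantCoeff ρ' = 1) :
    coeff m (compX M ρ * M) - coeff m (compX M' ρ' * M') =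
      (coeff m ρ - coeff m ρ') + (coeff m M - coeff m M') := by
  have hc := X_pow_dvd_compX_sub hM hρ h1 h1'
  have h0 : constantCoeff (compX M' ρ') = 1 := by
    rw [← coeff_zero_eq_constantCoeff_apply, coeff_compX]
    simp [hρ1]
  have e : compX M ρ * M - compX M' ρ' * M' =
      (compX M ρ - compX M' ρ') * M + (M - M') * compX M' ρ' := by ring
  rw [← map_sub, e, map_add, coeff_mul_of_X_pow_dvd hc, coeff_mul_of_X_pow_dvd hM, h1, h0,
    map_sub, map_sub, coeff_compX_sub hM hρ h1 h1' le_rfl]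
  ring

end Transformations

/-! ### Centering and dilation -/

section Affine

open PowerSeries

variable {β₀ ε t : ℝ} {κ ρ M : ℝ⟦X⟧}

/-- Centering by `t β₀` and rescaling by `ε`, where `t ε² = 1`. -/
lemma centered_rescaled (hε : t * ε ^ 2 = 1) (hM : IsFreeMoment (C t * (C β₀ + X * κ)) M)
    {B G : ℕ → ℝ} (hN : compX M ρ * M = jac B G) {M₀ : ℝ⟦X⟧}
    (hM₀ : IsFreeMoment (X * rescale ε κ) M₀) :
    compX M₀ (rescale ε ρ) * M₀ =
      jac (fun n => ε * (B n - t * β₀)) (fun n => ε ^ 2 * G n) := by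
  -- For the image of a measure under x ↦ ε(x - tβ₀), the moment series F(X) becomes E F(εEX) with E
  -- = 1 / (1 + tβ₀εX). Below, `D = εE` and `M₁` is the transform of `M`.
  obtain ⟨E, hE⟩ : ∃ E : ℝ⟦X⟧, (1 + C (t * β₀ * ε) * X) * E = 1 :=
    (isUnit_of_constantCoeff_eq_one (by simp)).exists_right_inv
  obtain ⟨L, hL⟩ : ∃ L : ℝ⟦X⟧, L = 1 + C (t * β₀ * ε) * X := ⟨_, rfl⟩
  obtain ⟨D, hD⟩ : ∃ D : ℝ⟦X⟧, D = C ε * E := ⟨_, rfl⟩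
  rw [← hL] at hE
  have hcC : C t * C ε * C ε = (1 : ℝ⟦X⟧) := by
    rw [← map_mul, ← map_mul, mul_assoc, ← sq, hε, map_one]
  obtain ⟨M₁, hM₁⟩ : ∃ F : ℝ⟦X⟧, F = E * compX D M := ⟨_, rfl⟩
  have hDm : D * compX D M = C ε * M₁ := by
    rw [hM₁]; linear_combination compX D M * hD
  have hLM : compX D M = L * M₁ := by rw [hM₁]; linear_combination (- compX D M) * hE
  have hfree : IsFreeMoment (X * rescale ε κ) M₁ := by
    have h := congrArg (compX D) hM
    simp only [map_add, map_mul, map_one, compX_X, compX_C, compX_compX, hDm, compX_C_mul] at h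
    rw [hLM] at h
    rw [IsFreeMoment, map_mul, compX_X]
    have e : D * L = C ε := by rw [hD]; linear_combination C ε * hE
    set Y := compX M₁ (rescale ε κ)
    have h2 : L * M₁ = 1 + X * (C t * (C β₀ + (D * L) * M₁ * X * Y)) * (D * L) * M₁ := by
      linear_combination h
    rw [e, hL] at h2
    simp only [map_mul] at h2
    linear_combination h2 + X * M₁ * M₁ * X * Y * hcC
  have hMM := hM₀.moment_unique hfree
  have hN' : compX M₀ (rescale ε ρ) * M₀ = E * compX D (jac B G) := by
    rw [← hN, map_mul, compX_compX, hDm, compX_C_mul, hMM]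
    nth_rewrite 2 [hM₁]
    ring
  rw [hN']
  -- The same transformation acts on all tails of the continued fraction at once, so each parameter
  -- is centered and dilated.
  have hch : IsJacChain (fun n => ε * (B n - t * β₀)) (fun n => ε ^ 2 * G n) fun n =>
      E * compX D (jac (fun k => B (k + n)) (fun k => G (k + n))) := by
    intro n
    have h := congrArg (compX D) (isJacChain_jac B G n)
    simp only [map_add, map_mul, map_one, map_pow, compX_X, compX_C] at h
    set K := compX D (jac (fun k => B (k + n)) (fun k => G (k + n)))
    set K' := compX D (jac (fun k => B (k + (n + 1))) (fun k => G (k + (n + 1))))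
    rw [hD] at h
    rw [hL] at hE
    simp only [map_mul, map_sub, map_pow] at hE ⊢
    linear_combination h + K * hE
  exact hch.eq_jac

end Affine

/-! ### Series with a formal scaling parameter ε -/

section Homogenization

open PowerSeries

/-- The power series `f (ε z)`, where `ε` is a polynomial variable. -/
def homog (f : ℝ⟦X⟧) : (Polynomial ℝ)⟦X⟧ := rescale Polynomial.X (f.map Polynomial.C)

lemma coeff_homog (f : ℝ⟦X⟧) (n : ℕ) :
    coeff n (homog f) = Polynomial.X ^ n * Polynomial.C (coeff n f) := by
  rw [homog, coeff_rescale, coeff_map]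

lemma constantCoeff_homog (f : ℝ⟦X⟧) :
    constantCoeff (homog f) = Polynomial.C (constantCoeff f) := by
  rw [← coeff_zero_eq_constantCoeff_apply, coeff_homog, pow_zero, one_mul,
    coeff_zero_eq_constantCoeff_apply]

lemma map_homog (f : ℝ⟦X⟧) (ε : ℝ) :
    (homog f).map (Polynomial.evalRingHom ε) = rescale ε f := by
  ext n
  rw [coeff_map, coeff_homog, coeff_rescale]
  simp only [Polynomial.coe_evalRingHom, Polynomial.eval_mul, Polynomial.eval_pow,
    Polynomial.eval_X, Polynomial.eval_C]

lemma homog_jac (β γ : ℕ → ℝ) :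
    homog (jac β γ) = jac (fun n => Polynomial.X * Polynomial.C (β n))
      (fun n => Polynomial.X ^ 2 * Polynomial.C (γ n)) := by
  rw [homog, map_jac, rescale_jac]

/-- The n-th coefficient carries the factor ε^n, so modulo ε³ only the first three survive. -/
lemma map_homog_congr {S : Type*} [CommRing S] (φ : Polynomial ℝ →+* S)
    (hφ : φ (Polynomial.X ^ 3) = 0) {f g : ℝ⟦X⟧} (h : ∀ n < 3, coeff n f = coeff n g) :
    (homog f).map φ = (homog g).map φ := by
  ext n
  rw [coeff_map, coeff_map, coeff_homog, coeff_homog]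
  by_cases hn : n < 3
  · rw [h n hn]
  · obtain ⟨k, rfl⟩ := Nat.exists_eq_add_of_le (not_lt.1 hn)
    rw [pow_add, map_mul, map_mul, map_mul, map_mul, hφ]
    simp

/-- A pair of cumulant series is determined by the associated series. -/
lemma homog_pair_unique {κ κ' ρ ρ' : ℝ⟦X⟧} {M M' : (Polynomial ℝ)⟦X⟧}
    (hρ' : constantCoeff ρ' = 1)
    (hM : IsFreeMoment (X * homog κ) M) (hM' : IsFreeMoment (X * homog κ') M')
    (h : compX M (homog ρ) * M = compX M' (homog ρ') * M') : κ = κ' ∧ ρ = ρ' := by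
  have hr1 : constantCoeff (homog ρ') = 1 := by rw [constantCoeff_homog, hρ', map_one]
  have ext_step : ∀ {f g : (Polynomial ℝ)⟦X⟧} {n : ℕ}, X ^ n ∣ f - g → coeff n f = coeff n g →
      X ^ (n + 1) ∣ f - g := by
    intro f g n hd hc
    rw [X_pow_dvd_iff] at hd ⊢
    intro m hm
    rcases Nat.lt_succ_iff_lt_or_eq.1 hm with hm | rfl
    · exact hd m hm
    · rw [map_sub, hc, sub_self]
  have hcoeff : ∀ {m : ℕ}, X ^ m ∣ M - M' → X ^ m ∣ homog ρ - homog ρ' →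
      (coeff m (homog ρ) - coeff m (homog ρ')) + (coeff m M - coeff m M') = 0 := by
    intro m h1 h2
    rw [← coeff_compX_mul_sub h1 h2 hM.constantCoeff hM'.constantCoeff hr1, h, sub_self]
  have key : ∀ n, X ^ n ∣ X * homog κ - X * homog κ' ∧ X ^ n ∣ homog ρ - homog ρ' := by
    intro n
    induction n with
    | zero => simp
    | succ n ih =>
      have hMn := hM.X_pow_dvd_sub hM' ih.1
      have hMn' : X ^ n ∣ M - M' := (pow_dvd_pow X n.le_succ).trans hMn
      have hρn : X ^ (n + 1) ∣ homog ρ - homog ρ' := by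
        refine ext_step ih.2 ?_
        have := hcoeff hMn' ih.2
        rw [coeff_eq_of_X_pow_dvd_sub hMn n.lt_succ_self, sub_self, add_zero] at this
        exact sub_eq_zero.1 this
      refine ⟨ext_step ih.1 ?_, hρn⟩
      have h2 := hcoeff hMn hρn
      rw [hM.coeff_sub hM' ih.1] at h2
      cases n with
      | zero => simp
      | succ n =>
        rw [coeff_succ_X_mul, coeff_succ_X_mul] at h2 ⊢
        rw [coeff_homog, coeff_homog, coeff_homog, coeff_homog] at h2
        rw [coeff_homog, coeff_homog]
        -- The unknown coefficient of ρ comes with ε^(n+2) and that of κ with ε^n. The different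
        -- powers of ε separate the two unknowns in the single equation.
        have h3 := congrArg (Polynomial.coeff · n) h2
        simp only [Polynomial.coeff_add, Polynomial.coeff_sub, Polynomial.coeff_X_pow_mul',
          Polynomial.coeff_zero, le_refl, if_true, Nat.sub_self, Polynomial.coeff_C_zero] at h3
        rw [if_neg (by omega), if_neg (by omega), sub_self, zero_add] at h3
        rw [sub_eq_zero.1 h3]
  have hinj : ∀ {f g : ℝ⟦X⟧}, homog f = homog g → f = g := by
    intro f g hfg
    have := congrArg (PowerSeries.map (Polynomial.evalRingHom (1 : ℝ))) hfg
    rwa [map_homog, map_homog, rescale_one, RingHom.id_apply, RingHom.id_apply] at this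
  exact ⟨hinj (X_mul_cancel (eq_of_forall_X_pow_dvd_sub fun n => (key n).1)),
    hinj (eq_of_forall_X_pow_dvd_sub fun n => (key n).2)⟩

end Homogenization

/-! ### Polynomials of slow growth -/

section PolynomialGrowth

open Polynomial Filter Topology

lemma eq_C_of_tendsto_div_nat {Q : ℝ[X]}
    (h : Tendsto (fun t : ℕ => Q.eval (t : ℝ) / t) atTop (𝓝 0)) : ∃ a, Q = C a := by
  by_cases hd : Q.degree < (X : ℝ[X]).degree
  · rw [degree_X] at hd
    refine ⟨Q.coeff 0, eq_C_of_natDegree_eq_zero ?_⟩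
    by_cases hQ : Q = 0
    · simp [hQ]
    · have := (natDegree_lt_iff_degree_lt (n := 1) hQ).2 (by simpa using hd)
      omega
  · exfalso
    have hc := tendsto_natCast_atTop_atTop (R := ℝ)
    rcases (not_lt.1 hd).eq_or_lt with he | hlt
    · have h1 := (div_tendsto_atTop_leadingCoeff_div_of_degree_eq Q X he.symm).comp hc
      simp only [Function.comp_def, eval_X, leadingCoeff_X, div_one] at h1
      have h2 := tendsto_nhds_unique h1 h
      rw [leadingCoeff_eq_zero] at h2
      rw [h2, degree_X, degree_zero] at he
      exact absurd he (by simp)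
    · have h1 := (abs_div_tendsto_atTop_atTop_of_degree_gt Q X hlt X_ne_zero).comp hc
      simp only [Function.comp_def, eval_X] at h1
      exact not_tendsto_nhds_of_tendsto_atTop h1 _ h.abs

/-- Squaring replaces √t by t and reduces this to `eq_C_of_tendsto_div_nat`. -/
lemma eq_C_of_tendsto_div_sqrt_nat {Q : ℝ[X]}
    (h : Tendsto (fun t : ℕ => (√(t : ℝ))⁻¹ * Q.eval (t : ℝ)) atTop (𝓝 0)) : ∃ a, Q = C a := by
  obtain ⟨a, ha⟩ : ∃ a, Q ^ 2 = C a := by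
    refine eq_C_of_tendsto_div_nat ?_
    have := h.mul h
    rw [mul_zero] at this
    refine this.congr fun t => ?_
    have hs := Real.sq_sqrt (Nat.cast_nonneg (α := ℝ) t)
    rw [eval_pow, div_eq_inv_mul, ← hs, Real.sqrt_sq (Real.sqrt_nonneg _)]
    ring
  refine ⟨Q.coeff 0, eq_C_of_natDegree_eq_zero ?_⟩
  have := congrArg natDegree ha
  rw [natDegree_pow, natDegree_C] at this
  omega

end PolynomialGrowth

/-! ### Polynomial Jacobi parameters force the Meixner form -/

section PolynomialParameters

open PowerSeries Filter Topology

lemma homog_series_map {κ ρ : ℝ⟦X⟧} {M : (Polynomial ℝ)⟦X⟧}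
    (hM : IsFreeMoment (X * homog κ) M) (ε : ℝ) :
    IsFreeMoment (X * rescale ε κ) (M.map (Polynomial.evalRingHom ε)) ∧
    (compX M (homog ρ) * M).map (Polynomial.evalRingHom ε) =
      compX (M.map (Polynomial.evalRingHom ε)) (rescale ε ρ) *
        M.map (Polynomial.evalRingHom ε) := by
  constructor
  · have := hM.map (Polynomial.evalRingHom ε)
    rwa [map_mul, map_homog, PowerSeries.map_X] at this
  · rw [map_mul, map_compX, map_homog]

/-- At ε = 0 only the variance is left among the cumulants: this is the central limit theorem, and
the limit is the semicircle law of variance σ. -/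
lemma homog_series_map_zero {σ : ℝ} {κ ρ : ℝ⟦X⟧} (hκ : constantCoeff κ = σ)
    (hρ : constantCoeff ρ = 1) {M : (Polynomial ℝ)⟦X⟧} (hM : IsFreeMoment (X * homog κ) M) :
    (compX M (homog ρ) * M).map (Polynomial.evalRingHom 0) =
      jac (fun _ => 0) (fun _ => σ) := by
  obtain ⟨h1, h2⟩ := homog_series_map (ρ := ρ) hM 0
  rw [h2]
  set M₀ := M.map (Polynomial.evalRingHom 0)
  simp only [rescale_zero, RingHom.comp_apply, hκ, hρ] at h1 ⊢
  rw [map_one, map_one, one_mul]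
  rw [IsFreeMoment, map_mul, compX_X, compX_C] at h1
  have hch : IsJacChain (fun _ => 0) (fun _ => σ) fun _ => M₀ := by
    intro n
    rw [map_zero]
    linear_combination h1
  exact hch.eq_jac

variable {β₀ σ : ℝ} {κ ρ : ℝ⟦X⟧} {M : ℕ → ℝ⟦X⟧} {B G : ℕ → ℕ → ℝ}

lemma nat_mul_inv_sqrt_sq {t : ℕ} (ht : 1 ≤ t) : (t : ℝ) * ((√(t : ℝ))⁻¹) ^ 2 = 1 := by
  have h0 : (0 : ℝ) < t := by exact_mod_cast ht
  rw [inv_pow, Real.sq_sqrt h0.le, mul_inv_cancel₀ h0.ne']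

lemma homog_series_eval
    (hM : ∀ t : ℕ, 1 ≤ t → IsFreeMoment (C (t : ℝ) * (C β₀ + X * κ)) (M t))
    (hN : ∀ t : ℕ, 1 ≤ t → compX (M t) ρ * M t = jac (B t) (G t))
    {M₀ : (Polynomial ℝ)⟦X⟧} (hM₀ : IsFreeMoment (X * homog κ) M₀) {t : ℕ} (ht : 1 ≤ t) :
    (compX M₀ (homog ρ) * M₀).map (Polynomial.evalRingHom (√(t : ℝ))⁻¹) =
      jac (fun n => (√(t : ℝ))⁻¹ * (B t n - t * β₀)) (fun n => ((√(t : ℝ))⁻¹) ^ 2 * G t n) := by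
  obtain ⟨h1, h2⟩ := homog_series_map (ρ := ρ) hM₀ (√(t : ℝ))⁻¹
  rw [h2]
  exact centered_rescaled (nat_mul_inv_sqrt_sq ht) (hM t ht) (hN t ht) h1

lemma tendsto_inv_sqrt_nat : Tendsto (fun t : ℕ => (√(t : ℝ))⁻¹) atTop (𝓝 0) :=
  tendsto_inv_atTop_zero.comp (Real.tendsto_sqrt_atTop.comp tendsto_natCast_atTop_atTop)

/-- Polynomial parameters are affine functions of `t`. -/
lemma exists_affine_params (hσ : σ ≠ 0) (hκ : constantCoeff κ = σ) (hρ : constantCoeff ρ = 1)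
    (hM : ∀ t : ℕ, 1 ≤ t → IsFreeMoment (C (t : ℝ) * (C β₀ + X * κ)) (M t))
    (hN : ∀ t : ℕ, 1 ≤ t → compX (M t) ρ * M t = jac (B t) (G t))
    (hpoly : ∀ n, ∃ p q : Polynomial ℝ, ∀ t : ℕ, 1 ≤ t → (∀ k < n, G t k ≠ 0) →
      B t n = p.eval (t : ℝ) ∧ G t n = q.eval (t : ℝ)) (n : ℕ) :
    ∃ b c : ℝ, ∀ᶠ t : ℕ in atTop, B t n - t * β₀ = b ∧ G t n = σ * t + c := by
  obtain ⟨M₀, hM₀⟩ := exists_isFreeMoment (X * homog κ)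
  -- The coefficients are polynomials in ε, hence continuous at ε = 0.
  have hlim : ∀ k, Tendsto (fun t : ℕ => coeff k (jac (fun n => (√(t : ℝ))⁻¹ * (B t n - t * β₀))
      (fun n => ((√(t : ℝ))⁻¹) ^ 2 * G t n))) atTop
      (𝓝 (coeff k (jac (fun _ => 0) (fun _ => σ)))) := by
    intro k
    rw [← homog_series_map_zero hκ hρ hM₀, coeff_map, Polynomial.coe_evalRingHom]
    have h1 := ((coeff k (compX M₀ (homog ρ) * M₀)).continuous.tendsto 0).comp
      tendsto_inv_sqrt_nat
    refine h1.congr' ?_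
    filter_upwards [eventually_ge_atTop 1] with t ht
    rw [← homog_series_eval hM hN hM₀ ht, coeff_map]
    rfl
  have hpar := fun n => tendsto_jac_params n hlim fun _ => hσ
  -- As G_t / t tends to σ ≠ 0, finitely many parameters are all nonzero for large `t`, and the
  -- assumption on genuine parameters applies.
  have hgen : ∀ᶠ t : ℕ in atTop, ∀ k < n, G t k ≠ 0 := by
    have : ∀ k ∈ Finset.range n, ∀ᶠ t : ℕ in atTop, G t k ≠ 0 := by
      intro k _
      filter_upwards [(hpar k).2.eventually_ne hσ] with t ht h0
      exact ht (by rw [h0, mul_zero])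
    filter_upwards [(Filter.eventually_all_finset _).2 this] with t ht k hk
    exact ht k (Finset.mem_range.2 hk)
  obtain ⟨p, q, hpq⟩ := hpoly n
  have hev : ∀ᶠ t : ℕ in atTop, B t n = p.eval (t : ℝ) ∧ G t n = q.eval (t : ℝ) := by
    filter_upwards [hgen, eventually_ge_atTop 1] with t ht ht1
    exact hpq t ht1 ht
  obtain ⟨b, hb⟩ : ∃ b, p - Polynomial.C β₀ * Polynomial.X = Polynomial.C b := by
    refine eq_C_of_tendsto_div_sqrt_nat ((hpar n).1.congr' ?_)
    filter_upwards [hev] with t ht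
    rw [ht.1]
    simp only [Polynomial.eval_sub, Polynomial.eval_mul, Polynomial.eval_C, Polynomial.eval_X]
    ring
  obtain ⟨c, hc⟩ : ∃ c, q - Polynomial.C σ * Polynomial.X = Polynomial.C c := by
    refine eq_C_of_tendsto_div_nat ?_
    have h1 := (hpar n).2.sub_const σ
    rw [sub_self] at h1
    refine h1.congr' ?_
    filter_upwards [hev, eventually_ge_atTop 1] with t ht ht1
    have h0 : (t : ℝ) ≠ 0 := by positivity
    rw [ht.2, inv_pow, Real.sq_sqrt (Nat.cast_nonneg t)]
    simp only [Polynomial.eval_sub, Polynomial.eval_mul, Polynomial.eval_C, Polynomial.eval_X]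
    field_simp
  refine ⟨b, c, ?_⟩
  filter_upwards [hev] with t ht
  have h1 := congrArg (Polynomial.eval (t : ℝ)) hb
  have h2 := congrArg (Polynomial.eval (t : ℝ)) hc
  simp only [Polynomial.eval_sub, Polynomial.eval_mul, Polynomial.eval_C, Polynomial.eval_X]
    at h1 h2
  rw [ht.1, ht.2]
  constructor <;> linarith

/-- Both sides have coefficients polynomial in ε which agree at the infinitely many points ε = 1/√t
with `t` large. A coefficient of order `k` involves only `k` levels of parameters, so one threshold
for `t` serves them all. -/
lemma homog_series_eq_jac
    (hM : ∀ t : ℕ, 1 ≤ t → IsFreeMoment (C (t : ℝ) * (C β₀ + X * κ)) (M t))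
    (hN : ∀ t : ℕ, 1 ≤ t → compX (M t) ρ * M t = jac (B t) (G t)) {b c : ℕ → ℝ}
    (hbc : ∀ n, ∀ᶠ t : ℕ in atTop, B t n - t * β₀ = b n ∧ G t n = σ * t + c n)
    {M₀ : (Polynomial ℝ)⟦X⟧} (hM₀ : IsFreeMoment (X * homog κ) M₀) :
    compX M₀ (homog ρ) * M₀ = jac (fun n => Polynomial.X * Polynomial.C (b n))
      (fun n => Polynomial.X ^ 2 * Polynomial.C (c n) + Polynomial.C σ) := by
  ext1 k
  have hev : ∀ᶠ t : ℕ in atTop, ∀ n < k, B t n - t * β₀ = b n ∧ G t n = σ * t + c n := by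
    filter_upwards [(Filter.eventually_all_finset (Finset.range k)).2 fun n _ => hbc n]
      with t ht n hn
    exact ht n (Finset.mem_range.2 hn)
  obtain ⟨T, hT⟩ := eventually_atTop.1 (hev.and (eventually_ge_atTop 1))
  refine Polynomial.eq_of_infinite_eval_eq _ _ (Set.Infinite.mono
    (s := (fun t : ℕ => (√(t : ℝ))⁻¹) '' Set.Ici T) ?_
    ((Set.Ici_infinite T).image fun s _ t _ hst => ?_))
  · rintro _ ⟨t, ht, rfl⟩
    obtain ⟨h1, h2⟩ := hT t ht
    change Polynomial.evalRingHom _ _ = Polynomial.evalRingHom _ _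
    rw [← coeff_map, ← coeff_map, homog_series_eval hM hN hM₀ h2, map_jac]
    refine coeff_jac_congr fun n hn _ => ?_
    rw [(h1 n hn).1, (h1 n hn).2]
    have h3 := nat_mul_inv_sqrt_sq h2
    simp only [Polynomial.coe_evalRingHom, Polynomial.eval_mul, Polynomial.eval_X,
      Polynomial.eval_C, Polynomial.eval_add, Polynomial.eval_pow, true_and]
    linear_combination σ * h3
  · have h1 := inv_injective hst
    have h2 := (Real.sqrt_inj (Nat.cast_nonneg s) (Nat.cast_nonneg t)).1 h1
    exact_mod_cast h2

/-- This is `compX_constTail_mul` over ℝ[ε] with β₀ = 0, γ₀ = σ and the remaining parameters scaled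
by ε and ε². -/
lemma homog_series_meixner {b' c' b c : ℝ} {M₀ : (Polynomial ℝ)⟦X⟧}
    (hM₀ : IsFreeMoment (X * homog (C σ * jac (fun _ => b) (fun _ => c))) M₀) :
    compX M₀ (homog (jac (constTail b' b) (constTail c' c))) * M₀ =
      jac (fun n => Polynomial.X * Polynomial.C (constTail b' b n))
        (fun n => Polynomial.X ^ 2 * Polynomial.C (constTail c' c n) + Polynomial.C σ) := by
  have hC : homog (C σ) = C (Polynomial.C σ) := by
    ext1 n
    rw [coeff_homog, coeff_C, coeff_C]
    split_ifs with hn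
    · simp [hn]
    · simp
  have hmul : ∀ f g : ℝ⟦X⟧, homog (f * g) = homog f * homog g := fun f g => by
    simp only [homog, map_mul]
  have h1 := isFreeMoment_meixner (0 : Polynomial ℝ) (Polynomial.C σ)
    (Polynomial.X * Polynomial.C b) (Polynomial.X ^ 2 * Polynomial.C c)
  rw [map_zero, zero_add] at h1
  have e : X * homog (C σ * jac (fun _ => b) (fun _ => c)) = C (Polynomial.C σ) * X *
      jac (fun _ => Polynomial.X * Polynomial.C b) (fun _ => Polynomial.X ^ 2 * Polynomial.C c) := by
    rw [hmul, hC, homog_jac]; ring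
  rw [← e] at h1
  rw [hM₀.moment_unique h1]
  have h2 := compX_constTail_mul (0 : Polynomial ℝ) (Polynomial.C σ)
    (Polynomial.X * Polynomial.C b) (Polynomial.X ^ 2 * Polynomial.C c)
    (Polynomial.X * Polynomial.C b') (Polynomial.X ^ 2 * Polynomial.C c')
  have ct : ∀ (f : ℝ → Polynomial ℝ) (x y : ℝ),
      constTail (f x) (f y) = fun n => f (constTail x y n) := by
    intro f x y
    funext n; cases n <;> rfl
  rw [homog_jac]
  simp only [add_zero] at h2 ⊢
  rw [ct (fun x => Polynomial.X * Polynomial.C x), ct (fun x => Polynomial.X ^ 2 * Polynomial.C x),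
    ct (fun x => Polynomial.X ^ 2 * Polynomial.C x + Polynomial.C σ)] at h2
  exact h2

/-- Two homogenized continued fractions that agree modulo `ε ^ 3` are equal. -/
lemma homog_params_unique (hσ : σ ≠ 0) {b c b' c' : ℕ → ℝ} {S : Type*} [CommRing S]
    (φ : Polynomial ℝ →+* S) (hφ : ∀ p, φ p = 0 ↔ Polynomial.X ^ 3 ∣ p)
    (h : (jac (fun n => Polynomial.X * Polynomial.C (b n))
        (fun n => Polynomial.X ^ 2 * Polynomial.C (c n) + Polynomial.C σ)).map φ =
      (jac (fun n => Polynomial.X * Polynomial.C (b' n))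
        (fun n => Polynomial.X ^ 2 * Polynomial.C (c' n) + Polynomial.C σ)).map φ) :
    b = b' ∧ c = c' := by
  have hu : ∀ n, IsUnit (φ (Polynomial.X ^ 2 * Polynomial.C (c n) + Polynomial.C σ)) := by
    intro n
    -- The inverse of σ + ε²c modulo ε³ is (σ - ε²c) / σ², since the error is a multiple of ε⁴.
    have h1 : φ (Polynomial.X ^ 2 * Polynomial.C (c n) + Polynomial.C σ) *
        φ ((Polynomial.C σ - Polynomial.X ^ 2 * Polynomial.C (c n)) * Polynomial.C (σ⁻¹ ^ 2)) =
        1 := by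
      rw [← map_mul, ← sub_eq_zero, ← map_one φ, ← map_sub, hφ]
      refine ⟨- (Polynomial.X * Polynomial.C (c n) ^ 2 * Polynomial.C (σ⁻¹ ^ 2)), ?_⟩
      have h2 : Polynomial.C σ * Polynomial.C σ * Polynomial.C (σ⁻¹ ^ 2) = 1 := by
        rw [← map_mul, ← map_mul, ← sq, ← mul_pow, mul_inv_cancel₀ hσ, one_pow, map_one]
      linear_combination h2
    exact IsUnit.of_mul_eq_one _ h1
  rw [map_jac, map_jac] at h
  have key := fun n => jac_params_unique n h fun k _ => hu k
  have coeff_zero : ∀ (p : Polynomial ℝ) (k : ℕ), k < 3 → φ p = 0 → p.coeff k = 0 :=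
    fun p k hk hp => Polynomial.X_pow_dvd_iff.1 ((hφ p).1 hp) k hk
  constructor
  · funext n
    have h1 := (key n).1
    rw [← sub_eq_zero, ← map_sub] at h1
    have h2 := coeff_zero _ 1 (by omega) h1
    simpa [sub_eq_zero] using h2
  · funext n
    have h1 := (key n).2
    rw [← sub_eq_zero, ← map_sub, add_sub_add_right_eq_sub] at h1
    have h2 := coeff_zero _ 2 (by omega) h1
    simpa [sub_eq_zero, Polynomial.coeff_X_pow_mul'] using h2

/-- Polynomial Jacobi parameters force the cumulant series to be of free Meixner type. -/
theorem meixner_of_polynomial_params (hσ : σ ≠ 0) (hκ : constantCoeff κ = σ)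
    (hρ : constantCoeff ρ = 1)
    (hM : ∀ t : ℕ, 1 ≤ t → IsFreeMoment (C (t : ℝ) * (C β₀ + X * κ)) (M t))
    (hN : ∀ t : ℕ, 1 ≤ t → compX (M t) ρ * M t = jac (B t) (G t))
    (hpoly : ∀ n, ∃ p q : Polynomial ℝ, ∀ t : ℕ, 1 ≤ t → (∀ k < n, G t k ≠ 0) →
      B t n = p.eval (t : ℝ) ∧ G t n = q.eval (t : ℝ)) :
    ∃ b' c' b c : ℝ, κ = C σ * jac (fun _ => b) (fun _ => c) ∧
      ρ = jac (constTail b' b) (constTail c' c) := by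
  choose b c hbc using exists_affine_params hσ hκ hρ hM hN hpoly
  -- The constants are dictated by matching the coefficients of order 1 and 2 of κ and ρ with those
  -- of a free Meixner pair.
  set b₁ := coeff 1 κ / σ with hb₁
  set c₁ := coeff 2 κ / σ - b₁ * b₁ with hc₁
  set b₂ := coeff 1 ρ with hb₂
  set c₂ := coeff 2 ρ - b₂ * b₂ with hc₂
  refine ⟨b₂, c₂, b₁, c₁, ?_⟩
  obtain ⟨M₀, hM₀⟩ := exists_isFreeMoment (X * homog κ)
  obtain ⟨M₁, hM₁⟩ := exists_isFreeMoment (X * homog (C σ * jac (fun _ => b₁) (fun _ => c₁)))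
  have e₀ := homog_series_eq_jac hM hN hbc hM₀
  have e₁ := homog_series_meixner (b' := b₂) (c' := c₂) hM₁
  have agκ : ∀ n < 3, coeff n κ = coeff n (C σ * jac (fun _ => b₁) (fun _ => c₁)) := by
    intro n hn
    rw [coeff_C_mul]
    interval_cases n
    · rw [coeff_zero_eq_constantCoeff_apply, coeff_zero_eq_constantCoeff_apply,
        constantCoeff_jac, hκ, mul_one]
    · simp only [jac, coeff_mk, jacPath, hb₁]
      field_simp
      ring
    · simp only [jac, coeff_mk, jacPath, hc₁]
      field_simp
      ring
  have agρ : ∀ n < 3, coeff n ρ = coeff n (jac (constTail b₂ b₁) (constTail c₂ c₁)) := by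
    intro n hn
    interval_cases n
    · rw [coeff_zero_eq_constantCoeff_apply, coeff_zero_eq_constantCoeff_apply,
        constantCoeff_jac, hρ]
    · simp [jac, jacPath, hb₂, constTail]
    · simp [jac, jacPath, hc₂, constTail]
  set I : Ideal (Polynomial ℝ) := Ideal.span {Polynomial.X ^ 3} with hI
  have hφ : ∀ p, Ideal.Quotient.mk I p = 0 ↔ Polynomial.X ^ 3 ∣ p := fun p => by
    rw [Ideal.Quotient.eq_zero_iff_mem, hI, Ideal.mem_span_singleton]
  have hφ3 := (hφ (Polynomial.X ^ 3)).2 dvd_rfl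
  have hMφ : M₀.map (Ideal.Quotient.mk I) = M₁.map (Ideal.Quotient.mk I) := by
    have h0 := hM₀.map (Ideal.Quotient.mk I)
    have h1 := hM₁.map (Ideal.Quotient.mk I)
    rw [map_mul, map_homog_congr _ hφ3 agκ, ← map_mul] at h0
    exact h0.moment_unique h1
  have hNφ : (compX M₀ (homog ρ) * M₀).map (Ideal.Quotient.mk I) =
      (compX M₁ (homog (jac (constTail b₂ b₁) (constTail c₂ c₁))) * M₁).map
        (Ideal.Quotient.mk I) := by
    rw [map_mul, map_mul, map_compX, map_compX, hMφ, map_homog_congr _ hφ3 agρ]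
  rw [e₀, e₁] at hNφ
  obtain ⟨hb, hc⟩ := homog_params_unique hσ (Ideal.Quotient.mk I) hφ hNφ
  -- Agreement modulo ε³ fixed every parameter, so the two series now agree exactly over ℝ[ε].
  rw [hb, hc, ← e₁] at e₀
  exact homog_pair_unique (constantCoeff_jac _ _) hM₀ hM₁ e₀

end PolynomialParameters

/-! ### From polynomial parameters to the Jacobi relations -/

section Necessity

open PowerSeries

variable {A : Type*} [CommRing A]

lemma C_add_X_mul_inj {a b : A} {f g : A⟦X⟧} (h : C a + X * f = C b + X * g) : a = b ∧ f = g := by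
  have h0 : a = b := by simpa using congrArg PowerSeries.constantCoeff h
  subst h0
  exact ⟨rfl, X_mul_cancel (add_left_cancel h)⟩

/-- Comparing the functional equation with the first continued fraction step strips one level: the
tail of the cumulant series governs the tail of the continued fraction. -/
lemma IsCFreeMoment.split {η M : A⟦X⟧} {β γ : ℕ → A} (h1 : PowerSeries.constantCoeff M = 1)
    (h : IsCFreeMoment η M (jac β γ)) : ∃ τ, η = C (β 0) + X * τ ∧
      PowerSeries.constantCoeff τ = γ 0 ∧
      compX M τ * M = C (γ 0) * jac (fun k => β (k + 1)) (fun k => γ (k + 1)) := by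
  have hu := isUnit_of_constantCoeff_eq_one (constantCoeff_jac β γ)
  have e : compX M η =
      C (β 0) + X * (C (γ 0) * jac (fun k => β (k + 1)) (fun k => γ (k + 1))) := by
    apply X_mul_cancel
    apply hu.mul_left_cancel
    have h2 := jac_eq β γ
    rw [IsCFreeMoment] at h
    linear_combination h2 - h
  obtain ⟨τ, hτ⟩ : ∃ τ, η = C (PowerSeries.constantCoeff η) + X * τ :=
    ⟨_, by rw [add_comm]; exact eq_X_mul_shift_add_const η⟩
  have e2 : C (PowerSeries.constantCoeff η) + X * (compX M τ * M) =
      C (β 0) + X * (C (γ 0) * jac (fun k => β (k + 1)) (fun k => γ (k + 1))) := by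
    rw [← e]
    conv_rhs => rw [hτ]
    rw [map_add, map_mul, compX_C, compX_X]
    ring
  obtain ⟨h3, h4⟩ := C_add_X_mul_inj e2
  refine ⟨τ, by rw [← h3]; exact hτ, ?_, h4⟩
  have h5 := congrArg PowerSeries.constantCoeff h4
  rw [map_mul, map_mul, h1, constantCoeff_jac, ← coeff_zero_eq_constantCoeff_apply (compX M τ),
    coeff_compX] at h5
  simpa using h5

/-- A continued fraction determines its genuine parameters; `γ 0 ≠ 0` makes `β 1`, `γ 1` genuine, so
they can serve as the common value. -/
lemma jacobiRelations_of_isMeixnerPair {μ' μ : Measure ℝ} [IsProbabilityMeasure μ']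
    [IsProbabilityMeasure μ] {β' γ' β γ : ℕ → ℝ} (hm' : momentSeries μ' = jac β' γ')
    (hm : momentSeries μ = jac β γ) (hγ : γ 0 ≠ 0) {b' c' b c : ℝ}
    (h : IsMeixnerPair μ' μ (β' 0) (γ' 0) (β 0) (γ 0) b' c' b c) : JacobiRelations β' γ' β γ := by
  obtain ⟨e, e'⟩ := isMeixnerPair_iff.1 h
  rw [hm] at e
  rw [hm'] at e'
  have key := fun n (hn : IsGenuine γ n) => jac_params_unique n e fun k hk => (hn k hk).isUnit
  have key' := fun n (hn : IsGenuine γ' n) => jac_params_unique n e' fun k hk => (hn k hk).isUnit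
  have h1 := key 1 fun k hk => by
    obtain rfl : k = 0 := by omega
    exact hγ
  intro n hn
  obtain ⟨n, rfl⟩ : ∃ k, n = k + 1 := ⟨n - 1, by omega⟩
  refine ⟨fun hg => ?_, fun hg => ?_⟩
  · have h2 := key _ hg
    exact ⟨h2.1.trans h1.1.symm, h2.2.trans h1.2.symm⟩
  · have h2 := key' _ hg
    exact ⟨h2.1.trans h1.1.symm, h2.2.trans h1.2.symm⟩

theorem jacobiRelations_of_polynomial {μ' μ : Measure ℝ} [IsProbabilityMeasure μ']
    [IsProbabilityMeasure μ] (hμ' : HasAllMoments μ') (hμ : HasAllMoments μ)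
    {β' γ' β γ : ℕ → ℝ} (hJ' : HasJacobiParameters μ' β' γ') (hJ : HasJacobiParameters μ β γ)
    (hp' : ¬ IsPointMass μ') (hp : ¬ IsPointMass μ) {ν' ν : ℕ → Measure ℝ}
    (hν : ∀ t : ℕ, 1 ≤ t → IsCFreePower (t : ℝ) μ' μ (ν' t) (ν t))
    (hpoly : HasPolynomialJacobiParameters ν') : JacobiRelations β' γ' β γ := by
  have hm := hJ.momentSeries hμ
  have hm' := hJ'.momentSeries hμ'
  have hγ : γ 0 ≠ 0 := fun h => hp ((isPointMass_iff hμ hm).2 h)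
  have hγ' : γ' 0 ≠ 0 := fun h => hp' ((isPointMass_iff hμ' hm').2 h)
  have hf : IsCFreeMoment (freeCumulantSeries μ) (momentSeries μ) (momentSeries μ) :=
    isFreeMoment_momentSeries μ
  obtain ⟨κ, hκ, hκ0, -⟩ := IsCFreeMoment.split (isFreeMoment_momentSeries μ).constantCoeff
    (hm ▸ hf : IsCFreeMoment (freeCumulantSeries μ) (momentSeries μ) (jac β γ))
  obtain ⟨τ, hτ, hτ0, -⟩ := IsCFreeMoment.split (isFreeMoment_momentSeries μ).constantCoeff
    (hm' ▸ isCFreeMoment_momentSeries μ' μ)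
  obtain ⟨B, G, hBG, hpq⟩ := hpoly
  have hinv : C (γ' 0) * C (γ' 0)⁻¹ = (1 : ℝ⟦X⟧) := by
    rw [← map_mul, mul_inv_cancel₀ hγ', map_one]
  have hM : ∀ t : ℕ, 1 ≤ t →
      IsFreeMoment (C (t : ℝ) * (C (β 0) + X * κ)) (momentSeries (ν t)) := by
    intro t ht
    have := (hν t ht).isProbabilityMeasure
    rw [← hκ, ← freeCumulantSeries_smul_iff.1 (hν t ht).freeCumulant_eq]
    exact isFreeMoment_momentSeries (ν t)
  -- Dividing out tγ₀', the parameters of `ν' t` from index 1 on are those of ρ(XM_t) M_t with ρ = τ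
  -- / γ₀' independent of `t`.
  have hstep : ∀ t : ℕ, 1 ≤ t → G t 0 = t * γ' 0 ∧
      compX (momentSeries (ν t)) (C (γ' 0)⁻¹ * τ) * momentSeries (ν t) =
        jac (fun n => B t (n + 1)) (fun n => G t (n + 1)) := by
    intro t ht
    have := (hν t ht).isProbabilityMeasure
    have := (hν t ht).isProbabilityMeasure'
    have h1 := isCFreeMoment_momentSeries (ν' t) (ν t)
    rw [(hBG t ht).momentSeries (hν t ht).hasAllMoments',
      cfreeCumulantSeries_smul_iff.1 (hν t ht).cfreeCumulant_eq, hτ] at h1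
    obtain ⟨τ', h2, h3, h4⟩ := h1.split (hM t ht).constantCoeff
    have h5 : C ((t : ℝ) * β' 0) + X * (C (t : ℝ) * τ) = C (B t 0) + X * τ' := by
      rw [← h2, map_mul]; ring
    obtain ⟨-, rfl⟩ := C_add_X_mul_inj h5
    have h6 : G t 0 = t * γ' 0 := by
      rw [← h3, map_mul, hτ0, constantCoeff_C]
    refine ⟨h6, ?_⟩
    have ht0 : (t : ℝ) * γ' 0 ≠ 0 := mul_ne_zero (by positivity) hγ'
    apply ((isUnit_iff_ne_zero.2 ht0).map (C (R := ℝ))).mul_left_cancel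
    rw [h6] at h4
    rw [← h4]
    simp only [map_mul, compX_C]
    linear_combination C (t : ℝ) * compX (momentSeries (ν t)) τ * momentSeries (ν t) * hinv
  obtain ⟨b', c', b, c, h1, h2⟩ := meixner_of_polynomial_params hγ hκ0
    (by rw [map_mul, hτ0, constantCoeff_C, inv_mul_cancel₀ hγ']) hM
    (fun t ht => (hstep t ht).2) (fun n => by
      -- Indices are shifted by one, and G_t(0) = tγ₀' ≠ 0 supplies the missing genuineness
      -- condition.
      obtain ⟨p, q, h⟩ := hpq (n + 1)
      refine ⟨p, q, fun t ht hg => h t ht ?_⟩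
      rintro (_ | k) hk
      · rw [(hstep t ht).1]
        exact mul_ne_zero (by positivity) hγ'
      · exact hg k (by omega))
  refine jacobiRelations_of_isMeixnerPair hm' hm hγ (b' := b') (c' := c') (b := b) (c := c)
    ⟨?_, ?_⟩
  · rw [hκ, h1]; ring
  · rw [tail₁_eq_constTail, tail₁_eq_constTail, ← h2, hτ]
    linear_combination - X * τ * hinv

lemma isMeixnerPair_of_relations {μ' μ : Measure ℝ} [IsProbabilityMeasure μ']
    [IsProbabilityMeasure μ] (hμ' : HasAllMoments μ') (hμ : HasAllMoments μ)
    {β' γ' β γ : ℕ → ℝ} (hJ' : HasJacobiParameters μ' β' γ') (hJ : HasJacobiParameters μ β γ)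
    (hrel : JacobiRelations β' γ' β γ) :
    IsMeixnerPair μ' μ (β' 0) (γ' 0) (β 0) (γ 0) (β' 1 - β 0) (γ' 1 - γ 0) (β 1 - β 0)
      (γ 1 - γ 0) := by
  rw [isMeixnerPair_iff]
  simp only [sub_add_cancel]
  exact (momentSeries_of_relations hμ' hμ hJ' hJ hrel).symm

/-- When γ₀' = 0 the continued fraction containing c' is multiplied by zero. -/
lemma IsMeixnerPair.of_pointMass {μ' μ : Measure ℝ} {β₀' β₀ γ₀ b' c' b c : ℝ} (c'' : ℝ)
    (h : IsMeixnerPair μ' μ β₀' 0 β₀ γ₀ b' c' b c) : IsMeixnerPair μ' μ β₀' 0 β₀ γ₀ b' c'' b c :=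
  ⟨h.free, by rw [h.cfree, map_zero, zero_mul, zero_mul, zero_mul]⟩

end Necessity

end

end TwoState

/-! ### The theorem -/

theorem mainTheorem1
    (μ' μ : Measure ℝ) [IsProbabilityMeasure μ'] [IsProbabilityMeasure μ]
    (hμ' : HasAllMoments μ') (hμ : HasAllMoments μ)
    (β' γ' β γ : ℕ → ℝ)
    (hJ' : HasJacobiParameters μ' β' γ') (hJ : HasJacobiParameters μ β γ) :
    -- polynomial Jacobi parameters force the relations
    (¬ IsPointMass μ' → ¬ IsPointMass μ →
      ∀ ν' ν : ℕ → Measure ℝ,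
        (∀ t : ℕ, 1 ≤ t → IsCFreePower (t : ℝ) μ' μ (ν' t) (ν t)) →
        HasPolynomialJacobiParameters ν' →
          JacobiRelations β' γ' β γ ∧
          HasJacobiParameters μ' (tail₂ (β' 0) (β' 1) (β 1)) (tail₂ (γ' 0) (γ' 1) (γ 1)) ∧
          HasJacobiParameters μ (tail₁ (β 0) (β 1)) (tail₁ (γ 0) (γ 1)) ∧
          IsFreeMeixner μ) ∧
    -- the converse
    (JacobiRelations β' γ' β γ →
      ∀ b' b c' c : ℝ, b' = β' 1 - β 0 → b = β 1 - β 0 → c' = γ' 1 - γ 0 → c = γ 1 - γ 0 →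
        (∀ t : ℝ, 0 ≤ t → 0 ≤ c + γ 0 * t → 0 ≤ c' + γ 0 * t →
          (∃ ν' ν : Measure ℝ, IsCFreePower t μ' μ ν' ν) ∧
          ∀ ν' ν : Measure ℝ, IsCFreePower t μ' μ ν' ν →
            HasJacobiParameters ν'
              (tail₂ (β' 0 * t) (b' + β 0 * t) (b + β 0 * t))
              (tail₂ (γ' 0 * t) (c' + γ 0 * t) (c + γ 0 * t)) ∧
            HasJacobiParameters ν
              (tail₁ (β 0 * t) (b + β 0 * t))
              (tail₁ (γ 0 * t) (c + γ 0 * t))) ∧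
        (¬ IsPointMass μ' → (IsCFreeInfinitelyDivisible μ' μ ↔ 0 ≤ c ∧ 0 ≤ c')) ∧
        -- if `μ'` is a point mass then `γ' 1`, hence `c'`, is not determined by `μ'`
        (IsPointMass μ' → (IsCFreeInfinitelyDivisible μ' μ ↔ 0 ≤ c)) ∧
        (0 ≤ c → 0 ≤ c' →
          ∃ ρ : Measure ℝ, IsProbabilityMeasure ρ ∧ HasAllMoments ρ ∧ IsFreeMeixner ρ ∧
            HasJacobiParameters ρ (tail₁ b' b) (tail₁ c' c) ∧
            ∃ ε : ℝ, 0 < ε ∧ ∀ z : ℂ, ‖z‖ < ε →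
              Integrable (fun x : ℝ => 1 / (1 - (x : ℂ) * z)) ρ ∧
              HasSum (fun k : ℕ => (cfreeCumulant μ' μ (k + 1) : ℂ) * z ^ (k + 1))
                ((β' 0 : ℂ) * z + (γ' 0 : ℂ) * z ^ 2 *
                  ∫ x : ℝ, 1 / (1 - (x : ℂ) * z) ∂ρ))) := by
  have h0 := hJ.nonneg 0
  have h0' := hJ'.nonneg 0
  constructor
  · intro hp' hp ν' ν hν hpoly
    have hrel := jacobiRelations_of_polynomial hμ' hμ hJ' hJ hp' hp hν hpoly
    exact ⟨hrel, hasJacobiParameters_of_relations hμ' hμ hJ' hJ hrel⟩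
  · rintro hrel b' b c' c rfl rfl rfl rfl
    have hpair := isMeixnerPair_of_relations hμ' hμ hJ' hJ hrel
    have hpm := isPointMass_iff hμ' (hJ'.momentSeries hμ')
    have hc_of : IsCFreeInfinitelyDivisible μ' μ → 0 ≤ γ 1 - γ 0 := by
      intro hid
      -- If γ₀ = 0 then `γ 1` is an arbitrary filler, but a nonnegative one by convention, and c =
      -- γ₁.
      rcases h0.eq_or_lt with h | h
      · rw [← h, sub_zero]; exact hJ.nonneg 1
      · exact (hpair.nonneg_of_infinitelyDivisible hid).1 h
    refine ⟨fun t ht hc hc' => ⟨hpair.exists_power h0' h0 ht hc hc', fun ν' ν hp =>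
      hpair.hasJacobiParameters_power h0' h0 ht hc hc' hp⟩, fun hn => ⟨fun hid => ⟨hc_of hid, ?_⟩,
      fun hc => hpair.infinitelyDivisible hμ' hμ h0' h0 hc.1 hc.2⟩,
      fun hd => ⟨hc_of, fun hc => ?_⟩, hpair.exists_representing_measure⟩
    · refine (hpair.nonneg_of_infinitelyDivisible hid).2 (h0'.lt_of_ne fun h => ?_)
      exact hn (hpm.2 h.symm)
    · rw [hpm.1 hd] at hpair
      -- The undetermined c' may be taken to be 0, which meets the sign condition.
      exact (hpair.of_pointMass 0).infinitelyDivisible hμ' hμ le_rfl h0 hc le_rfl
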